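/- **Setting.** Let $\Omega=\mathbb T^d=\mathbb R^d/\mathbb Z^d$ with Lebesgue measure, $T>0$, and $(f,g)=\int_\Omega f\cdot g\,dx$; for $N\times N$ matrices $A:B=\sum_{l,m}A_{lm}B_{lm}$, $\mathbb R^{N\times N}_s$ are the symmetric and $\mathbb R^{N\times N}_+$ the nonnegative-definite matrices. Let $L$ be a differential operator with constant coefficients, $$L(\Xi)_i=\sum_{j=0}^{\nu}\sum_{l,m=1}^N\sum_{|\alpha|=j}b_{ilm\alpha}\,\partial_\alpha\Xi_{lm},\qquad i=1,\dots,n,\quad \Xi:\Omega\to\mathbb R^{N\times N}_s,$$ let $L^*$ be its (symmetric-matrix-valued) adjoint, and let $\Lambda\subset\mathbb R^{N\times N}_s$ be the smallest linear subspace that contains $I$ and all values $L^*u(x)$, $u:\Omega\to\mathbb R^n$ smooth, $x\in\Omega$. For $A,B\in\mathbb R^{N\times N}_s$ write $B\le A$ if $(A-B):P\ge 0$ for all $P\in\Lambda\cap\mathbb R^{N\times N}_+$. Let $\mathbf F:\mathbb R^n\to\mathbb R^{N\times N}_s$ be $C^2$ and $\mathbf K(v)=\frac12\operatorname{tr}(\mathbf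 F(v)-\mathbf F(0))$. A Young function is an even convex $\Phi:\mathbb R\to[0,\infty)$, vanishing only at $0$, with $\Phi(s)/s\to0$ as $s\to0$ and $\Phi(s)/s\to+\infty$ as $s\to+\infty$. An $N$-function is an even convex $\mathbf G:\mathbb R^n\to[0,\infty)$ with $\Phi_-(|y|)\le\mathbf G(y)\le\Phi_+(|y|)$ for some Young functions $\Phi_\pm$; it satisfies the $\Delta_2$-condition if $\mathbf G(2y)\le C(\mathbf G(y)+1)$ for some constant $C$. $L_{\mathbf G}(Q)$ is the set of measurable $f$ with $\int_Q\mathbf G(f)<\infty$, and $\mathbf K^*$ is the Legendre transform of $\mathbf K$. Assume: (1) $\mathbf K$ is a strictly convex $N$-function, and $\mathbf K,\mathbf K^*$ satisfy the $\Delta_2$-condition; (2) $v\mapsto\mathbf F(v):P$ is convex for every $P\in\Lambda\cap\mathbb R^{N\times N}_+$; (3) $\mathbf F(v)\ge 0$ for all $v$, and $|\pi_\Lambda\partial_l\mathbf F(v)|\le C(|\nabla\mathbf K(v)|+1)$ for all $v,l$ with a constant $C$, where $\pi_\Lambda$ is the Frobenius-orthogonal projection onto $\Lambda$; (4) writing $v^\#=\nabla\mathbf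 K(v)$, one has $(\mathbf F(v),L^*(v^\#))=0$ whenever $v^\#:\Omega\to\mathbb R^n$ is smooth. Consider the problem $\partial_tv=L(\mathbf F(v))$, $v(0,\cdot)=v_0$, with $v_0\in L_{\mathbf K}(\Omega;\mathbb R^n)$. A *test pair* is $(E,B)\in L_{\mathbf K^*}((0,T)\times\Omega;\mathbb R^n)\times L^\infty((0,T)\times\Omega;\mathbb R^{N\times N}_s)$ with $\int_0^T[(B,\partial_t\Psi)+(E,L\Psi)]\,dt=0$ for all smooth $\Psi:[0,T]\times\Omega\to\mathbb R^{N\times N}_s$ with $\Psi(0)=0$. * A *weak solution* is $v\in L_{\mathbf K}((0,T)\times\Omega;\mathbb R^n)$ with $\int_0^T[(v-v_0,E)+(\mathbf F(v),B)]\,dt=0$ for all test pairs. * A *subsolution* is $(u,M)\in L_{\mathbf K}((0,T)\times\Omega;\mathbb R^n)\times L^1((0,T)\times\Omega;\mathbb R^{N\times N}_s)$ with $\mathbf F(u)\le M$ a.e. and $\int_0^T[(u-v_0,E)+(M,B)]\,dt=0$ for all test pairs. * Fix a measurable weight $\kappa$ bounded away from $0$ and $\infty$ on $[0,T]$ and let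 $H(t)=\int_t^T\kappa(s)\,ds$. A *strong solution* is a weak solution $v$ such that $\partial_t(Hv^\#)\in L_{\mathbf K^*}((0,T)\times\Omega;\mathbb R^n)$, $H\,L^*(v^\#)\in L^\infty((0,T)\times\Omega;\mathbb R^{N\times N}_s)$, and $\partial_t(v^\#)_l+L^*(v^\#):\partial_l\mathbf F(v)=0$ a.e. in $(0,T)\times\Omega$ for $l=1,\dots,n$ (derivatives being distributional), with $v^\#(0,\cdot)=(v_0)^\#$ in the sense of the trace in time in $L^1(\Omega)$. **Theorem (Dafermos' principle).** Let $v$ be a strong solution on $[0,T]$ with total entropy $K(t)=\int_\Omega\mathbf K(v(t,x))\,dx$, and let $(u,M)$ be a subsolution on $[0,T]$, with the same initial datum $v_0$ and with total entropy $\tilde K(t)=\frac12(M(t,\cdot)-\mathbf F(0),I)$. Then the total entropy of $v$ is conserved, $K(t)=K(0)=\int_\Omega\mathbf K(v_0)\,dx$ for a.a. $t\in(0,T)$, and for any $0\le t_0<t_1\le T$ it cannot simultaneously be that $\tilde K(t)\le K(t)$ for a.a. $t\in(0,t_1)$ and $\tilde K(t)<K(t)$ for a.a. $t\in(t_0,t_1)$.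 In particular, for no $\varepsilon\in(0,T]$ is $\tilde K(t)<K(t)$ for a.a. $t\in(0,\varepsilon)$. -/

import Mathlib

open MeasureTheory Filter Topology Set
open scoped ContDiff

namespace Dafermos

noncomputable section

/-! ### Young functions, `N`-functions, Legendre transform, Orlicz classes -/

/-- Young functions on the real line. -/
structure IsYoung (Φ : ℝ → ℝ) : Prop where
  convex : ConvexOn ℝ univ Φ
  nonneg : ∀ s, 0 ≤ Φ s
  even : ∀ s, Φ (-s) = Φ s
  eq_zero_iff : ∀ s, Φ s = 0 ↔ s = 0
  limit_zero : Tendsto (fun s => Φ s / s) (𝓝[≠] 0) (𝓝 0)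
  limit_top : Tendsto (fun s => Φ s / s) atTop atTop

/-- (Anisotropic) `N`-functions on `ℝⁿ`. -/
structure IsNFunction {n : ℕ} (K : EuclideanSpace ℝ (Fin n) → ℝ) : Prop where
  convex : ConvexOn ℝ univ K
  nonneg : ∀ y, 0 ≤ K y
  even : ∀ y, K (-y) = K y
  squeeze : ∃ Φ₁ Φ₂ : ℝ → ℝ, IsYoung Φ₁ ∧ IsYoung Φ₂ ∧ ∀ y, Φ₁ ‖y‖ ≤ K y ∧ K y ≤ Φ₂ ‖y‖

/-- The `Δ₂`-condition `K (2y) ≲ K y + 1`. -/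
def DeltaTwo {n : ℕ} (K : EuclideanSpace ℝ (Fin n) → ℝ) : Prop :=
  ∃ C : ℝ, ∀ y, K ((2 : ℝ) • y) ≤ C * (K y + 1)

/-- The Legendre transform `K^*(y) = sup_x (x · y - K x)`; the supremum is finite when `K` is an
`N`-function. -/
def legendre {n : ℕ} (K : EuclideanSpace ℝ (Fin n) → ℝ) (y : EuclideanSpace ℝ (Fin n)) : ℝ :=
  ⨆ x : EuclideanSpace ℝ (Fin n), (inner ℝ x y - K x)

/-- The Orlicz class: measurable functions whose modular `∫ K(f)` is finite. -/
def MemOrlicz {X : Type*} [MeasurableSpace X] {n : ℕ} (K : EuclideanSpace ℝ (Fin n) → ℝ)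
    (f : X → EuclideanSpace ℝ (Fin n)) (μ : Measure X) : Prop :=
  AEStronglyMeasurable f μ ∧ Integrable (fun x => K (f x)) μ

/-! ### Matrices -/

/-- The Frobenius product `A : B`. -/
def frob {N : ℕ} (A B : Matrix (Fin N) (Fin N) ℝ) : ℝ := ∑ l, ∑ m, A l m * B l m

/-- `P` is the orthogonal projection of `A` onto the subspace `Λ` for the Frobenius product. -/
def IsFrobProj {N : ℕ} (Λ : Submodule ℝ (Matrix (Fin N) (Fin N) ℝ))
    (A P : Matrix (Fin N) (Fin N) ℝ) : Prop :=
  P ∈ Λ ∧ ∀ Q ∈ Λ, frob (A - P) Q = 0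

/-- `A` is nonnegative in the `Λ`-order: `A : P ≥ 0` for all nonnegative-definite `P ∈ Λ`. -/
def LambdaNonneg {N : ℕ} (Λ : Submodule ℝ (Matrix (Fin N) (Fin N) ℝ))
    (A : Matrix (Fin N) (Fin N) ℝ) : Prop :=
  A.IsSymm ∧ ∀ P ∈ Λ, P.PosSemidef → 0 ≤ frob A P

/-! ### The flat torus `𝕋^d = ℝ^d / ℤ^d`

It is represented by its fundamental cell `[0,1)^d`: a measurable function on the torus is a
function on the cell, a smooth function on the torus is a smooth `ℤ^d`-periodic function. -/

/-- The fundamental cell of the torus. -/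
def cell (d : ℕ) : Set (Fin d → ℝ) := Set.pi univ fun _ => Ico (0 : ℝ) 1

/-- The space-time domain `(0,T) × 𝕋^d`. -/
def cylinder (d : ℕ) (T : ℝ) : Set (ℝ × (Fin d → ℝ)) := Ioo 0 T ×ˢ cell d

/-- Invariance under translations in `ℤ^d`. -/
def IsPeriodic {d : ℕ} (g : (Fin d → ℝ) → ℝ) : Prop :=
  ∀ (k : Fin d → ℤ) (x : Fin d → ℝ), g (x + fun i => (k i : ℝ)) = g x

/-- Smooth vector fields on the torus. -/
def SmoothVec {d n : ℕ} (u : (Fin d → ℝ) → EuclideanSpace ℝ (Fin n)) : Prop :=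
  ∀ i, ContDiff ℝ ∞ (fun x => u x i) ∧ IsPeriodic (fun x => u x i)

/-- Smooth scalar fields of `(t,x)` that are periodic in `x`. -/
def SmoothST {d : ℕ} (f : ℝ × (Fin d → ℝ) → ℝ) : Prop :=
  ContDiff ℝ ∞ f ∧ ∀ t, IsPeriodic (fun x => f (t, x))

/-- Smooth space-time vector fields. -/
def SmoothVecST {d n : ℕ} (φ : ℝ × (Fin d → ℝ) → EuclideanSpace ℝ (Fin n)) : Prop :=
  ∀ i, SmoothST (fun p => φ p i)

/-- Smooth space-time fields of symmetric matrices. -/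
def SmoothMatST {d N : ℕ} (Ψ : ℝ × (Fin d → ℝ) → Matrix (Fin N) (Fin N) ℝ) : Prop :=
  (∀ p, (Ψ p).IsSymm) ∧ ∀ l m, SmoothST (fun p => Ψ p l m)

/-- The field vanishes outside a compact subinterval of `(0,T)` in time. -/
def CompactInTime {d : ℕ} {V : Type*} [Zero V] (T : ℝ) (f : ℝ × (Fin d → ℝ) → V) : Prop :=
  ∃ a b : ℝ, 0 < a ∧ b < T ∧ ∀ t x, t ∉ Icc a b → f (t, x) = 0

/-- The time derivative of a vector field. -/
def dtVec {d n : ℕ} (φ : ℝ × (Fin d → ℝ) → EuclideanSpace ℝ (Fin n)) (p : ℝ × (Fin d → ℝ)) :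
    EuclideanSpace ℝ (Fin n) :=
  deriv (fun s => φ (s, p.2)) p.1

/-- The time derivative of a matrix field. -/
def dtMat {d N : ℕ} (Ψ : ℝ × (Fin d → ℝ) → Matrix (Fin N) (Fin N) ℝ) (p : ℝ × (Fin d → ℝ)) :
    Matrix (Fin N) (Fin N) ℝ :=
  Matrix.of fun l m => deriv (fun s => Ψ (s, p.2) l m) p.1

/-! ### Differential operators with constant coefficients -/

/-- The partial derivative `∂_i`. -/
def pd {d : ℕ} (i : Fin d) (g : (Fin d → ℝ) → ℝ) : (Fin d → ℝ) → ℝ :=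
  fun x => fderiv ℝ g x (Pi.single i 1)

/-- The partial derivative `∂_α` for a multiindex `α`. -/
def pdMulti {d : ℕ} (α : Fin d → ℕ) (g : (Fin d → ℝ) → ℝ) : (Fin d → ℝ) → ℝ :=
  (List.finRange d).foldr (fun i h => (pd i)^[α i] h) g

/-- The data (order `ν` and coefficients `b_{ilmα}`) of a differential operator that maps
fields of symmetric `N × N` matrices to fields of vectors in `ℝⁿ`. -/
structure DiffOp (d n N : ℕ) where
  order : ℕ
  coeff : Fin n → Fin N → Fin N → (Fin d → ℕ) → ℝ

/-- `L(Ξ)_i = ∑_{j ≤ ν} ∑_{l,m} ∑_{|α| = j} b_{ilmα} ∂_α Ξ_{lm}`. -/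
def DiffOp.app {d n N : ℕ} (L : DiffOp d n N) (Ξ : (Fin d → ℝ) → Matrix (Fin N) (Fin N) ℝ)
    (x : Fin d → ℝ) : EuclideanSpace ℝ (Fin n) :=
  WithLp.toLp 2 fun i => ∑ j ∈ Finset.range (L.order + 1), ∑ l, ∑ m,
    ∑ α ∈ Finset.piAntidiag Finset.univ j, L.coeff i l m α * pdMulti α (fun y => Ξ y l m) x

/-- The adjoint operator `L^*`, with values in the symmetric matrices. -/
def DiffOp.adj {d n N : ℕ} (L : DiffOp d n N) (u : (Fin d → ℝ) → EuclideanSpace ℝ (Fin n))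
    (x : Fin d → ℝ) : Matrix (Fin N) (Fin N) ℝ :=
  Matrix.of fun l m => ∑ j ∈ Finset.range (L.order + 1), (-1 : ℝ) ^ j * ∑ i,
    ∑ α ∈ Finset.piAntidiag Finset.univ j,
      (L.coeff i l m α + L.coeff i m l α) / 2 * pdMulti α (fun y => u y i) x

/-- `L Ψ` for a space-time field `Ψ` (`L` acts in the space variables). -/
def DiffOp.appST {d n N : ℕ} (L : DiffOp d n N)
    (Ψ : ℝ × (Fin d → ℝ) → Matrix (Fin N) (Fin N) ℝ) (p : ℝ × (Fin d → ℝ)) :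
    EuclideanSpace ℝ (Fin n) :=
  L.app (fun y => Ψ (p.1, y)) p.2

/-- `Λ`: the smallest linear space of matrices that contains `I` and all the values of `L^* u`
for smooth `u` on the torus. -/
def DiffOp.Lam {d n N : ℕ} (L : DiffOp d n N) : Submodule ℝ (Matrix (Fin N) (Fin N) ℝ) :=
  Submodule.span ℝ ({1} ∪ {P | ∃ (u : (Fin d → ℝ) → EuclideanSpace ℝ (Fin n)) (x : Fin d → ℝ),
    SmoothVec u ∧ P = L.adj u x})

/-! ### The abstract problem `∂_t v = L(F(v))`, `v(0) = v₀` -/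

/-- The entropy function `K(v) = ½ tr (F(v) - F(0))`. -/
def entropy {n N : ℕ} (F : EuclideanSpace ℝ (Fin n) → Matrix (Fin N) (Fin N) ℝ)
    (v : EuclideanSpace ℝ (Fin n)) : ℝ :=
  (1 / 2) * (F v - F 0).trace

/-- The sharp map `v ↦ v^# = ∇K(v)`. -/
def sharp {n N : ℕ} (F : EuclideanSpace ℝ (Fin n) → Matrix (Fin N) (Fin N) ℝ)
    (v : EuclideanSpace ℝ (Fin n)) : EuclideanSpace ℝ (Fin n) :=
  gradient (entropy F) v

/-- The partial derivative `∂_l F(v)`. -/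
def partialF {n N : ℕ} (F : EuclideanSpace ℝ (Fin n) → Matrix (Fin N) (Fin N) ℝ) (l : Fin n)
    (v : EuclideanSpace ℝ (Fin n)) : Matrix (Fin N) (Fin N) ℝ :=
  Matrix.of fun a b => fderiv ℝ (fun z => F z a b) v (EuclideanSpace.single l 1)

/-- The standing assumptions on the flux `F` and the operator `L`. -/
structure StandingAssumptions {d n N : ℕ} (L : DiffOp d n N)
    (F : EuclideanSpace ℝ (Fin n) → Matrix (Fin N) (Fin N) ℝ) : Prop where
  /-- `F` is a `C²` function with values in the symmetric matrices. -/
  symm : ∀ v, (F v).IsSymm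
  smooth : ∀ a b, ContDiff ℝ 2 (fun v => F v a b)
  /-- The entropy is a strictly convex `N`-function, and it and its Legendre transform satisfy
  the `Δ₂`-condition. -/
  strictConvex : StrictConvexOn ℝ univ (entropy F)
  nFunction : IsNFunction (entropy F)
  deltaTwo : DeltaTwo (entropy F)
  deltaTwo_legendre : DeltaTwo (legendre (entropy F))
  /-- `Λ`-convexity of `F`. -/
  lambdaConvex : ∀ P ∈ L.Lam, P.PosSemidef → ConvexOn ℝ univ (fun v => frob (F v) P)
  /-- `F ≥ 0` in the `Λ`-order. -/
  lambdaNonneg : ∀ v, LambdaNonneg L.Lam (F v)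
  /-- `|π_Λ ∂_l F(v)| ≲ |∇K(v)| + 1`. -/
  derivBound : ∃ C : ℝ, ∀ (l : Fin n) (v : EuclideanSpace ℝ (Fin n))
    (P : Matrix (Fin N) (Fin N) ℝ), IsFrobProj L.Lam (partialF F l v) P →
      Real.sqrt (frob P P) ≤ C * (‖sharp F v‖ + 1)
  /-- Formal conservativity: `(F(v), L^*(v^#)) = 0` whenever `v^#` is smooth on the torus. -/
  conservative : ∀ v : (Fin d → ℝ) → EuclideanSpace ℝ (Fin n),
    SmoothVec (fun x => sharp F (v x)) →
      ∫ x in cell d, frob (F (v x)) (L.adj (fun y => sharp F (v y)) x) = 0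

/-- Admissible test pairs: `E ∈ L_{K^*}`, `B ∈ L^∞` symmetric, subject to the weak form of
`∂_t B = L^* E`, `B(T) = 0`. -/
structure IsTestPair {d n N : ℕ} (L : DiffOp d n N)
    (F : EuclideanSpace ℝ (Fin n) → Matrix (Fin N) (Fin N) ℝ) (T : ℝ)
    (E : ℝ × (Fin d → ℝ) → EuclideanSpace ℝ (Fin n))
    (B : ℝ × (Fin d → ℝ) → Matrix (Fin N) (Fin N) ℝ) : Prop where
  memE : MemOrlicz (legendre (entropy F)) E (volume.restrict (cylinder d T))
  memB : ∀ l m, MemLp (fun p => B p l m) ⊤ (volume.restrict (cylinder d T))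
  symmB : ∀ᵐ p ∂(volume.restrict (cylinder d T)), (B p).IsSymm
  constraint : ∀ Ψ : ℝ × (Fin d → ℝ) → Matrix (Fin N) (Fin N) ℝ,
    SmoothMatST Ψ → (∀ x, Ψ (0, x) = 0) →
      ∫ p in cylinder d T, (frob (B p) (dtMat Ψ p) + inner ℝ (E p) (L.appST Ψ p)) = 0

/-- Weak solutions on `[0,T]` with initial datum `v₀`. -/
structure IsWeakSolution {d n N : ℕ} (L : DiffOp d n N)
    (F : EuclideanSpace ℝ (Fin n) → Matrix (Fin N) (Fin N) ℝ) (T : ℝ)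
    (v₀ : (Fin d → ℝ) → EuclideanSpace ℝ (Fin n))
    (v : ℝ × (Fin d → ℝ) → EuclideanSpace ℝ (Fin n)) : Prop where
  mem : MemOrlicz (entropy F) v (volume.restrict (cylinder d T))
  weak : ∀ E B, IsTestPair L F T E B →
    ∫ p in cylinder d T, (inner ℝ (v p - v₀ p.2) (E p) + frob (F (v p)) (B p)) = 0

/-- Subsolutions `(u, M)` on `[0,T]` with initial datum `v₀`; `F(u) ≤ M` in the `Λ`-order. -/
structure IsSubsolution {d n N : ℕ} (L : DiffOp d n N)
    (F : EuclideanSpace ℝ (Fin n) → Matrix (Fin N) (Fin N) ℝ) (T : ℝ)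
    (v₀ : (Fin d → ℝ) → EuclideanSpace ℝ (Fin n))
    (u : ℝ × (Fin d → ℝ) → EuclideanSpace ℝ (Fin n))
    (M : ℝ × (Fin d → ℝ) → Matrix (Fin N) (Fin N) ℝ) : Prop where
  memu : MemOrlicz (entropy F) u (volume.restrict (cylinder d T))
  memM : ∀ l m, Integrable (fun p => M p l m) (volume.restrict (cylinder d T))
  symmM : ∀ᵐ p ∂(volume.restrict (cylinder d T)), (M p).IsSymm
  le : ∀ᵐ p ∂(volume.restrict (cylinder d T)), LambdaNonneg L.Lam (M p - F (u p))
  weak : ∀ E B, IsTestPair L F T E B →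
    ∫ p in cylinder d T, (inner ℝ (u p - v₀ p.2) (E p) + frob (M p) (B p)) = 0

/-- `D = ∂_t w` in the sense of distributions on `(0,T) × 𝕋^d`, with `w` and `D` locally
integrable there. -/
def HasWeakTimeDeriv {d n : ℕ} (T : ℝ) (w D : ℝ × (Fin d → ℝ) → EuclideanSpace ℝ (Fin n)) :
    Prop :=
  (∀ a b : ℝ, 0 < a → b < T →
    IntegrableOn w (Icc a b ×ˢ cell d) ∧ IntegrableOn D (Icc a b ×ˢ cell d)) ∧
  ∀ φ : ℝ × (Fin d → ℝ) → EuclideanSpace ℝ (Fin n), SmoothVecST φ → CompactInTime T φ →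
    ∫ p in cylinder d T, inner ℝ (w p) (dtVec φ p) = -∫ p in cylinder d T, inner ℝ (D p) (φ p)

/-- `G = L^* w` in the sense of distributions on `(0,T) × 𝕋^d`, with `w` and `G` locally
integrable there and `G` symmetric. -/
def HasWeakAdj {d n N : ℕ} (L : DiffOp d n N) (T : ℝ)
    (w : ℝ × (Fin d → ℝ) → EuclideanSpace ℝ (Fin n))
    (G : ℝ × (Fin d → ℝ) → Matrix (Fin N) (Fin N) ℝ) : Prop :=
  (∀ a b : ℝ, 0 < a → b < T → IntegrableOn w (Icc a b ×ˢ cell d) ∧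
    ∀ l m, IntegrableOn (fun p => G p l m) (Icc a b ×ˢ cell d)) ∧
  (∀ᵐ p ∂(volume.restrict (cylinder d T)), (G p).IsSymm) ∧
  ∀ Ψ : ℝ × (Fin d → ℝ) → Matrix (Fin N) (Fin N) ℝ, SmoothMatST Ψ → CompactInTime T Ψ →
    ∫ p in cylinder d T, inner ℝ (w p) (L.appST Ψ p) = ∫ p in cylinder d T, frob (G p) (Ψ p)

/-- Admissible weights: measurable, bounded away from `0` and `∞` on `[0,T]`. -/
def IsWeight (T : ℝ) (κ : ℝ → ℝ) : Prop :=
  Measurable κ ∧ ∃ c C : ℝ, 0 < c ∧ ∀ t ∈ Icc 0 T, c ≤ κ t ∧ κ t ≤ C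

/-- The integrated weight `t ↦ ∫_t^T κ(s) ds`. -/
def intWeight (T : ℝ) (κ : ℝ → ℝ) (t : ℝ) : ℝ := ∫ s in t..T, κ s

/-- Strong solutions on `[0,T]` with initial datum `v₀`, for the weight `κ` with integral
`H(t) = ∫_t^T κ`: weak solutions such that `∂_t (H v^#) ∈ L_{K^*}`, `H L^*(v^#) ∈ L^∞`,
`∂_t (v^#)_l + L^*(v^#) : ∂_l F(v) = 0` a.e., and `v^#(0) = v₀^#`. The last equality is the
convergence in `L¹(𝕋^d)` of `v^#(t)` to `v₀^#` as `t → 0⁺` outside a null set of times. -/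
structure IsStrongSolution {d n N : ℕ} (L : DiffOp d n N)
    (F : EuclideanSpace ℝ (Fin n) → Matrix (Fin N) (Fin N) ℝ) (T : ℝ) (κ : ℝ → ℝ)
    (v₀ : (Fin d → ℝ) → EuclideanSpace ℝ (Fin n))
    (v : ℝ × (Fin d → ℝ) → EuclideanSpace ℝ (Fin n)) : Prop where
  weak : IsWeakSolution L F T v₀ v
  timeReg : ∃ A : ℝ × (Fin d → ℝ) → EuclideanSpace ℝ (Fin n),
    HasWeakTimeDeriv T (fun p => intWeight T κ p.1 • sharp F (v p)) A ∧
    MemOrlicz (legendre (entropy F)) A (volume.restrict (cylinder d T))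
  equation : ∃ (D : ℝ × (Fin d → ℝ) → EuclideanSpace ℝ (Fin n))
    (G : ℝ × (Fin d → ℝ) → Matrix (Fin N) (Fin N) ℝ),
    HasWeakTimeDeriv T (fun p => sharp F (v p)) D ∧
    HasWeakAdj L T (fun p => sharp F (v p)) G ∧
    (∀ l m, MemLp (fun p => intWeight T κ p.1 * G p l m) ⊤ (volume.restrict (cylinder d T))) ∧
    ∀ᵐ p ∂(volume.restrict (cylinder d T)), ∀ l, D p l + frob (G p) (partialF F l (v p)) = 0
  initial : Tendsto (fun t => ∫⁻ x in cell d, ‖sharp F (v (t, x)) - sharp F (v₀ x)‖ₑ)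
    (𝓝[>] 0 ⊓ ae volume) (𝓝 0)

/-- The total entropy `∫ K(v(t,x)) dx`. -/
def totalEntropy {d n N : ℕ} (F : EuclideanSpace ℝ (Fin n) → Matrix (Fin N) (Fin N) ℝ)
    (v : ℝ × (Fin d → ℝ) → EuclideanSpace ℝ (Fin n)) (t : ℝ) : ℝ :=
  ∫ x in cell d, entropy F (v (t, x))

/-- The total entropy `½ (M(t,·) - F(0), I)` of a subsolution. -/
def subTotalEntropy {d n N : ℕ} (F : EuclideanSpace ℝ (Fin n) → Matrix (Fin N) (Fin N) ℝ)
    (M : ℝ × (Fin d → ℝ) → Matrix (Fin N) (Fin N) ℝ) (t : ℝ) : ℝ :=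
  (1 / 2) * ∫ x in cell d, frob (M (t, x) - F 0) 1

end

end Dafermos

namespace Dafermos

/-! ### Convex analysis of smooth `N`-functions -/

section ConvexAnalysis

/-! The strong solution supplies its own test pairs. With `w = v^#`, `D = ∂_t w`, `G = L^* w` and a
smooth `θ(t)` that vanishes from some time before `T` on, the pair `E = ∂_t (θ w)`, `B = θ G`
satisfies `∂_t B = L^* E` weakly after each time derivative is moved across, and the equation turns
`E` into `θ' w - θ (G : ∂_l F(v))_l`. Since `H(T) = 0`, the field `G` is bounded only on `(0,τ)`
with `τ < T`, so everything is done there (`exists_regularOn`, `isTestPair`).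

Comparison. Subtracting the weak identities of `(u,M)` and `v` gives `∫ (u - v)·E + (M - F(v)) : B =
0`. Put `P = -θ' I + 2θ G`, which lies in `Λ` and is nonnegative definite as soon as `θ` decays fast
enough relative to `|G| ≤ C`. Its flux gradient at `v` is exactly `-2E`, so `Λ`-convexity of `F`
together with `F(u) ≤ M` bounds the integrand from below by `θ'` times the difference of the entropy
densities (`relative_entropy_le`). Hence `∫ θ' (K̃ - K) dt ≤ 0`. As `θ' < 0` before the time where
`θ` vanishes, this excludes `K̃ ≤ K` with strict inequality on a final stretch.

Conservation. The same pair tested against `v` alone gives, for `m(t) = ∫ (v - v₀)·w dx`, the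
relation `m' = ∫ (v - v₀)·D dx`, `m(0) = 0`, once `∫ F(v) : G dx = 0` is known on almost every time
slice. That is formal conservativity for a nonsmooth `w`, obtained by mollifying `w`, pulling the
result back by the inverse of `∇K`, and passing to the limit with the majorant `ρ * K^*(w)` from
Jensen's inequality (`integral_frob_eq_zero`). On the other hand `v = ∇K^*(w)`, so `∂_t K^*(w) =
v·D` along almost every line in time (`legendre_add_integral_sub`). Combining the two with `K(v) =
v·w - K^*(w)` gives constancy of `∫ K(v) dx`; no time derivative of `v` itself is needed.

The growth bounds behind integrability come from convexity, evenness and the two `Δ₂`-conditions.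
Slicing rests on a periodic approximate identity: a weak identity tested with `θ(t) ρ(x - y)`
becomes an identity for mollified slices at almost every time. -/

theorem ConvexOn.add_fderiv_le {V : Type*} [NormedAddCommGroup V] [NormedSpace ℝ V]
    {f : V → ℝ} (hf : ConvexOn ℝ univ f) {f' : V →L[ℝ] ℝ} {x : V} (h : HasFDerivAt f f' x)
    (y : V) : f x + f' (y - x) ≤ f y := by
  have hline : ConvexOn ℝ univ (fun s : ℝ => f (x + s • (y - x))) := by
    refine ⟨convex_univ, fun a _ b _ p q hp hq hpq => ?_⟩
    have := hf.2 (mem_univ (x + a • (y - x))) (mem_univ (x + b • (y - x))) hp hq hpq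
    convert this using 2
    obtain rfl : q = 1 - p := by linarith
    simp only [smul_eq_mul]
    module
  have hd : HasDerivAt (fun s : ℝ => f (x + s • (y - x))) (f' (y - x)) 0 := by
    have h1 : HasDerivAt (fun s : ℝ => x + s • (y - x)) (y - x) 0 := by
      simpa using ((hasDerivAt_id (0 : ℝ)).smul_const (y - x)).const_add x
    have h2 : HasFDerivAt f f' (x + (0 : ℝ) • (y - x)) := by simpa using h
    exact h2.comp_hasDerivAt 0 h1
  have := hline.le_slope_of_hasDerivAt (mem_univ 0) (mem_univ 1) one_pos hd
  simp [slope_def_field, -map_sub] at this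
  linarith

variable {n : ℕ} {K : EuclideanSpace ℝ (Fin n) → ℝ}

theorem inner_gradient_eq_fderiv (K : EuclideanSpace ℝ (Fin n) → ℝ)
    (v y : EuclideanSpace ℝ (Fin n)) : inner ℝ (gradient K v) y = fderiv ℝ K v y := by
  rw [gradient, ← InnerProductSpace.toDual_apply_apply (𝕜 := ℝ), LinearIsometryEquiv.apply_symm_apply]

theorem add_inner_gradient_le (hc : ConvexOn ℝ univ K) (hd : Differentiable ℝ K)
    (v y : EuclideanSpace ℝ (Fin n)) : K v + inner ℝ (gradient K v) (y - v) ≤ K y := by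
  rw [inner_gradient_eq_fderiv]
  exact ConvexOn.add_fderiv_le hc (hd v).hasFDerivAt y

theorem inner_gradient_le (hc : ConvexOn ℝ univ K) (hd : Differentiable ℝ K)
    (v y : EuclideanSpace ℝ (Fin n)) : inner ℝ (gradient K v) y ≤ K (v + y) - K v := by
  have := add_inner_gradient_le hc hd v (v + y)
  simp only [add_sub_cancel_left] at this
  linarith

theorem continuous_gradient (hd : ContDiff ℝ 1 K) : Continuous (gradient K) :=
  (InnerProductSpace.toDual ℝ _).symm.continuous.comp (hd.continuous_fderiv one_ne_zero)

theorem IsNFunction.map_zero (hK : IsNFunction K) : K 0 = 0 := by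
  obtain ⟨Φ₁, Φ₂, -, h₂, h⟩ := hK.squeeze
  have := (h 0).2
  rw [norm_zero, (h₂.eq_zero_iff 0).2 rfl] at this
  exact le_antisymm this (hK.nonneg 0)

theorem IsNFunction.superlinear (hK : IsNFunction K) (R : ℝ) :
    ∃ C, 0 ≤ C ∧ ∀ y, R * ‖y‖ ≤ K y + C := by
  obtain ⟨Φ₁, Φ₂, h₁, -, h⟩ := hK.squeeze
  obtain ⟨S, hS⟩ := eventually_atTop.1 (h₁.limit_top.eventually_ge_atTop R)
  refine ⟨|R| * max S 1, by positivity, fun y => ?_⟩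
  by_cases hy : max S 1 ≤ ‖y‖
  · have hpos : 0 < ‖y‖ := lt_of_lt_of_le one_pos ((le_max_right _ _).trans hy)
    have h2 := hS ‖y‖ ((le_max_left _ _).trans hy)
    rw [le_div_iff₀ hpos] at h2
    have : 0 ≤ |R| * max S 1 := by positivity
    linarith [(h y).1]
  · push Not at hy
    have h3 : R * ‖y‖ ≤ |R| * max S 1 :=
      mul_le_mul (le_abs_self R) hy.le (norm_nonneg _) (abs_nonneg _)
    linarith [hK.nonneg y]

theorem IsNFunction.bddAbove (hK : IsNFunction K) (z : EuclideanSpace ℝ (Fin n)) :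
    BddAbove (range fun x : EuclideanSpace ℝ (Fin n) => inner ℝ x z - K x) := by
  obtain ⟨C, -, hC⟩ := hK.superlinear ‖z‖
  refine ⟨C, ?_⟩
  rintro _ ⟨x, rfl⟩
  have := real_inner_le_norm x z
  have := hC x
  simp only
  nlinarith

theorem IsNFunction.inner_le (hK : IsNFunction K) (x z : EuclideanSpace ℝ (Fin n)) :
    inner ℝ x z ≤ K x + legendre K z := by
  have := le_ciSup (hK.bddAbove z) x
  simp only [legendre]
  linarith

theorem legendre_le {z : EuclideanSpace ℝ (Fin n)} {a : ℝ}
    (h : ∀ x, inner ℝ x z ≤ K x + a) : legendre K z ≤ a :=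
  ciSup_le fun x => by linarith [h x]

theorem IsNFunction.legendre_nonneg (hK : IsNFunction K) (z : EuclideanSpace ℝ (Fin n)) :
    0 ≤ legendre K z := by
  have := hK.inner_le 0 z
  rw [hK.map_zero] at this
  simpa using this

theorem IsNFunction.convexOn_legendre (hK : IsNFunction K) : ConvexOn ℝ univ (legendre K) := by
  refine ⟨convex_univ, fun a _ b _ p q hp hq hpq => legendre_le fun x => ?_⟩
  have h1 := mul_le_mul_of_nonneg_left (hK.inner_le x a) hp
  have h2 := mul_le_mul_of_nonneg_left (hK.inner_le x b) hq
  simp only [inner_add_right, real_inner_smul_right, smul_eq_mul]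
  have : K x = p * K x + q * K x := by rw [← add_mul, hpq, one_mul]
  linarith

theorem IsNFunction.continuous_legendre (hK : IsNFunction K) : Continuous (legendre K) :=
  continuousOn_univ.1 (hK.convexOn_legendre.continuousOn isOpen_univ)

theorem legendre_gradient (hK : IsNFunction K) (hd : Differentiable ℝ K)
    (v : EuclideanSpace ℝ (Fin n)) :
    legendre K (gradient K v) = inner ℝ v (gradient K v) - K v := by
  refine le_antisymm (legendre_le fun x => ?_) (by linarith [hK.inner_le v (gradient K v)])
  have := add_inner_gradient_le hK.convex hd v x
  rw [inner_sub_right, real_inner_comm, real_inner_comm v] at this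
  linarith

theorem DeltaTwo.iterate {G : EuclideanSpace ℝ (Fin n) → ℝ} (hG : DeltaTwo G)
    (h0 : ∀ y, 0 ≤ G y) (j : ℕ) :
    ∃ C, 0 ≤ C ∧ ∀ y, G ((2 : ℝ) ^ j • y) ≤ C * (G y + 1) := by
  obtain ⟨C, hC⟩ := hG
  induction j with
  | zero => exact ⟨1, zero_le_one, fun y => by simp⟩
  | succ j ih =>
    obtain ⟨C', hC', h'⟩ := ih
    refine ⟨|C| * (C' + 1), by positivity, fun y => ?_⟩
    rw [pow_succ', mul_smul]
    have h3 : C * (G ((2 : ℝ) ^ j • y) + 1) ≤ |C| * (G ((2 : ℝ) ^ j • y) + 1) :=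
      mul_le_mul_of_nonneg_right (le_abs_self C) (by linarith [h0 ((2 : ℝ) ^ j • y)])
    have h4 : |C| * (G ((2 : ℝ) ^ j • y) + 1) ≤ |C| * (C' * (G y + 1) + (G y + 1)) :=
      mul_le_mul_of_nonneg_left (by linarith [h' y, h0 y]) (abs_nonneg C)
    calc _ ≤ _ := hC _
      _ ≤ _ := h3
      _ ≤ _ := h4
      _ = _ := by ring

/-- Convexity at the midpoint of `2v` and `2y`, followed by `Δ₂`. -/
theorem IsNFunction.map_add_le (hK : IsNFunction K) (h2 : DeltaTwo K) :
    ∃ C, 0 ≤ C ∧ ∀ v y, K (v + y) ≤ C * (K v + K y + 1) := by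
  obtain ⟨C, hC0, hC⟩ := h2.iterate hK.nonneg 1
  refine ⟨C, hC0, fun v y => ?_⟩
  have h := hK.convex.2 (mem_univ ((2 : ℝ) • v)) (mem_univ ((2 : ℝ) • y))
    (by norm_num : (0 : ℝ) ≤ 1 / 2) (by norm_num : (0 : ℝ) ≤ 1 / 2) (by norm_num)
  have e : ∀ z : EuclideanSpace ℝ (Fin n), (1 / 2 : ℝ) • (2 : ℝ) • z = z := fun z => by
    rw [smul_smul]; norm_num
  rw [e, e] at h
  have hv := hC v
  have hy := hC y
  simp only [pow_one, smul_eq_mul] at h hv hy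
  linarith [mul_nonneg hC0 (hK.nonneg v), mul_nonneg hC0 (hK.nonneg y)]

/-- The subgradient inequality bounds `∇K(v)·y` by `K(v + y) - K(v)`; evenness of `K` allows `y` to
be replaced by `-y`. -/
theorem IsNFunction.abs_inner_gradient_le (hK : IsNFunction K) (h2 : DeltaTwo K)
    (hd : Differentiable ℝ K) :
    ∃ C, 0 ≤ C ∧ ∀ v y, |inner ℝ (gradient K v) y| ≤ C * (K v + K y + 1) := by
  obtain ⟨C, hC0, hC⟩ := hK.map_add_le h2
  have key : ∀ v y, inner ℝ (gradient K v) y ≤ C * (K v + K y + 1) := fun v y => by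
    linarith [inner_gradient_le hK.convex hd v y, hC v y, hK.nonneg v]
  refine ⟨C, hC0, fun v y => abs_le.2 ⟨?_, key v y⟩⟩
  have := key v (-y)
  rw [inner_neg_right, hK.even] at this
  linarith

/-- Vectors that are dominated by `K` have dominated Legendre transform. -/
theorem IsNFunction.legendre_le_of_inner_le (hK : IsNFunction K) (h2 : DeltaTwo (legendre K))
    (C : ℝ) :
    ∃ C', 0 ≤ C' ∧ ∀ z a, 0 ≤ a → (∀ y, inner ℝ y z ≤ C * (K y + a)) →
      legendre K z ≤ C' * (a + 1) := by
  -- Dividing `z` by a power of two above `C` makes the hypothesis say directly that the Legendre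
  -- transform is at most `a`; `Δ₂` for the transform, iterated `j` times, undoes the division.
  obtain ⟨j, hj⟩ := pow_unbounded_of_one_lt C one_lt_two
  obtain ⟨C', hC'0, hC'⟩ := h2.iterate hK.legendre_nonneg j
  refine ⟨C', hC'0, fun z a ha h => ?_⟩
  have hpos : (0 : ℝ) < 2 ^ j := by positivity
  have h1 : legendre K (((2 : ℝ) ^ j)⁻¹ • z) ≤ a := legendre_le fun y => by
    rw [real_inner_smul_right, inv_mul_le_iff₀ hpos]
    exact (h y).trans (mul_le_mul_of_nonneg_right hj.le (by linarith [hK.nonneg y]))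
  have h3 := hC' (((2 : ℝ) ^ j)⁻¹ • z)
  rw [smul_inv_smul₀ hpos.ne'] at h3
  exact h3.trans (mul_le_mul_of_nonneg_left (by linarith) hC'0)

theorem euclidean_eq_sum_single (y : EuclideanSpace ℝ (Fin n)) :
    y = ∑ l, y l • EuclideanSpace.single l (1 : ℝ) := by
  ext i
  simp [Finset.sum_apply, Pi.single_apply]

theorem norm_le_sum_abs (z : EuclideanSpace ℝ (Fin n)) :
    ‖z‖ ≤ ∑ l, |z l| := by
  conv_lhs => rw [euclidean_eq_sum_single z]
  refine (norm_sum_le _ _).trans (Finset.sum_le_sum fun l _ => ?_)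
  rw [norm_smul]
  simp

/-- Vectors that are dominated by `K` have dominated norm. -/
theorem norm_le_of_inner_le (K : EuclideanSpace ℝ (Fin n) → ℝ) :
    ∃ A, 0 ≤ A ∧ ∀ (C a : ℝ) (z : EuclideanSpace ℝ (Fin n)), 0 ≤ C → 0 ≤ a →
      (∀ y, |inner ℝ y z| ≤ C * (K y + a)) → ‖z‖ ≤ A * C * (a + 1) := by
  -- The hypothesis is only used for `y` a standard basis vector, which bounds one coordinate of `z`
  -- at a time.
  refine ⟨∑ l : Fin n, (|K (EuclideanSpace.single l 1)| + 1), by positivity,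
    fun C a z hC ha h => ?_⟩
  refine (norm_le_sum_abs z).trans ?_
  rw [Finset.sum_mul, Finset.sum_mul]
  refine Finset.sum_le_sum fun l _ => ?_
  have h1 := h (EuclideanSpace.single l 1)
  rw [EuclideanSpace.inner_single_left] at h1
  simp only [map_one, one_mul] at h1
  refine h1.trans ?_
  rw [mul_comm _ C, mul_assoc]
  refine mul_le_mul_of_nonneg_left ?_ hC
  nlinarith [le_abs_self (K (EuclideanSpace.single l 1)),
    mul_nonneg (abs_nonneg (K (EuclideanSpace.single l 1))) ha]

/-- By superlinear growth `x ↦ K x - x·z` attains its minimum, and there `∇K = z`. -/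
theorem gradient_surjective (hK : IsNFunction K) (hd : Differentiable ℝ K) :
    Function.Surjective (gradient K) := by
  intro z
  obtain ⟨C, -, hC⟩ := hK.superlinear (‖z‖ + 1)
  have hcoer : Tendsto (fun x => K x - inner ℝ x z) (cocompact _) atTop := by
    refine tendsto_atTop_mono (f := fun x => ‖x‖ - C) (fun x => ?_)
      (tendsto_atTop_add_const_right _ _ (tendsto_norm_cocompact_atTop))
    have := real_inner_le_norm x z
    have := hC x
    nlinarith
  obtain ⟨x, hx⟩ := (hd.continuous.sub (by fun_prop : Continuous fun x => inner ℝ x z)).exists_forall_le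
    hcoer
  refine ⟨x, ?_⟩
  have hf : HasFDerivAt (fun x => K x - inner ℝ x z)
      (fderiv ℝ K x - (innerSL ℝ z)) x := by
    refine (hd x).hasFDerivAt.sub ?_
    simp_rw [real_inner_comm z]
    exact (innerSL ℝ z).hasFDerivAt
  have hmin : IsLocalMin (fun x => K x - inner ℝ x z) x := Eventually.of_forall hx
  have h0 := hmin.hasFDerivAt_eq_zero hf
  refine ext_inner_right ℝ fun y => ?_
  rw [inner_gradient_eq_fderiv]
  have := congrArg (fun f => f y) h0
  simp at this
  linarith

theorem gradient_injective (hs : StrictConvexOn ℝ univ K) (hd : Differentiable ℝ K) :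
    Function.Injective (gradient K) := by
  intro x y hxy
  by_contra hne
  have hm := hs.2 (mem_univ x) (mem_univ y) hne (by norm_num : (0 : ℝ) < 1 / 2)
    (by norm_num : (0 : ℝ) < 1 / 2) (by norm_num)
  have h1 := add_inner_gradient_le hs.convexOn hd x ((1 / 2 : ℝ) • x + (1 / 2 : ℝ) • y)
  have h2 := add_inner_gradient_le hs.convexOn hd y ((1 / 2 : ℝ) • x + (1 / 2 : ℝ) • y)
  rw [← hxy] at h2
  have e1 : (1 / 2 : ℝ) • x + (1 / 2 : ℝ) • y - x = -((1 / 2 : ℝ) • x + (1 / 2 : ℝ) • y - y) := by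
    module
  rw [e1, inner_neg_right] at h1
  simp only [smul_eq_mul] at hm
  linarith

/-- Convexity compared with the point `0` gives `K(x) ≤ ∇K(x)·x`, so superlinear growth of `K`
forces `|∇K(x)| → ∞`. Properness is what makes the inverse of `∇K` continuous. -/
theorem tendsto_gradient_cocompact (hK : IsNFunction K) (hd : Differentiable ℝ K) :
    Tendsto (gradient K) (cocompact _) (cocompact _) := by
  rw [← Metric.cobounded_eq_cocompact, ← tendsto_norm_atTop_iff_cobounded]
  rw [tendsto_atTop]
  intro R
  obtain ⟨C, hC0, hC⟩ := hK.superlinear (R + 1)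
  have : ∀ᶠ x : EuclideanSpace ℝ (Fin n) in Bornology.cobounded _, C + 1 ≤ ‖x‖ :=
    tendsto_norm_cobounded_atTop.eventually_ge_atTop (C + 1)
  filter_upwards [this] with x hx
  have h1 := add_inner_gradient_le hK.convex hd x 0
  rw [hK.map_zero, zero_sub, inner_neg_right] at h1
  have h2 := real_inner_le_norm (gradient K x) x
  have h3 := hC x
  by_contra! h
  nlinarith

/-- The inverse of the gradient map. -/
theorem exists_continuous_gradient_inverse (hK : IsNFunction K) (hs : StrictConvexOn ℝ univ K)
    (hd : ContDiff ℝ 1 K) :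
    ∃ V : EuclideanSpace ℝ (Fin n) → EuclideanSpace ℝ (Fin n), Continuous V ∧
      (∀ z, gradient K (V z) = z) ∧ ∀ v, V (gradient K v) = v := by
  have hdiff : Differentiable ℝ K := hd.differentiable one_ne_zero
  have hcont := continuous_gradient hd
  let e := Equiv.ofBijective (gradient K)
    ⟨gradient_injective hs hdiff, gradient_surjective hK hdiff⟩
  have hclosed : IsClosedMap e :=
    (isProperMap_iff_tendsto_cocompact.2 ⟨hcont, tendsto_gradient_cocompact hK hdiff⟩).isClosedMap
  refine ⟨e.symm, (e.toHomeomorphOfContinuousClosed hcont hclosed).symm.continuous,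
    e.apply_symm_apply, e.symm_apply_apply⟩

/-- Young's inequality for the pair `v`, `2v^#`, combined with the equality `v·v^# = K(v) +
K^*(v^#)`, gives `K(v) ≤ K^*(2v^#)`; then `Δ₂` for `K^*` applies. -/
theorem le_legendre_gradient (hK : IsNFunction K) (h2 : DeltaTwo (legendre K))
    (hd : Differentiable ℝ K) :
    ∃ C, 0 ≤ C ∧ ∀ v, K v ≤ C * (legendre K (gradient K v) + 1) := by
  obtain ⟨C, hC0, hC⟩ := h2.iterate hK.legendre_nonneg 1
  refine ⟨C, hC0, fun v => ?_⟩
  have h1 := hK.inner_le v ((2 : ℝ) ^ 1 • gradient K v)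
  rw [real_inner_smul_right] at h1
  linarith [legendre_gradient hK hd v, hC (gradient K v), hK.legendre_nonneg (gradient K v)]

theorem legendre_gradient_le (hK : IsNFunction K) (h2 : DeltaTwo K) (hd : Differentiable ℝ K) :
    ∃ C, 0 ≤ C ∧ ∀ v, legendre K (gradient K v) ≤ C * (K v + 1) := by
  obtain ⟨C, hC0, hC⟩ := hK.abs_inner_gradient_le h2 hd
  refine ⟨2 * C, by positivity, fun v => ?_⟩
  rw [legendre_gradient hK hd, real_inner_comm]
  nlinarith [hC v v, le_abs_self (inner ℝ (gradient K v) v), hK.nonneg v]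

/-- The Legendre transform has `v` as a subgradient at `∇K(v)`. -/
theorem legendre_add_inner_le (hK : IsNFunction K) (hd : Differentiable ℝ K)
    (v z : EuclideanSpace ℝ (Fin n)) :
    legendre K (gradient K v) + inner ℝ v (z - gradient K v) ≤ legendre K z := by
  rw [legendre_gradient hK hd, inner_sub_right]
  linarith [hK.inner_le v z]

end ConvexAnalysis

/-! ### The Frobenius product and the space `Λ` -/

section Frobenius

variable {N : ℕ}

theorem frob_comm (A B : Matrix (Fin N) (Fin N) ℝ) : frob A B = frob B A := by
  simp only [frob, mul_comm]

theorem frob_add_right (A B C : Matrix (Fin N) (Fin N) ℝ) :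
    frob A (B + C) = frob A B + frob A C := by
  simp only [frob, Matrix.add_apply, mul_add, Finset.sum_add_distrib]

theorem frob_smul_right (a : ℝ) (A B : Matrix (Fin N) (Fin N) ℝ) :
    frob A (a • B) = a * frob A B := by
  simp only [frob, Matrix.smul_apply, smul_eq_mul, Finset.mul_sum]
  exact Finset.sum_congr rfl fun _ _ => Finset.sum_congr rfl fun _ _ => by ring

theorem frob_sub_left (A B C : Matrix (Fin N) (Fin N) ℝ) :
    frob (A - B) C = frob A C - frob B C := by
  simp only [frob, Matrix.sub_apply, sub_mul, Finset.sum_sub_distrib]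

theorem frob_neg_right (A B : Matrix (Fin N) (Fin N) ℝ) : frob A (-B) = -frob A B := by
  simp only [frob, Matrix.neg_apply, mul_neg, Finset.sum_neg_distrib]

theorem frob_zero_right (A : Matrix (Fin N) (Fin N) ℝ) : frob A 0 = 0 := by
  simp [frob]

theorem frob_one (A : Matrix (Fin N) (Fin N) ℝ) : frob A 1 = A.trace := by
  simp [frob, Matrix.one_apply, Matrix.trace]

/-- A symmetric matrix becomes nonnegative after adding a large multiple of the identity. -/
theorem posSemidef_smul_one_add {Q : Matrix (Fin N) (Fin N) ℝ} (hs : Q.IsSymm) {C a : ℝ}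
    (hQ : ∀ l m, |Q l m| ≤ C) (ha : N * C ≤ a) :
    (a • (1 : Matrix (Fin N) (Fin N) ℝ) + Q).PosSemidef := by
  refine Matrix.PosSemidef.of_dotProduct_mulVec_nonneg ?_ fun x => ?_
  · rw [Matrix.IsHermitian, Matrix.conjTranspose_eq_transpose_of_trivial, Matrix.transpose_add,
      Matrix.transpose_smul, Matrix.transpose_one, hs]
  · have e : star x ⬝ᵥ ((a • (1 : Matrix (Fin N) (Fin N) ℝ) + Q).mulVec x)
        = a * ∑ l, x l ^ 2 + ∑ l, ∑ m, x l * Q l m * x m := by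
      rw [Matrix.add_mulVec, Matrix.smul_mulVec, Matrix.one_mulVec, dotProduct_add]
      simp only [dotProduct, Matrix.mulVec, Finset.mul_sum, star_trivial, Pi.smul_apply,
        smul_eq_mul]
      congr 1
      · exact Finset.sum_congr rfl fun _ _ => by ring
      · exact Finset.sum_congr rfl fun _ _ => Finset.sum_congr rfl fun _ _ => by ring
    rw [e]
    -- Each off-diagonal term is split by `|x_l x_m| ≤ (x_l² + x_m²)/2`; summing over the `N²`
    -- entries yields the factor `N * C`.
    have hb : ∀ l m, -(C * ((x l ^ 2 + x m ^ 2) / 2)) ≤ x l * Q l m * x m := fun l m => by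
      have hC : 0 ≤ C := (abs_nonneg _).trans (hQ l m)
      have h1 : |x l * Q l m * x m| ≤ C * ((x l ^ 2 + x m ^ 2) / 2) := by
        rw [abs_mul, abs_mul, mul_comm |x l|, mul_assoc]
        refine mul_le_mul (hQ l m) ?_ (by positivity) hC
        nlinarith [sq_nonneg (|x l| - |x m|), sq_abs (x l), sq_abs (x m)]
      exact (abs_le.1 h1).1
    have h2 : -(N * C * ∑ l, x l ^ 2) ≤ ∑ l, ∑ m, x l * Q l m * x m := by
      refine le_trans (le_of_eq ?_) (Finset.sum_le_sum fun l _ => Finset.sum_le_sum fun m _ => hb l m)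
      simp only [Finset.sum_neg_distrib, ← Finset.mul_sum, add_div, Finset.sum_add_distrib,
        Finset.sum_const, Finset.card_univ, Fintype.card_fin, nsmul_eq_mul, ← Finset.sum_div]
      ring
    have h3 : N * C * ∑ l, x l ^ 2 ≤ a * ∑ l, x l ^ 2 :=
      mul_le_mul_of_nonneg_right ha (Finset.sum_nonneg fun _ _ => sq_nonneg _)
    linarith

end Frobenius

section Lam

variable {d n N : ℕ} {L : DiffOp d n N}

theorem DiffOp.isSymm_adj (L : DiffOp d n N) (u : (Fin d → ℝ) → EuclideanSpace ℝ (Fin n))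
    (x : Fin d → ℝ) : (L.adj u x).IsSymm := by
  ext l m
  simp only [Matrix.transpose_apply, DiffOp.adj, Matrix.of_apply, add_comm]

theorem DiffOp.one_mem_Lam : (1 : Matrix (Fin N) (Fin N) ℝ) ∈ L.Lam :=
  Submodule.subset_span (Or.inl rfl)

theorem DiffOp.adj_mem_Lam {u : (Fin d → ℝ) → EuclideanSpace ℝ (Fin n)} (hu : SmoothVec u)
    (x : Fin d → ℝ) : L.adj u x ∈ L.Lam :=
  Submodule.subset_span (Or.inr ⟨u, x, hu, rfl⟩)

theorem DiffOp.isSymm_of_mem_Lam {Q : Matrix (Fin N) (Fin N) ℝ} (hQ : Q ∈ L.Lam) :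
    Q.IsSymm := by
  induction hQ using Submodule.span_induction with
  | mem x hx =>
    rcases hx with rfl | ⟨u, x, -, rfl⟩
    · exact Matrix.isSymm_one
    · exact L.isSymm_adj u x
  | zero => exact Matrix.isSymm_zero
  | add x y _ _ hx hy => exact hx.add hy
  | smul a x _ hx => exact hx.smul a

end Lam

/-! ### The gradient of the flux in the directions of `Λ`, and its growth. -/

section Flux

variable {d n N : ℕ} {L : DiffOp d n N}
  {F : EuclideanSpace ℝ (Fin n) → Matrix (Fin N) (Fin N) ℝ}

/-- The vector `(Q : ∂_l F(v))_l`. -/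
noncomputable def fluxGrad (F : EuclideanSpace ℝ (Fin n) → Matrix (Fin N) (Fin N) ℝ)
    (Q : Matrix (Fin N) (Fin N) ℝ) (v : EuclideanSpace ℝ (Fin n)) : EuclideanSpace ℝ (Fin n) :=
  WithLp.toLp 2 fun l => frob Q (partialF F l v)

theorem StandingAssumptions.differentiable_apply (h : StandingAssumptions L F) (a b : Fin N) :
    Differentiable ℝ (fun v => F v a b) := (h.smooth a b).differentiable two_ne_zero

theorem StandingAssumptions.contDiff_entropy (h : StandingAssumptions L F) :
    ContDiff ℝ 2 (entropy F) := by
  unfold entropy Matrix.trace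
  simp only [Matrix.diag_apply, Matrix.sub_apply]
  exact contDiff_const.mul (ContDiff.sum fun i _ => (h.smooth i i).sub contDiff_const)

theorem StandingAssumptions.differentiable_entropy (h : StandingAssumptions L F) :
    Differentiable ℝ (entropy F) := h.contDiff_entropy.differentiable two_ne_zero

theorem StandingAssumptions.continuous_sharp (h : StandingAssumptions L F) :
    Continuous (sharp F) := continuous_gradient (h.contDiff_entropy.of_le one_le_two)

theorem trace_eq_entropy (F : EuclideanSpace ℝ (Fin n) → Matrix (Fin N) (Fin N) ℝ)
    (v : EuclideanSpace ℝ (Fin n)) : (F v).trace = 2 * entropy F v + (F 0).trace := by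
  rw [entropy, Matrix.trace_sub]; ring

theorem hasFDerivAt_frob (h : StandingAssumptions L F) (Q : Matrix (Fin N) (Fin N) ℝ)
    (v : EuclideanSpace ℝ (Fin n)) :
    HasFDerivAt (fun z => frob (F z) Q) (innerSL ℝ (fluxGrad F Q v)) v := by
  have h1 : HasFDerivAt (fun z => frob (F z) Q)
      (∑ a, ∑ b, (Q a b) • fderiv ℝ (fun z => F z a b) v) v := by
    unfold frob
    refine HasFDerivAt.fun_sum fun a _ => HasFDerivAt.fun_sum fun b _ => ?_
    exact (h.differentiable_apply a b v).hasFDerivAt.mul_const (Q a b)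
  convert! h1 using 1
  ext y
  rw [euclidean_eq_sum_single y]
  simp only [map_sum, map_smul]
  refine Finset.sum_congr rfl fun l _ => ?_
  congr 1
  simp [fluxGrad, frob, partialF, EuclideanSpace.inner_single_right]

theorem fluxGrad_add (P Q : Matrix (Fin N) (Fin N) ℝ) (v : EuclideanSpace ℝ (Fin n)) :
    fluxGrad F (P + Q) v = fluxGrad F P v + fluxGrad F Q v := by
  ext l
  simp only [fluxGrad, PiLp.add_apply, frob_comm (P + Q), frob_add_right, frob_comm P, frob_comm Q]

theorem fluxGrad_smul (a : ℝ) (Q : Matrix (Fin N) (Fin N) ℝ) (v : EuclideanSpace ℝ (Fin n)) :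
    fluxGrad F (a • Q) v = a • fluxGrad F Q v := by
  ext l
  simp only [fluxGrad, PiLp.smul_apply, frob_comm (a • Q), frob_smul_right, frob_comm Q,
    smul_eq_mul]

/-- `F : I` equals `2K` up to a constant. This is the link between convexity of the flux in the
direction `I` and the entropy variable `v^#`. -/
theorem StandingAssumptions.fluxGrad_one (h : StandingAssumptions L F)
    (v : EuclideanSpace ℝ (Fin n)) : fluxGrad F 1 v = (2 : ℝ) • sharp F v := by
  have h1 := hasFDerivAt_frob h 1 v
  have h2 : HasFDerivAt (fun z => frob (F z) 1) ((2 : ℝ) • fderiv ℝ (entropy F) v) v := by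
    rw [show (fun z => frob (F z) 1) = fun z => 2 * entropy F z + (F 0).trace from
      funext fun z => (frob_one _).trans (trace_eq_entropy F z)]
    exact ((h.differentiable_entropy v).hasFDerivAt.const_mul 2).add_const _
  refine ext_inner_right ℝ fun y => ?_
  have := congrArg (fun f => f y) (h1.unique h2)
  rw [real_inner_smul_left, sharp, inner_gradient_eq_fderiv]
  simpa using this

/-- The `Λ`-convexity inequality for `F`. -/
theorem StandingAssumptions.inner_fluxGrad_le (h : StandingAssumptions L F)
    {P : Matrix (Fin N) (Fin N) ℝ} (hP : P ∈ L.Lam) (hpos : P.PosSemidef)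
    (v y : EuclideanSpace ℝ (Fin n)) :
    frob (F v) P + inner ℝ (fluxGrad F P v) (y - v) ≤ frob (F y) P :=
  ConvexOn.add_fderiv_le (h.lambdaConvex P hP hpos) (hasFDerivAt_frob h P v) y

theorem StandingAssumptions.trace_nonneg (h : StandingAssumptions L F)
    (v : EuclideanSpace ℝ (Fin n)) : 0 ≤ (F v).trace := by
  rw [← frob_one]
  exact (h.lambdaNonneg v).2 1 DiffOp.one_mem_Lam Matrix.PosSemidef.one

/-- Both `N C I + Q` and `N C I - Q` are nonnegative definite and lie in `Λ`, so `F(v) ≥ 0` bounds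
`F(v) : Q` on both sides by a multiple of the trace of `F(v)`, hence by the entropy. -/
theorem StandingAssumptions.abs_frob_le (h : StandingAssumptions L F)
    {Q : Matrix (Fin N) (Fin N) ℝ} (hQ : Q ∈ L.Lam) {C : ℝ} (hC : ∀ l m, |Q l m| ≤ C)
    (v : EuclideanSpace ℝ (Fin n)) :
    |frob (F v) Q| ≤ N * C * (2 * entropy F v + (F 0).trace) := by
  have key : ∀ Q' ∈ L.Lam, (∀ l m, |Q' l m| ≤ C) →
      0 ≤ N * C * (2 * entropy F v + (F 0).trace) + frob (F v) Q' := fun Q' hQ' hC' => by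
    have := (h.lambdaNonneg v).2 _
      (L.Lam.add_mem (L.Lam.smul_mem (N * C) DiffOp.one_mem_Lam) hQ')
      (posSemidef_smul_one_add (DiffOp.isSymm_of_mem_Lam hQ') hC' le_rfl)
    rwa [frob_add_right, frob_smul_right, frob_one, trace_eq_entropy] at this
  have h1 := key Q hQ hC
  have h2 := key (-Q) (L.Lam.neg_mem hQ) (by simpa using hC)
  rw [frob_neg_right] at h2
  exact abs_le.2 ⟨by linarith, by linarith⟩

/-- For `P = N C I + Q`, `Λ`-convexity between `v` and `v + y` bounds `y · ∇(F : P)(v)` by `F(v + y)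
: P`, the term `F(v) : P ≥ 0` being dropped. The part of the gradient due to `I` is a multiple of
`v^#` and already controlled; what remains bounds the part due to `Q`. The other sign comes from
`-Q`. -/
theorem StandingAssumptions.abs_inner_fluxGrad_le (h : StandingAssumptions L F) {C : ℝ}
    (hC0 : 0 ≤ C) :
    ∃ C', 0 ≤ C' ∧ ∀ Q ∈ L.Lam, (∀ l m, |Q l m| ≤ C) → ∀ v y,
      |inner ℝ y (fluxGrad F Q v)| ≤ C' * (entropy F v + entropy F y + 1) := by
  obtain ⟨C₁, hC₁0, hC₁⟩ := h.nFunction.map_add_le h.deltaTwo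
  obtain ⟨C₂, hC₂0, hC₂⟩ := h.nFunction.abs_inner_gradient_le h.deltaTwo h.differentiable_entropy
  have hF0 : 0 ≤ (F 0).trace := h.trace_nonneg 0
  set c : ℝ := N * C with hc
  have hc0 : 0 ≤ c := by positivity
  refine ⟨2 * c * (2 * C₁ + (F 0).trace) + 2 * c * C₂, by positivity, ?_⟩
  have key : ∀ Q ∈ L.Lam, (∀ l m, |Q l m| ≤ C) → ∀ v y, inner ℝ (fluxGrad F Q v) y ≤
      (2 * c * (2 * C₁ + (F 0).trace) + 2 * c * C₂) * (entropy F v + entropy F y + 1) := by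
    intro Q hQ hQC v y
    have hP : c • (1 : Matrix (Fin N) (Fin N) ℝ) + Q ∈ L.Lam :=
      L.Lam.add_mem (L.Lam.smul_mem c DiffOp.one_mem_Lam) hQ
    have hpos := posSemidef_smul_one_add (DiffOp.isSymm_of_mem_Lam hQ) hQC hc.ge
    have h1 := h.inner_fluxGrad_le hP hpos v (v + y)
    have h2 := (h.lambdaNonneg v).2 _ hP hpos
    rw [add_sub_cancel_left, fluxGrad_add, fluxGrad_smul, h.fluxGrad_one, inner_add_left,
      real_inner_smul_left, real_inner_smul_left, frob_add_right (F (v + y)), frob_smul_right,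
      frob_one, trace_eq_entropy F (v + y)] at h1
    have h3 := (abs_le.1 (h.abs_frob_le hQ hQC (v + y))).2
    have h4 := (abs_le.1 (hC₂ v y)).1
    have h5 := hC₁ v y
    set s := entropy F v + entropy F y + 1 with hs
    have hs1 : 1 ≤ s := by linarith [h.nFunction.nonneg v, h.nFunction.nonneg y]
    have h6 : c * -(C₂ * s) ≤ c * inner ℝ (sharp F v) y := mul_le_mul_of_nonneg_left h4 hc0
    have h7 : c * entropy F (v + y) ≤ c * (C₁ * s) := mul_le_mul_of_nonneg_left h5 hc0
    have h8 : c * (F 0).trace ≤ c * ((F 0).trace * s) :=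
      mul_le_mul_of_nonneg_left (le_mul_of_one_le_right hF0 hs1) hc0
    nlinarith
  intro Q hQ hQC v y
  rw [real_inner_comm]
  refine abs_le.2 ⟨?_, key Q hQ hQC v y⟩
  have := key (-Q) (L.Lam.neg_mem hQ) (by simpa using hQC) v y
  rw [← neg_one_smul ℝ Q, fluxGrad_smul, real_inner_smul_left] at this
  linarith

end Flux

/-! ### The cell and smooth periodic functions -/

section Cell

variable {d : ℕ}

theorem measurableSet_cell (d : ℕ) : MeasurableSet (cell d) :=
  MeasurableSet.univ_pi fun _ => measurableSet_Ico

theorem cell_subset_Icc (d : ℕ) : cell d ⊆ Icc 0 1 := fun _ hx =>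
  ⟨fun i => (hx i (mem_univ i)).1, fun i => (hx i (mem_univ i)).2.le⟩

theorem cell_ae_eq_Icc (d : ℕ) : cell d =ᵐ[volume] (Icc 0 1 : Set (Fin d → ℝ)) :=
  Measure.univ_pi_Ico_ae_eq_Icc

instance isFiniteMeasure_cell (d : ℕ) : IsFiniteMeasure (volume.restrict (cell d)) := by
  rw [Measure.restrict_congr_set (cell_ae_eq_Icc d)]
  exact ⟨by rw [Measure.restrict_apply_univ]; exact isCompact_Icc.measure_lt_top⟩

instance regular_cell (d : ℕ) : (volume.restrict (cell d)).Regular := by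
  infer_instance

theorem IsPeriodic.exists_mem_cell {g : (Fin d → ℝ) → ℝ} (hg : IsPeriodic g) (x : Fin d → ℝ) :
    ∃ y ∈ cell d, g x = g y := by
  refine ⟨fun i => Int.fract (x i), fun i _ => ⟨Int.fract_nonneg _, Int.fract_lt_one _⟩, ?_⟩
  rw [← hg (fun i => ⌊x i⌋) fun i => Int.fract (x i)]
  congr 1
  ext i
  simp

theorem IsPeriodic.exists_bound {g : (Fin d → ℝ) → ℝ} (hg : IsPeriodic g) (hc : Continuous g) :
    ∃ C, 0 ≤ C ∧ ∀ x, |g x| ≤ C := by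
  obtain ⟨C, hC⟩ := (isCompact_Icc (a := (0 : Fin d → ℝ)) (b := 1)).exists_bound_of_continuousOn
    hc.continuousOn
  refine ⟨|C|, abs_nonneg _, fun x => ?_⟩
  obtain ⟨y, hy, e⟩ := hg.exists_mem_cell x
  rw [e]
  exact (hC y (cell_subset_Icc d hy)).trans (le_abs_self C)

/-- Smooth periodic functions. -/
def SmoothPer (g : (Fin d → ℝ) → ℝ) : Prop := ContDiff ℝ ∞ g ∧ IsPeriodic g

theorem IsPeriodic.fderiv_add {g : (Fin d → ℝ) → ℝ} (hg : IsPeriodic g) (k : Fin d → ℤ)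
    (x : Fin d → ℝ) : fderiv ℝ g (x + fun i => (k i : ℝ)) = fderiv ℝ g x := by
  rw [← fderiv_comp_add_right]
  congr 1
  exact funext fun y => hg k y

theorem SmoothPer.fderiv_apply {g : (Fin d → ℝ) → ℝ} (hg : SmoothPer g) (y : Fin d → ℝ) :
    SmoothPer (fun x => fderiv ℝ g x y) :=
  ⟨(hg.1.fderiv_right (m := ∞) (by simp)).clm_apply contDiff_const,
    fun k x => by simp only [hg.2.fderiv_add]⟩

theorem SmoothPer.pd {g : (Fin d → ℝ) → ℝ} (hg : SmoothPer g) (i : Fin d) :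
    SmoothPer (pd i g) := hg.fderiv_apply _

theorem SmoothPer.exists_fderiv_bound {g : (Fin d → ℝ) → ℝ} (hg : SmoothPer g) :
    ∃ C, 0 ≤ C ∧ ∀ x, ‖fderiv ℝ g x‖ ≤ C := by
  have hp : IsPeriodic (fun x => ‖fderiv ℝ g x‖) := fun k x => by simp only [hg.2.fderiv_add]
  obtain ⟨C, h0, hC⟩ := hp.exists_bound (hg.1.continuous_fderiv (by simp)).norm
  exact ⟨C, h0, fun x => (le_abs_self _).trans (hC x)⟩

theorem SmoothPer.exists_bound {g : (Fin d → ℝ) → ℝ} (hg : SmoothPer g) :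
    ∃ C, 0 ≤ C ∧ ∀ x, |g x| ≤ C := hg.2.exists_bound hg.1.continuous

theorem pdMulti_induction {P : ((Fin d → ℝ) → ℝ) → Prop} (hP : ∀ g i, P g → P (pd i g))
    {g : (Fin d → ℝ) → ℝ} (hg : P g) (α : Fin d → ℕ) : P (pdMulti α g) := by
  have hiter : ∀ (i : Fin d) (k : ℕ) (h : (Fin d → ℝ) → ℝ), P h → P ((pd i)^[k] h) := by
    intro i k
    induction k with
    | zero => exact fun h hh => hh
    | succ k ih => exact fun h hh => ih _ (hP h i hh)
  unfold pdMulti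
  induction List.finRange d with
  | nil => exact hg
  | cons i l ih => exact hiter i _ _ ih

theorem SmoothPer.pdMulti {g : (Fin d → ℝ) → ℝ} (hg : SmoothPer g) (α : Fin d → ℕ) :
    SmoothPer (pdMulti α g) := pdMulti_induction (fun _ i h => h.pd i) hg α

/-- `∂_α` is compatible with every operation on functions that is compatible with all `∂_i`. -/
theorem pdMulti_comm {P : ((Fin d → ℝ) → ℝ) → Prop} (hP : ∀ g i, P g → P (pd i g))
    {A : ((Fin d → ℝ) → ℝ) → ((Fin d → ℝ) → ℝ)}
    (hA : ∀ g i, P g → pd i (A g) = A (pd i g)) {g : (Fin d → ℝ) → ℝ} (hg : P g)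
    (α : Fin d → ℕ) : pdMulti α (A g) = A (pdMulti α g) := by
  have hiter : ∀ (i : Fin d) (k : ℕ) (h : (Fin d → ℝ) → ℝ), P h →
      (pd i)^[k] (A h) = A ((pd i)^[k] h) ∧ P ((pd i)^[k] h) := by
    intro i k
    induction k with
    | zero => exact fun h hh => ⟨rfl, hh⟩
    | succ k ih =>
      intro h hh
      rw [Function.iterate_succ_apply, Function.iterate_succ_apply, hA h i hh]
      exact ih _ (hP h i hh)
  have : pdMulti α (A g) = A (pdMulti α g) ∧ P (pdMulti α g) := by
    unfold Dafermos.pdMulti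
    induction List.finRange d with
    | nil => exact ⟨rfl, hg⟩
    | cons i l ih =>
      simp only [List.foldr_cons]
      rw [ih.1]
      exact hiter i _ _ ih.2
  exact this.1

theorem pdMulti_const_mul (c : ℝ) (g : (Fin d → ℝ) → ℝ) (α : Fin d → ℕ) :
    pdMulti α (fun y => c * g y) = fun y => c * pdMulti α g y := by
  refine pdMulti_comm (P := fun _ => True) (A := fun g y => c * g y) (fun _ _ _ => trivial)
    (fun g i _ => ?_) trivial α
  ext y
  have h1 : (fun y => c * g y) = c • g := rfl
  simp only [pd]
  rw [h1, fderiv_const_smul_field, Pi.smul_apply, smul_apply, smul_eq_mul]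

/-- `∂_α` of a reflected function. -/
theorem pdMulti_comp_const_sub (ρ : (Fin d → ℝ) → ℝ) (x : Fin d → ℝ) (α : Fin d → ℕ) :
    pdMulti α (fun y => ρ (x - y)) =
      fun y => (-1) ^ (∑ i, α i) * pdMulti α ρ (x - y) := by
  have hpd : ∀ (i : Fin d) (c : ℝ) (h : (Fin d → ℝ) → ℝ),
      pd i (fun y => c * h (x - y)) = fun y => (c * -1) * pd i h (x - y) := by
    intro i c h
    ext y
    simp only [pd]
    have h1 : (fun y => c * h (x - y)) = c • (fun z => h (x - z)) := rfl
    have h2 : (fun z => h (x - z)) = (fun w => h (x + w)) ∘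
        (ContinuousLinearEquiv.neg ℝ : (Fin d → ℝ) ≃L[ℝ] (Fin d → ℝ)) := by
      ext z; simp [sub_eq_add_neg]
    rw [h1, fderiv_const_smul_field, Pi.smul_apply, h2, ContinuousLinearEquiv.comp_right_fderiv,
      fderiv_comp_add_left]
    simp [sub_eq_add_neg]
  have hiter : ∀ (i : Fin d) (k : ℕ) (c : ℝ) (h : (Fin d → ℝ) → ℝ),
      (pd i)^[k] (fun y => c * h (x - y)) =
        fun y => (c * (-1) ^ k) * (pd i)^[k] h (x - y) := by
    intro i k
    induction k with
    | zero => exact fun c h => by simp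
    | succ k ih =>
      intro c h
      rw [Function.iterate_succ_apply, Function.iterate_succ_apply, hpd i c h, ih]
      ext y
      ring
  have hfold : ∀ l : List (Fin d), l.foldr (fun i h => (pd i)^[α i] h) (fun y => ρ (x - y)) =
      fun y => (-1) ^ (l.map α).sum * l.foldr (fun i h => (pd i)^[α i] h) ρ (x - y) := by
    intro l
    induction l with
    | nil => simp
    | cons i l ih =>
      simp only [List.foldr_cons, List.map_cons, List.sum_cons]
      rw [ih, hiter]
      ext y
      ring
  rw [pdMulti, hfold, ← Fin.sum_univ_def]
  rfl

end Cell

/-! ### Periodic mollification -/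

section Mollify

variable {d : ℕ}

/-- `x ↦ ∫ ρ(x - y) g(y) dy` over the torus. -/
noncomputable def mollify (ρ g : (Fin d → ℝ) → ℝ) (x : Fin d → ℝ) : ℝ :=
  ∫ y in cell d, ρ (x - y) * g y

theorem SmoothPer.integrable_mul {ρ g : (Fin d → ℝ) → ℝ} (hρ : SmoothPer ρ)
    (hg : Integrable g (volume.restrict (cell d))) (x : Fin d → ℝ) :
    Integrable (fun y => ρ (x - y) * g y) (volume.restrict (cell d)) := by
  obtain ⟨C, -, hC⟩ := hρ.exists_bound
  exact hg.bdd_mul (c := C) ((hρ.1.continuous.comp (continuous_const.sub continuous_id)).aestronglyMeasurable)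
    (Eventually.of_forall fun y => hC _)

theorem hasFDerivAt_mollify {ρ g : (Fin d → ℝ) → ℝ} (hρ : SmoothPer ρ)
    (hg : Integrable g (volume.restrict (cell d))) (x : Fin d → ℝ) :
    HasFDerivAt (mollify ρ g) (∫ y in cell d, g y • fderiv ℝ ρ (x - y)) x := by
  obtain ⟨C, hC0, hC⟩ := hρ.exists_fderiv_bound
  have hdc : Continuous (fderiv ℝ ρ) := hρ.1.continuous_fderiv (by simp)
  refine hasFDerivAt_integral_of_dominated_of_fderiv_le (s := univ)
    (F' := fun x y => g y • fderiv ℝ ρ (x - y)) (bound := fun y => |g y| * C) univ_mem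
    (Eventually.of_forall fun x => (hρ.integrable_mul hg x).aestronglyMeasurable)
    (hρ.integrable_mul hg x) ?_ ?_ ?_ ?_
  · exact hg.aestronglyMeasurable.smul
      (hdc.comp (continuous_const.sub continuous_id)).aestronglyMeasurable
  · refine Eventually.of_forall fun y z _ => ?_
    rw [norm_smul]
    exact mul_le_mul_of_nonneg_left (hC _) (abs_nonneg _)
  · exact hg.abs.mul_const C
  · refine Eventually.of_forall fun y z _ => ?_
    have h1 : HasFDerivAt (fun z => ρ (z - y)) (fderiv ℝ ρ (z - y)) z := by
      have := ((hρ.1.differentiable (by simp)) (z - y)).hasFDerivAt.comp z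
        ((hasFDerivAt_id z).sub_const y)
      rwa [ContinuousLinearMap.comp_id] at this
    exact h1.mul_const (g y)

theorem fderiv_mollify_apply {ρ g : (Fin d → ℝ) → ℝ} (hρ : SmoothPer ρ)
    (hg : Integrable g (volume.restrict (cell d))) (x z : Fin d → ℝ) :
    fderiv ℝ (mollify ρ g) x z = mollify (fun y => fderiv ℝ ρ y z) g x := by
  obtain ⟨C, hC0, hC⟩ := hρ.exists_fderiv_bound
  have hdc : Continuous (fderiv ℝ ρ) := hρ.1.continuous_fderiv (by simp)
  have hint : Integrable (fun y => g y • fderiv ℝ ρ (x - y)) (volume.restrict (cell d)) := by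
    refine hg.smul_bdd (C := C)
      (hdc.comp (continuous_const.sub continuous_id)).aestronglyMeasurable
      (Eventually.of_forall fun y => hC _)
  rw [(hasFDerivAt_mollify hρ hg x).fderiv, ContinuousLinearMap.integral_apply hint]
  simp only [mollify, smul_apply, smul_eq_mul, mul_comm]

theorem pd_mollify {ρ g : (Fin d → ℝ) → ℝ} (hρ : SmoothPer ρ)
    (hg : Integrable g (volume.restrict (cell d))) (i : Fin d) :
    pd i (mollify ρ g) = mollify (pd i ρ) g :=
  funext fun x => fderiv_mollify_apply hρ hg x _

theorem pdMulti_mollify {ρ g : (Fin d → ℝ) → ℝ} (hρ : SmoothPer ρ)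
    (hg : Integrable g (volume.restrict (cell d))) (α : Fin d → ℕ) :
    pdMulti α (mollify ρ g) = mollify (pdMulti α ρ) g :=
  pdMulti_comm (fun _ i h => SmoothPer.pd h i) (A := fun ρ => mollify ρ g)
    (fun _ i h => pd_mollify h hg i) hρ α

/-- Derivatives fall on the kernel and directional derivatives of a smooth periodic kernel are again
such kernels, so the induction on the order has to run over all kernels at once. -/
theorem smoothPer_mollify {ρ g : (Fin d → ℝ) → ℝ} (hρ : SmoothPer ρ)
    (hg : Integrable g (volume.restrict (cell d))) : SmoothPer (mollify ρ g) := by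
  refine ⟨contDiff_infty.2 fun k => ?_, fun k x => ?_⟩
  · induction k generalizing ρ with
    | zero =>
      have : Differentiable ℝ (mollify ρ g) :=
        fun x => (hasFDerivAt_mollify hρ hg x).differentiableAt
      exact contDiff_zero.2 this.continuous
    | succ k ih =>
      push_cast
      refine contDiff_succ_iff_fderiv_apply.2
        ⟨fun x => (hasFDerivAt_mollify hρ hg x).differentiableAt, by simp, fun z => ?_⟩
      simp only [fderiv_mollify_apply hρ hg]
      exact ih (hρ.fderiv_apply z)
  · simp only [mollify]
    congr 1
    ext y
    rw [add_sub_right_comm, hρ.2]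

theorem continuous_mollify {ρ g : (Fin d → ℝ) → ℝ} (hρ : SmoothPer ρ)
    (hg : Integrable g (volume.restrict (cell d))) : Continuous (mollify ρ g) :=
  (smoothPer_mollify hρ hg).1.continuous

/-- The unnormalised kernel. -/
noncomputable def kerBase (d : ℕ) (z : Fin d → ℝ) : ℝ :=
  ∏ i, (1 + Real.cos (2 * Real.pi * z i)) / 2

/-- The mass of the powers of the unnormalised kernel. -/
noncomputable def kerMass (d k : ℕ) : ℝ := ∫ y in cell d, kerBase d y ^ k

/-- An approximate identity on the torus, made of trigonometric polynomials. -/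
noncomputable def torusKer (d k : ℕ) (z : Fin d → ℝ) : ℝ := (kerMass d k)⁻¹ * kerBase d z ^ k

theorem contDiff_kerBase (d : ℕ) : ContDiff ℝ ∞ (kerBase d) := by
  unfold kerBase
  refine contDiff_prod fun i _ => ContDiff.div_const (contDiff_const.add ?_) 2
  exact Real.contDiff_cos.comp (contDiff_const.mul (contDiff_apply ℝ ℝ i))

theorem kerBase_periodic (d : ℕ) : IsPeriodic (kerBase d) := fun k x => by
  unfold kerBase
  refine Finset.prod_congr rfl fun i _ => ?_
  have : 2 * Real.pi * (x + fun i => (k i : ℝ)) i = 2 * Real.pi * x i + k i * (2 * Real.pi) := by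
    simp only [Pi.add_apply]; ring
  rw [this, Real.cos_add_int_mul_two_pi]

theorem kerBase_nonneg (d : ℕ) (z : Fin d → ℝ) : 0 ≤ kerBase d z :=
  Finset.prod_nonneg fun i _ => by linarith [Real.neg_one_le_cos (2 * Real.pi * z i)]

theorem kerBase_neg (d : ℕ) (z : Fin d → ℝ) : kerBase d (-z) = kerBase d z := by
  simp [kerBase]

theorem integral_cell_prod (f : ℝ → ℝ) :
    ∫ y in cell d, ∏ i, f (y i) = ∏ _i : Fin d, ∫ s in (0 : ℝ)..1, f s := by
  rw [volume_pi, cell, Measure.restrict_pi_pi, integral_fintype_prod_eq_prod (fun _ => f)]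
  refine Finset.prod_congr rfl fun i _ => ?_
  rw [intervalIntegral.integral_of_le zero_le_one, integral_Ico_eq_integral_Ioc]

theorem kerBase_pow_eq (k : ℕ) (z : Fin d → ℝ) :
    kerBase d z ^ k = ∏ i, ((1 + Real.cos (2 * Real.pi * z i)) / 2) ^ k := by
  rw [kerBase, Finset.prod_pow]

theorem kerMass_pos (d k : ℕ) : 0 < kerMass d k := by
  simp only [kerMass, kerBase_pow_eq]
  rw [integral_cell_prod (fun s => ((1 + Real.cos (2 * Real.pi * s)) / 2) ^ k)]
  refine Finset.prod_pos fun i _ => ?_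
  refine intervalIntegral.integral_pos zero_lt_one ?_ (fun s _ => ?_) ⟨0, by simp, by simp⟩
  · exact Continuous.continuousOn (by fun_prop)
  · exact pow_nonneg (by linarith [Real.neg_one_le_cos (2 * Real.pi * s)]) k

/-- The kernel is a product, so translation invariance of its mass reduces in each coordinate to the
integral of a 1-periodic function over an interval of length one. -/
theorem integral_kerBase_pow_sub (k : ℕ) (x : Fin d → ℝ) :
    ∫ y in cell d, kerBase d (x - y) ^ k = kerMass d k := by
  simp only [kerMass, kerBase_pow_eq]
  rw [integral_cell_prod (fun s => ((1 + Real.cos (2 * Real.pi * s)) / 2) ^ k),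
    volume_pi, cell, Measure.restrict_pi_pi]
  simp only [Pi.sub_apply]
  rw [integral_fintype_prod_eq_prod
      (fun i s => ((1 + Real.cos (2 * Real.pi * (x i - s))) / 2) ^ k)]
  refine Finset.prod_congr rfl fun i _ => ?_
  rw [integral_Ico_eq_integral_Ioc, ← intervalIntegral.integral_of_le zero_le_one,
    intervalIntegral.integral_comp_sub_left
      (fun s => ((1 + Real.cos (2 * Real.pi * s)) / 2) ^ k) (x i)]
  have hper : Function.Periodic (fun s => ((1 + Real.cos (2 * Real.pi * s)) / 2) ^ k) 1 := by
    intro s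
    simp only [mul_add, mul_one, Real.cos_add_two_pi]
  have := hper.intervalIntegral_add_eq (x i - 1) 0
  simpa using this

theorem smoothPer_torusKer (d k : ℕ) : SmoothPer (torusKer d k) :=
  ⟨contDiff_const.mul ((contDiff_kerBase d).pow k), fun m x => by
    simp only [torusKer, kerBase_periodic d m x]⟩

theorem torusKer_nonneg (d k : ℕ) (z : Fin d → ℝ) : 0 ≤ torusKer d k z :=
  mul_nonneg (inv_nonneg.2 (kerMass_pos d k).le) (pow_nonneg (kerBase_nonneg d z) k)

theorem integral_torusKer_sub (k : ℕ) (x : Fin d → ℝ) :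
    ∫ y in cell d, torusKer d k (x - y) = 1 := by
  simp only [torusKer]
  rw [integral_const_mul, integral_kerBase_pow_sub, inv_mul_cancel₀ (kerMass_pos d k).ne']

theorem integral_torusKer_sub' (k : ℕ) (y : Fin d → ℝ) :
    ∫ x in cell d, torusKer d k (x - y) = 1 := by
  rw [← integral_torusKer_sub k y]
  congr 1
  ext x
  rw [torusKer, torusKer, ← neg_sub, kerBase_neg]

/-- The maximum is attained exactly on the integer lattice; the bound `|z i| < 1` leaves only the
origin. -/
theorem kerBase_lt_one {z : Fin d → ℝ} (hz : ∀ i, |z i| < 1) (hne : z ≠ 0) :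
    kerBase d z < kerBase d 0 := by
  obtain ⟨j, hj⟩ := Function.ne_iff.1 hne
  have hj0 : z j ≠ 0 := by simpa using hj
  have h1 : kerBase d 0 = 1 := by simp [kerBase]
  have hle : ∀ s : ℝ, (1 + Real.cos s) / 2 ≤ 1 := fun s => by linarith [Real.cos_le_one s]
  have hnn : ∀ s : ℝ, 0 ≤ (1 + Real.cos s) / 2 := fun s => by linarith [Real.neg_one_le_cos s]
  have hlt : (1 + Real.cos (2 * Real.pi * z j)) / 2 < 1 := by
    have : Real.cos (2 * Real.pi * z j) ≠ 1 := by
      intro h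
      rw [Real.cos_eq_one_iff] at h
      obtain ⟨m, hm⟩ := h
      have hm' : (m : ℝ) = z j := by
        have : (m : ℝ) * (2 * Real.pi) = z j * (2 * Real.pi) := by linarith
        exact mul_right_cancel₀ (by positivity) this
      have hmabs := hz j
      rw [← hm', ← Int.cast_abs] at hmabs
      have : |m| < 1 := by exact_mod_cast hmabs
      rw [Int.abs_lt_one_iff] at this
      exact hj0 (by rw [← hm', this, Int.cast_zero])
    linarith [lt_of_le_of_ne (Real.cos_le_one _) this]
  rw [h1, kerBase, ← Finset.mul_prod_erase _ _ (Finset.mem_univ j)]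
  calc _ ≤ (1 + Real.cos (2 * Real.pi * z j)) / 2 * 1 :=
        mul_le_mul_of_nonneg_left (Finset.prod_le_one (fun _ _ => hnn _) fun _ _ => hle _) (hnn _)
    _ < 1 := by rwa [mul_one]

/-- Normalised powers of a function with a unique maximum concentrate at it. For `x` interior to the
cell, `y = x` is the only maximiser of `kerBase d (x - y)` over the closed cell, so no periodicity
of `g` is needed; at boundary points opposite faces would also contribute. -/
theorem tendsto_mollify_of_continuous {g : (Fin d → ℝ) → ℝ} (hg : Continuous g)
    {x : Fin d → ℝ} (hx : ∀ i, x i ∈ Ioo (0 : ℝ) 1) :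
    Tendsto (fun k => mollify (torusKer d k) g x) atTop (𝓝 (g x)) := by
  have hint : x ∈ interior (Icc (0 : Fin d → ℝ) 1) := by
    rw [← pi_univ_Icc, interior_pi_set finite_univ]
    simp only [interior_Icc]
    exact fun i _ => hx i
  have h := tendsto_setIntegral_pow_smul_of_unique_maximum_of_isCompact_of_continuousOn
    (μ := volume) (isCompact_Icc (a := (0 : Fin d → ℝ)) (b := 1)) (c := fun y => kerBase d (x - y))
    (g := g) (x₀ := x)
    (((contDiff_kerBase d).continuous.comp (continuous_const.sub continuous_id)).continuousOn)
    (fun y hy hne => by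
      rw [sub_self]
      refine kerBase_lt_one (fun i => ?_) (sub_ne_zero.2 hne.symm)
      have h1 := hy.1 i
      have h2 := hy.2 i
      have h3 := hx i
      simp only [Pi.zero_apply, Pi.one_apply] at h1 h2
      rw [Pi.sub_apply, abs_lt]
      exact ⟨by linarith [h3.1], by linarith [h3.2]⟩)
    (fun y _ => kerBase_nonneg d _) (by simp [kerBase]) (subset_closure hint) hg.continuousOn
  refine h.congr fun k => ?_
  rw [← Measure.restrict_congr_set (cell_ae_eq_Icc d), integral_kerBase_pow_sub, smul_eq_mul,
    mollify, ← integral_const_mul]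
  simp only [torusKer, smul_eq_mul, mul_assoc]

end Mollify

/-! ### Convergence of mollifications in `L¹` and almost everywhere. -/

section MollifyConvergence

variable {d : ℕ}

theorem abs_mollify_torusKer_le {g : (Fin d → ℝ) → ℝ} {C : ℝ} (hC : ∀ y, |g y| ≤ C) (k : ℕ)
    (x : Fin d → ℝ) : |mollify (torusKer d k) g x| ≤ C := by
  have h1 : Integrable (fun y => torusKer d k (x - y) * C) (volume.restrict (cell d)) :=
    (smoothPer_torusKer d k).integrable_mul (integrable_const C) x
  rw [← Real.norm_eq_abs, mollify]
  refine (norm_integral_le_of_norm_le h1 (Eventually.of_forall fun y => ?_)).trans_eq ?_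
  · rw [norm_mul, Real.norm_of_nonneg (torusKer_nonneg d k _)]
    exact mul_le_mul_of_nonneg_left (hC y) (torusKer_nonneg d k _)
  · rw [integral_mul_const, integral_torusKer_sub, one_mul]

theorem mollify_sub {ρ f g : (Fin d → ℝ) → ℝ} (hρ : SmoothPer ρ)
    (hf : Integrable f (volume.restrict (cell d))) (hg : Integrable g (volume.restrict (cell d)))
    (x : Fin d → ℝ) : mollify ρ (fun y => f y - g y) x = mollify ρ f x - mollify ρ g x := by
  simp only [mollify, mul_sub]
  exact integral_sub (hρ.integrable_mul hf x) (hρ.integrable_mul hg x)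

theorem integrable_mollify {ρ g : (Fin d → ℝ) → ℝ} (hρ : SmoothPer ρ)
    (hg : Integrable g (volume.restrict (cell d))) :
    Integrable (mollify ρ g) (volume.restrict (cell d)) := by
  obtain ⟨C, -, hC⟩ := (smoothPer_mollify hρ hg).exists_bound
  exact Integrable.of_bound (continuous_mollify hρ hg).aestronglyMeasurable C
    (Eventually.of_forall hC)

/-- Fubini, using that the nonnegative kernel has mass one in either variable. -/
theorem integral_abs_mollify_le {g : (Fin d → ℝ) → ℝ}
    (hg : Integrable g (volume.restrict (cell d))) (k : ℕ) :
    ∫ x in cell d, |mollify (torusKer d k) g x| ≤ ∫ y in cell d, |g y| := by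
  have hρ := smoothPer_torusKer d k
  obtain ⟨C, -, hC⟩ := hρ.exists_bound
  have hprod : Integrable (fun p : (Fin d → ℝ) × (Fin d → ℝ) =>
      torusKer d k (p.1 - p.2) * |g p.2|)
      ((volume.restrict (cell d)).prod (volume.restrict (cell d))) :=
    (hg.abs.comp_snd (volume.restrict (cell d))).bdd_mul (c := C)
      (hρ.1.continuous.comp (continuous_fst.sub continuous_snd)).aestronglyMeasurable
      (Eventually.of_forall fun p => hC _)
  calc ∫ x in cell d, |mollify (torusKer d k) g x|
      ≤ ∫ x in cell d, ∫ y in cell d, torusKer d k (x - y) * |g y| := by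
        refine integral_mono (integrable_mollify hρ hg).abs hprod.integral_prod_left fun x => ?_
        refine (abs_integral_le_integral_abs).trans_eq ?_
        simp only [abs_mul, abs_of_nonneg (torusKer_nonneg d k _)]
    _ = ∫ y in cell d, ∫ x in cell d, torusKer d k (x - y) * |g y| := integral_integral_swap hprod
    _ = ∫ y in cell d, |g y| := by
        simp only [integral_mul_const, integral_torusKer_sub', one_mul]

theorem ae_cell_mem_Ioo (d : ℕ) :
    ∀ᵐ x ∂(volume.restrict (cell d)), ∀ i, x i ∈ Ioo (0 : ℝ) 1 := by
  have h : (univ.pi fun _ => Ioo (0 : ℝ) 1 : Set (Fin d → ℝ)) =ᵐ[volume] Icc 0 1 :=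
    Measure.univ_pi_Ioo_ae_eq_Icc
  rw [Measure.restrict_congr_set ((cell_ae_eq_Icc d).trans h.symm)]
  filter_upwards [ae_restrict_mem (MeasurableSet.univ_pi fun _ => measurableSet_Ioo)] with x hx i
  exact hx i (mem_univ i)

/-- Density of continuous functions in `L¹`: for the approximant dominated convergence applies, and
the error is controlled by the `L¹` contraction property of the mollification. -/
theorem tendsto_integral_abs_mollify_sub {g : (Fin d → ℝ) → ℝ}
    (hg : Integrable g (volume.restrict (cell d))) :
    Tendsto (fun k => ∫ x in cell d, |mollify (torusKer d k) g x - g x|) atTop (𝓝 0) := by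
  rw [Metric.tendsto_atTop]
  intro ε hε
  obtain ⟨f, hfs, hfle, hfc, hfi⟩ :=
    hg.exists_hasCompactSupport_integral_sub_le (show 0 < ε / 4 by positivity)
  obtain ⟨C, hC⟩ := hfs.exists_bound_of_continuous hfc
  have hlim : Tendsto (fun k => ∫ x in cell d, |mollify (torusKer d k) f x - f x|) atTop
      (𝓝 (∫ x in cell d, (0 : ℝ))) := by
    refine tendsto_integral_of_dominated_convergence (fun _ => C + C) (fun k => ?_)
      (integrable_const _) (fun k => Eventually.of_forall fun x => ?_) ?_
    · exact ((integrable_mollify (smoothPer_torusKer d k) hfi).sub hfi).abs.aestronglyMeasurable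
    · rw [Real.norm_eq_abs, abs_abs]
      exact (abs_sub _ _).trans (add_le_add (abs_mollify_torusKer_le hC k x) (hC x))
    · filter_upwards [ae_cell_mem_Ioo d] with x hx
      have := ((tendsto_mollify_of_continuous hfc hx).sub_const (f x)).abs
      simpa using this
  rw [integral_zero, Metric.tendsto_atTop] at hlim
  obtain ⟨k₀, hk₀⟩ := hlim (ε / 4) (by positivity)
  refine ⟨k₀, fun k hk => ?_⟩
  have h1 := hk₀ k hk
  rw [Real.dist_eq, sub_zero, abs_of_nonneg (integral_nonneg fun _ => abs_nonneg _)] at h1 ⊢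
  have hρ := smoothPer_torusKer d k
  have i1 : Integrable (fun x => |mollify (torusKer d k) (fun y => g y - f y) x|)
    (volume.restrict (cell d)) := (integrable_mollify hρ (hg.sub hfi)).abs
  have i2 : Integrable (fun x => |mollify (torusKer d k) f x - f x|)
    (volume.restrict (cell d)) := ((integrable_mollify hρ hfi).sub hfi).abs
  have i3 : Integrable (fun x => |g x - f x|) (volume.restrict (cell d)) := (hg.sub hfi).abs
  calc ∫ x in cell d, |mollify (torusKer d k) g x - g x|
      ≤ ∫ x in cell d, (|mollify (torusKer d k) (fun y => g y - f y) x|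
          + |mollify (torusKer d k) f x - f x| + |g x - f x|) := by
        refine integral_mono ((integrable_mollify hρ hg).sub hg).abs ((i1.add i2).add i3)
          fun x => ?_
        simp only
        rw [mollify_sub hρ hg hfi]
        have e : mollify (torusKer d k) g x - g x =
            (mollify (torusKer d k) g x - mollify (torusKer d k) f x)
            + (mollify (torusKer d k) f x - f x) - (g x - f x) := by ring
        rw [e]
        exact (abs_sub _ _).trans (add_le_add_left (abs_add_le _ _) _)
    _ = (∫ x in cell d, |mollify (torusKer d k) (fun y => g y - f y) x|)
          + (∫ x in cell d, |mollify (torusKer d k) f x - f x|)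
          + ∫ x in cell d, |g x - f x| := by
        have i12 : Integrable (fun x => |mollify (torusKer d k) (fun y => g y - f y) x|
          + |mollify (torusKer d k) f x - f x|) (volume.restrict (cell d)) := i1.add i2
        rw [integral_add i12 i3, integral_add i1 i2]
    _ < ε := by
        have h2 := integral_abs_mollify_le (hg.sub hfi) k
        simp only [Real.norm_eq_abs] at hfle
        simp only [Pi.sub_apply] at h2
        have h3 : ∫ x in cell d, |mollify (torusKer d k) (fun y => g y - f y) x|
          ≤ ∫ x in cell d, |g x - f x| := h2
        linarith

/-- Finitely many integrable functions are a.e. limits of their mollifications, along a common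
subsequence. -/
theorem exists_seq_tendsto_mollify {ι : Type*} [Fintype ι] {g : ι → (Fin d → ℝ) → ℝ}
    (hg : ∀ j, Integrable (g j) (volume.restrict (cell d))) :
    ∃ φ : ℕ → ℕ, StrictMono φ ∧ ∀ᵐ x ∂(volume.restrict (cell d)), ∀ j,
      Tendsto (fun k => mollify (torusKer d (φ k)) (g j) x) atTop (𝓝 (g j x)) := by
  -- Summing the errors over the finite index set lets one subsequence serve all the functions.
  set S : ℕ → (Fin d → ℝ) → ℝ := fun k x => ∑ j, |mollify (torusKer d k) (g j) x - g j x|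
  have hi : ∀ k j, Integrable (fun x => |mollify (torusKer d k) (g j) x - g j x|)
      (volume.restrict (cell d)) := fun k j =>
    ((integrable_mollify (smoothPer_torusKer d k) (hg j)).sub (hg j)).abs
  have hSi : ∀ k, Integrable (S k) (volume.restrict (cell d)) := fun k =>
    integrable_finsetSum _ fun j _ => hi k j
  have hSnn : ∀ k x, 0 ≤ S k x := fun k x => Finset.sum_nonneg fun _ _ => abs_nonneg _
  have hS : Tendsto (fun k => ∫ x in cell d, S k x) atTop (𝓝 0) := by
    have : Tendsto (fun k => ∑ j, ∫ x in cell d, |mollify (torusKer d k) (g j) x - g j x|) atTop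
        (𝓝 (∑ _j : ι, (0 : ℝ))) :=
      tendsto_finsetSum _ fun j _ => tendsto_integral_abs_mollify_sub (hg j)
    rw [Finset.sum_const_zero] at this
    refine this.congr fun k => (integral_finsetSum _ fun j _ => hi k j).symm
  have hm : TendstoInMeasure (volume.restrict (cell d)) S atTop (fun _ => 0) := by
    refine tendstoInMeasure_of_tendsto_eLpNorm one_ne_zero
      (fun k => (hSi k).aestronglyMeasurable) aestronglyMeasurable_const ?_
    have h2 : ∀ k, eLpNorm (S k - fun _ => 0) 1 (volume.restrict (cell d)) =
        ENNReal.ofReal (∫ x in cell d, S k x) := fun k => by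
      rw [eLpNorm_one_eq_lintegral_enorm, ofReal_integral_eq_lintegral_ofReal (hSi k)
        (Eventually.of_forall (hSnn k))]
      refine lintegral_congr fun x => ?_
      rw [Pi.sub_apply, sub_zero, Real.enorm_of_nonneg (hSnn k x)]
    simp only [h2]
    simpa using ENNReal.tendsto_ofReal hS
  obtain ⟨φ, hφ, hae⟩ := hm.exists_seq_tendsto_ae
  refine ⟨φ, hφ, ?_⟩
  filter_upwards [hae] with x hx j
  rw [tendsto_iff_dist_tendsto_zero]
  refine squeeze_zero (fun _ => dist_nonneg) (fun k => ?_) hx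
  rw [Real.dist_eq]
  exact Finset.single_le_sum (f := fun j => |mollify (torusKer d (φ k)) (g j) x - g j x|)
    (fun _ _ => abs_nonneg _) (Finset.mem_univ j)

/-- Mollification of vector fields. -/
noncomputable def mollifyVec {n : ℕ} (ρ : (Fin d → ℝ) → ℝ)
    (w : (Fin d → ℝ) → EuclideanSpace ℝ (Fin n)) (x : Fin d → ℝ) : EuclideanSpace ℝ (Fin n) :=
  WithLp.toLp 2 fun i => mollify ρ (fun y => w y i) x

/-- Mollification of matrix fields. -/
noncomputable def mollifyMat {N : ℕ} (ρ : (Fin d → ℝ) → ℝ)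
    (G : (Fin d → ℝ) → Matrix (Fin N) (Fin N) ℝ) (x : Fin d → ℝ) : Matrix (Fin N) (Fin N) ℝ :=
  Matrix.of fun l m => mollify ρ (fun y => G y l m) x

theorem integrable_euclidean_apply {X : Type*} [MeasurableSpace X] {μ : Measure X} {n : ℕ}
    {w : X → EuclideanSpace ℝ (Fin n)} (hw : Integrable w μ) (i : Fin n) :
    Integrable (fun x => w x i) μ :=
  (EuclideanSpace.proj (𝕜 := ℝ) i).integrable_comp hw

theorem smoothVec_mollifyVec {n : ℕ} {ρ : (Fin d → ℝ) → ℝ} (hρ : SmoothPer ρ)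
    {w : (Fin d → ℝ) → EuclideanSpace ℝ (Fin n)} (hw : Integrable w (volume.restrict (cell d))) :
    SmoothVec (mollifyVec ρ w) := fun i => smoothPer_mollify hρ (integrable_euclidean_apply hw i)

/-- Jensen's inequality for the Legendre transform. -/
theorem legendre_mollifyVec_le {n : ℕ} {K : EuclideanSpace ℝ (Fin n) → ℝ} (hK : IsNFunction K)
    {w : (Fin d → ℝ) → EuclideanSpace ℝ (Fin n)} (hw : Integrable w (volume.restrict (cell d)))
    (hKw : Integrable (fun x => legendre K (w x)) (volume.restrict (cell d))) (k : ℕ)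
    (x : Fin d → ℝ) : legendre K (mollifyVec (torusKer d k) w x) ≤
      mollify (torusKer d k) (fun y => legendre K (w y)) x := by
  have hρ := smoothPer_torusKer d k
  -- The transform is a supremum of affine functions, so it suffices to average Young's inequality
  -- for each fixed `a` against the probability kernel.
  refine legendre_le fun a => ?_
  have e1 : inner ℝ a (mollifyVec (torusKer d k) w x) =
      ∫ y in cell d, torusKer d k (x - y) * inner ℝ a (w y) := by
    simp only [PiLp.inner_apply, mollifyVec, mollify, Finset.mul_sum]
    rw [integral_finsetSum _ fun i _ => ?_]
    · refine Finset.sum_congr rfl fun i _ => ?_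
      simp only [RCLike.inner_apply, conj_trivial]
      rw [← integral_mul_const]
      simp only [mul_assoc]
    · exact hρ.integrable_mul ((integrable_euclidean_apply hw i).mul_const (a i)) x
  have e2 : K a = ∫ y in cell d, torusKer d k (x - y) * K a := by
    rw [integral_mul_const, integral_torusKer_sub, one_mul]
  have i2 := hρ.integrable_mul (integrable_const (μ := volume.restrict (cell d)) (K a)) x
  have i3 := hρ.integrable_mul hKw x
  rw [e1, e2, mollify, ← integral_add i2 i3]
  refine integral_mono (hρ.integrable_mul (hw.const_inner a) x) (i2.add i3) fun y => ?_
  simp only [← mul_add]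
  exact mul_le_mul_of_nonneg_left (hK.inner_le _ _) (torusKer_nonneg d k _)

end MollifyConvergence

/-! ### The operators on mollification kernels -/

section Kernel

variable {d n N : ℕ}

/-- The symmetric matrix `e_a ⊗ e_b + e_b ⊗ e_a`. -/
def symBasis (a b : Fin N) : Matrix (Fin N) (Fin N) ℝ :=
  Matrix.of fun l m => (if l = a then 1 else 0) * (if m = b then 1 else 0) +
    (if l = b then 1 else 0) * (if m = a then 1 else 0)

theorem sum_symBasis_mul (a b : Fin N) (f : Fin N → Fin N → ℝ) :
    ∑ l, ∑ m, symBasis a b l m * f l m = f a b + f b a := by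
  simp [symBasis, add_mul, Finset.sum_add_distrib]

theorem isSymm_symBasis (a b : Fin N) : (symBasis a b).IsSymm := by
  ext l m
  simp only [symBasis, Matrix.transpose_apply, Matrix.of_apply]
  ring

theorem frob_smul_symBasis (A : Matrix (Fin N) (Fin N) ℝ) (c : ℝ) (a b : Fin N) :
    frob A (c • symBasis a b) = c * (A a b + A b a) := by
  rw [frob_smul_right, frob_comm, frob, sum_symBasis_mul a b fun l m => A l m]

theorem DiffOp.app_const_smul (L : DiffOp d n N) (c : ℝ)
    (Ξ : (Fin d → ℝ) → Matrix (Fin N) (Fin N) ℝ) (x : Fin d → ℝ) :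
    L.app (fun y => c • Ξ y) x = c • L.app Ξ x := by
  ext i
  simp only [DiffOp.app, PiLp.smul_apply, smul_eq_mul, Finset.mul_sum, Matrix.smul_apply,
    pdMulti_const_mul]
  refine Finset.sum_congr rfl fun _ _ => Finset.sum_congr rfl fun _ _ =>
    Finset.sum_congr rfl fun _ _ => Finset.sum_congr rfl fun _ _ => by ring

theorem DiffOp.app_kernel (L : DiffOp d n N) (ρ : (Fin d → ℝ) → ℝ) (x : Fin d → ℝ)
    (a b : Fin N) (y : Fin d → ℝ) (i : Fin n) :
    L.app (fun y => ρ (x - y) • symBasis a b) y i = ∑ j ∈ Finset.range (L.order + 1),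
      ∑ α ∈ Finset.piAntidiag Finset.univ j,
        (L.coeff i a b α + L.coeff i b a α) * (-1) ^ j * pdMulti α ρ (x - y) := by
  simp only [DiffOp.app]
  refine Finset.sum_congr rfl fun j _ => ?_
  have h1 : ∀ l m, ∀ α ∈ Finset.piAntidiag (Finset.univ : Finset (Fin d)) j,
      L.coeff i l m α * pdMulti α (fun y => (ρ (x - y) • symBasis a b) l m) y =
        symBasis a b l m * (L.coeff i l m α * (-1) ^ j * pdMulti α ρ (x - y)) := by
    intro l m α hα
    rw [Finset.mem_piAntidiag] at hα
    have e : (fun y => (ρ (x - y) • symBasis a b) l m) =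
        fun y => symBasis a b l m * ρ (x - y) := by
      ext y
      rw [Matrix.smul_apply, smul_eq_mul, mul_comm]
    rw [e, pdMulti_const_mul _ (fun y => ρ (x - y)), pdMulti_comp_const_sub, hα.1]
    ring
  rw [Finset.sum_congr rfl fun l _ => Finset.sum_congr rfl fun m _ =>
    Finset.sum_congr rfl (h1 l m)]
  simp only [← Finset.mul_sum]
  rw [sum_symBasis_mul a b fun l m => ∑ α ∈ Finset.piAntidiag Finset.univ j,
    L.coeff i l m α * (-1) ^ j * pdMulti α ρ (x - y), ← Finset.sum_add_distrib]
  exact Finset.sum_congr rfl fun α _ => by ring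

/-- Pairing with `L` of a reflected kernel is evaluation of `L^*` on the mollified field: the sign
`(-1)^j` produced by the reflection is the one in the adjoint, and the factor 2 arises because
`symBasis` counts the entries `(a,b)` and `(b,a)` without halving. -/
theorem DiffOp.integral_inner_app_kernel (L : DiffOp d n N) {ρ : (Fin d → ℝ) → ℝ}
    (hρ : SmoothPer ρ) {w : (Fin d → ℝ) → EuclideanSpace ℝ (Fin n)}
    (hw : Integrable w (volume.restrict (cell d))) (x : Fin d → ℝ) (a b : Fin N) :
    ∫ y in cell d, inner ℝ (w y) (L.app (fun y => ρ (x - y) • symBasis a b) y) =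
      2 * L.adj (mollifyVec ρ w) x a b := by
  have hi : ∀ i α, Integrable (fun y => pdMulti α ρ (x - y) * w y i) (volume.restrict (cell d)) :=
    fun i α => (hρ.pdMulti α).integrable_mul (integrable_euclidean_apply hw i) x
  have e : ∀ y, inner ℝ (w y) (L.app (fun y => ρ (x - y) • symBasis a b) y) =
      ∑ i, ∑ j ∈ Finset.range (L.order + 1), ∑ α ∈ Finset.piAntidiag Finset.univ j,
        (L.coeff i a b α + L.coeff i b a α) * (-1) ^ j * (pdMulti α ρ (x - y) * w y i) := by
    intro y
    simp only [PiLp.inner_apply, RCLike.inner_apply, conj_trivial, DiffOp.app_kernel,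
      Finset.sum_mul, mul_assoc]
  simp only [e]
  rw [integral_finsetSum _ fun i _ => integrable_finsetSum _ fun j _ =>
    integrable_finsetSum _ fun α _ => (hi i α).const_mul _]
  have e2 : ∀ i, ∫ y in cell d, ∑ j ∈ Finset.range (L.order + 1),
      ∑ α ∈ Finset.piAntidiag Finset.univ j,
        (L.coeff i a b α + L.coeff i b a α) * (-1) ^ j * (pdMulti α ρ (x - y) * w y i) =
      ∑ j ∈ Finset.range (L.order + 1), ∑ α ∈ Finset.piAntidiag Finset.univ j,
        (L.coeff i a b α + L.coeff i b a α) * (-1) ^ j *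
          pdMulti α (fun y => mollifyVec ρ w y i) x := by
    intro i
    rw [integral_finsetSum _ fun j _ => integrable_finsetSum _ fun α _ => (hi i α).const_mul _]
    refine Finset.sum_congr rfl fun j _ => ?_
    rw [integral_finsetSum _ fun α _ => (hi i α).const_mul _]
    refine Finset.sum_congr rfl fun α _ => ?_
    rw [integral_const_mul]
    congr 1
    exact (congrFun (pdMulti_mollify hρ (integrable_euclidean_apply hw i) α) x).symm
  simp only [e2, DiffOp.adj, Matrix.of_apply, Finset.mul_sum]
  rw [Finset.sum_comm]
  refine Finset.sum_congr rfl fun _ _ => Finset.sum_congr rfl fun _ _ =>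
    Finset.sum_congr rfl fun _ _ => by ring

theorem DiffOp.continuous_adj_mollifyVec (L : DiffOp d n N) {ρ : (Fin d → ℝ) → ℝ}
    (hρ : SmoothPer ρ) {w : (Fin d → ℝ) → EuclideanSpace ℝ (Fin n)}
    (hw : Integrable w (volume.restrict (cell d))) (a b : Fin N) :
    Continuous (fun x => L.adj (mollifyVec ρ w) x a b) := by
  simp only [DiffOp.adj, Matrix.of_apply]
  refine continuous_finsetSum _ fun j _ => continuous_const.mul (continuous_finsetSum _ fun i _ =>
    continuous_finsetSum _ fun α _ => continuous_const.mul ?_)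
  exact ((smoothPer_mollify hρ (integrable_euclidean_apply hw i)).pdMulti α).1.continuous

end Kernel

/-! ### Space-time integrals -/

section SpaceTime

variable {d n N : ℕ} {T τ : ℝ}

theorem volume_restrict_cylinder (d : ℕ) (τ : ℝ) : volume.restrict (cylinder d τ) =
    (volume.restrict (Ioo 0 τ)).prod (volume.restrict (cell d)) := by
  rw [cylinder, Measure.volume_eq_prod, Measure.prod_restrict]

theorem measurableSet_cylinder (d : ℕ) (τ : ℝ) : MeasurableSet (cylinder d τ) :=
  measurableSet_Ioo.prod (measurableSet_cell d)

theorem cylinder_mono (d : ℕ) (h : τ ≤ T) : cylinder d τ ⊆ cylinder d T :=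
  prod_mono (Ioo_subset_Ioo_right h) subset_rfl

theorem setIntegral_cylinder_eq (h : τ ≤ T) {f : ℝ × (Fin d → ℝ) → ℝ}
    (hf : ∀ p : ℝ × (Fin d → ℝ), τ ≤ p.1 → f p = 0) :
    ∫ p in cylinder d T, f p = ∫ p in cylinder d τ, f p := by
  refine setIntegral_eq_of_subset_of_forall_sdiff_eq_zero (measurableSet_cylinder d T)
    (cylinder_mono d h) fun p hp => hf p ?_
  by_contra! hlt
  exact hp.2 ⟨⟨hp.1.1.1, hlt⟩, hp.1.2⟩

theorem integral_cylinder {f : ℝ × (Fin d → ℝ) → ℝ}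
    (hf : Integrable f (volume.restrict (cylinder d τ))) :
    ∫ p in cylinder d τ, f p = ∫ t in Ioo 0 τ, ∫ x in cell d, f (t, x) := by
  rw [volume_restrict_cylinder] at hf ⊢
  exact integral_prod f hf

/-- Smooth functions of time whose support is a compact part of `(0,τ)`, as multipliers, detect
the vanishing of spatial integrals. -/
theorem ae_integral_slice_eq_zero {f : ℝ × (Fin d → ℝ) → ℝ}
    (hf : Integrable f (volume.restrict (cylinder d τ)))
    (h : ∀ θ : ℝ → ℝ, ContDiff ℝ ∞ θ → HasCompactSupport θ → tsupport θ ⊆ Ioo 0 τ →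
      ∫ p in cylinder d τ, θ p.1 * f p = 0) :
    ∀ᵐ t ∂(volume.restrict (Ioo 0 τ)), ∫ x in cell d, f (t, x) = 0 := by
  have hf' := hf
  rw [volume_restrict_cylinder] at hf'
  have hint : IntegrableOn (fun t => ∫ x in cell d, f (t, x)) (Ioo 0 τ) := hf'.integral_prod_left
  rw [ae_restrict_iff' measurableSet_Ioo]
  refine isOpen_Ioo.ae_eq_zero_of_integral_contDiff_smul_eq_zero hint.locallyIntegrableOn
    fun θ hθ hc hs => ?_
  have hθf : Integrable (fun p : ℝ × (Fin d → ℝ) => θ p.1 * f p)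
      (volume.restrict (cylinder d τ)) := by
    obtain ⟨C, hC⟩ := hc.exists_bound_of_continuous hθ.continuous
    exact hf.bdd_mul (c := C) (hθ.continuous.comp continuous_fst).aestronglyMeasurable
      (Eventually.of_forall fun p => hC _)
  have h1 := h θ hθ hc hs
  rw [integral_cylinder hθf] at h1
  simp only [integral_const_mul] at h1
  rw [← h1]
  refine (setIntegral_eq_integral_of_forall_compl_eq_zero fun t ht => ?_).symm
  rw [image_eq_zero_of_notMem_tsupport fun h => ht (hs h), zero_smul]

theorem exists_Icc_of_tsupport_subset (hτ : 0 < τ) {θ : ℝ → ℝ} (hc : HasCompactSupport θ)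
    (hs : tsupport θ ⊆ Ioo 0 τ) :
    ∃ a b, 0 < a ∧ b < τ ∧ ∀ t, t ∉ Icc a b → θ t = 0 := by
  rcases (tsupport θ).eq_empty_or_nonempty with he | hne
  · refine ⟨τ / 2, τ / 2, by linarith, by linarith, fun t _ => ?_⟩
    exact image_eq_zero_of_notMem_tsupport (by rw [he]; exact fun h => h)
  · have hcomp : IsCompact (tsupport θ) := hc
    obtain ⟨a, ha, hamin⟩ := hcomp.exists_isMinOn hne continuousOn_id
    obtain ⟨b, hb, hbmax⟩ := hcomp.exists_isMaxOn hne continuousOn_id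
    refine ⟨a, b, (hs ha).1, (hs hb).2, fun t ht => ?_⟩
    exact image_eq_zero_of_notMem_tsupport fun h => ht ⟨hamin h, hbmax h⟩

/-- The integrated form of a weak time derivative with an initial value. -/
theorem ae_eq_add_integral_of_weak (hτ : 0 < τ) {m μ : ℝ → ℝ} {m₀ : ℝ}
    (hm : IntegrableOn m (Ioo 0 τ)) (hμ : IntegrableOn μ (Ioo 0 τ))
    (h : ∀ θ : ℝ → ℝ, ContDiff ℝ ∞ θ → (∃ b < τ, ∀ t, b ≤ t → θ t = 0) →
      ∫ t in Ioo 0 τ, (deriv θ t * m t + θ t * μ t) = -(θ 0 * m₀)) :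
    ∀ᵐ t ∂(volume.restrict (Ioo 0 τ)), m t = m₀ + ∫ s in (0)..t, μ s := by
  have hμ' : IntervalIntegrable μ volume 0 τ :=
    (intervalIntegrable_iff_integrableOn_Ioo_of_le hτ.le).2 hμ
  set P : ℝ → ℝ := fun t => ∫ s in (0)..t, μ s with hP
  have hPac : AbsolutelyContinuousOnInterval P 0 τ :=
    hμ'.absolutelyContinuousOnInterval_intervalIntegral (by simp)
  have hPc : ContinuousOn P (Icc 0 τ) := by simpa [uIcc_of_le hτ.le] using hPac.continuousOn
  have hPi : IntegrableOn P (Ioo 0 τ) := (hPc.integrableOn_Icc).mono_set Ioo_subset_Icc_self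
  have hz : IntegrableOn (fun t => m t - m₀ - P t) (Ioo 0 τ) :=
    (hm.sub (integrableOn_const (by simp))).sub hPi
  have key : ∀ᵐ t, t ∈ Ioo 0 τ → m t - m₀ - P t = 0 := by
    refine isOpen_Ioo.ae_eq_zero_of_integral_contDiff_smul_eq_zero hz.locallyIntegrableOn
      fun g hg hc hs => ?_
    obtain ⟨a, b, ha, hb, hab⟩ := exists_Icc_of_tsupport_subset hτ hc hs
    obtain ⟨C, hC⟩ := hc.exists_bound_of_continuous hg.continuous
    -- The base point `τ` makes the primitive of `g` vanish on `[b, τ]` and beyond, while `θ 0 = -∫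
    -- g` stays free. The test with `θ` therefore carries the initial value, and integration by
    -- parts against `P` turns it into a test of `m - m₀ - P` with the arbitrary function `g`.
    set θ : ℝ → ℝ := fun t => ∫ s in τ..t, g s with hθ
    have hder : ∀ t, HasDerivAt θ (g t) t := fun t =>
      intervalIntegral.integral_hasDerivAt_right (hg.continuous.intervalIntegrable _ _)
        (hg.continuous.stronglyMeasurableAtFilter _ _) hg.continuous.continuousAt
    have hdθ : deriv θ = g := funext fun t => (hder t).deriv
    have hθs : ContDiff ℝ ∞ θ :=
      contDiff_infty_iff_deriv.2 ⟨fun t => (hder t).differentiableAt, by rwa [hdθ]⟩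
    have hθ0 : ∀ t, b ≤ t → θ t = 0 := fun t ht => by
      refine (intervalIntegral.integral_congr_ae (g := fun _ => 0) ?_).trans (by simp)
      have hne : ∀ᵐ s : ℝ, s ≠ b := by simp [ae_iff]
      filter_upwards [hne] with s hsb hs'
      refine hab s fun hmem => hsb (le_antisymm hmem.2 ?_)
      rcases le_total τ t with h1 | h1
      · rw [uIoc_of_le h1] at hs'; linarith [hs'.1]
      · rw [uIoc_of_ge h1] at hs'; linarith [hs'.1]
    have h1 := h θ hθs ⟨b, hb, hθ0⟩
    rw [hdθ] at h1
    have hθac : AbsolutelyContinuousOnInterval θ 0 τ :=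
      ContDiffOn.absolutelyContinuousOnInterval (hθs.of_le (by simp)).contDiffOn
    have h2 := hθac.integral_mul_deriv_eq_deriv_mul hPac
    have h3 : ∫ t in (0)..τ, θ t * deriv P t = ∫ t in (0)..τ, θ t * μ t := by
      refine intervalIntegral.integral_congr_ae ?_
      filter_upwards [hμ'.ae_hasDerivAt_integral] with t ht hmem
      rw [(ht (uIoc_subset_uIcc hmem) 0 (by simp)).deriv]
    have hgm : IntegrableOn (fun t => g t * m t) (Ioo 0 τ) :=
      hm.bdd_mul (c := C) hg.continuous.aestronglyMeasurable (Eventually.of_forall hC)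
    have hgP : IntegrableOn (fun t => g t * P t) (Ioo 0 τ) :=
      hPi.bdd_mul (c := C) hg.continuous.aestronglyMeasurable (Eventually.of_forall hC)
    have hgi : IntegrableOn g (Ioo 0 τ) :=
      (hg.continuous.integrableOn_Icc (a := 0) (b := τ)).mono_set Ioo_subset_Icc_self
    have hθμ : IntegrableOn (fun t => θ t * μ t) (Ioo 0 τ) := by
      have := hμ'.continuousOn_mul (hθs.continuous.continuousOn (s := uIcc 0 τ))
      exact (intervalIntegrable_iff_integrableOn_Ioo_of_le hτ.le).1 this
    have hP0 : P 0 = 0 := by simp [hP]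
    have hθτ : θ τ = 0 := hθ0 τ hb.le
    have hθ00 : θ 0 = -∫ t in (0)..τ, g t := intervalIntegral.integral_symm _ _
    have hconv : ∀ f : ℝ → ℝ, ∫ t in (0)..τ, f t = ∫ t in Ioo 0 τ, f t := fun f => by
      rw [intervalIntegral.integral_of_le hτ.le, integral_Ioc_eq_integral_Ioo]
    rw [h3, hdθ, hP0, hθτ, hconv, hconv] at h2
    rw [hconv] at hθ00
    rw [integral_add hgm hθμ, h2, hθ00] at h1
    have h4 : ∫ t, g t • (m t - m₀ - P t) = ∫ t in Ioo 0 τ, g t • (m t - m₀ - P t) := by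
      refine (setIntegral_eq_integral_of_forall_compl_eq_zero fun t ht => ?_).symm
      rw [image_eq_zero_of_notMem_tsupport fun h => ht (hs h), zero_smul]
    rw [h4]
    have e : ∀ t, g t • (m t - m₀ - P t) = g t * m t - g t * m₀ - g t * P t := fun t => by
      rw [smul_eq_mul]; ring
    simp only [e]
    have hg12 : IntegrableOn (fun t => g t * m t - g t * m₀) (Ioo 0 τ) :=
      hgm.sub (hgi.mul_const m₀)
    rw [integral_sub hg12 hgP, integral_sub hgm (hgi.mul_const m₀),
      integral_mul_const]
    linarith
  rw [ae_restrict_iff' measurableSet_Ioo]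
  filter_upwards [key] with t ht hmem
  linarith [ht hmem]

end SpaceTime

/-! ### Smooth space-time fields -/

section SmoothFields

variable {d n N : ℕ} {T τ : ℝ}

/-- The time derivative of a scalar field. -/
noncomputable def dt (f : ℝ × (Fin d → ℝ) → ℝ) (p : ℝ × (Fin d → ℝ)) : ℝ :=
  deriv (fun s => f (s, p.2)) p.1

theorem SmoothST.differentiable {f : ℝ × (Fin d → ℝ) → ℝ} (hf : SmoothST f) :
    Differentiable ℝ f := hf.1.differentiable (by simp)

theorem SmoothST.hasDerivAt_time {f : ℝ × (Fin d → ℝ) → ℝ} (hf : SmoothST f)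
    (p : ℝ × (Fin d → ℝ)) : HasDerivAt (fun s => f (s, p.2)) (fderiv ℝ f p (1, 0)) p.1 :=
  (hf.differentiable p).hasFDerivAt.comp_hasDerivAt p.1
    ((hasDerivAt_id p.1).prodMk (hasDerivAt_const p.1 p.2))

theorem SmoothST.dt_eq {f : ℝ × (Fin d → ℝ) → ℝ} (hf : SmoothST f) :
    dt f = fun p => fderiv ℝ f p (1, 0) := funext fun p => (hf.hasDerivAt_time p).deriv

theorem SmoothST.hasDerivAt {f : ℝ × (Fin d → ℝ) → ℝ} (hf : SmoothST f)
    (p : ℝ × (Fin d → ℝ)) : HasDerivAt (fun s => f (s, p.2)) (dt f p) p.1 := by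
  rw [hf.dt_eq]
  exact hf.hasDerivAt_time p

theorem SmoothST.fderiv_apply {f : ℝ × (Fin d → ℝ) → ℝ} (hf : SmoothST f)
    (z : ℝ × (Fin d → ℝ)) : SmoothST (fun p => fderiv ℝ f p z) := by
  refine ⟨(hf.1.fderiv_right (m := ∞) (by simp)).clm_apply contDiff_const, fun t k x => ?_⟩
  have h : (fun p : ℝ × (Fin d → ℝ) => f (p + (0, fun i => (k i : ℝ)))) = f := by
    funext ⟨s, y⟩
    simpa using hf.2 s k y
  have h2 : fderiv ℝ f ((t, x) + (0, fun i => (k i : ℝ))) = fderiv ℝ f (t, x) := by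
    rw [← fderiv_comp_add_right, h]
  simp only [Prod.mk_add_mk, add_zero] at h2
  simp only [h2]

theorem SmoothST.dt {f : ℝ × (Fin d → ℝ) → ℝ} (hf : SmoothST f) : SmoothST (dt f) := by
  rw [hf.dt_eq]
  exact hf.fderiv_apply _

theorem SmoothST.pd_slice {f : ℝ × (Fin d → ℝ) → ℝ} (hf : SmoothST f) (i : Fin d) :
    (fun p : ℝ × (Fin d → ℝ) => pd i (fun y => f (p.1, y)) p.2) =
      fun p => fderiv ℝ f p (0, Pi.single i 1) := by
  ext p
  have h : HasFDerivAt (fun y => f (p.1, y))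
      ((fderiv ℝ f p).comp (ContinuousLinearMap.inr ℝ ℝ (Fin d → ℝ))) p.2 :=
    (hf.differentiable p).hasFDerivAt.comp p.2 (hasFDerivAt_prodMk_right p.1 p.2)
  rw [pd, h.fderiv]
  simp

theorem SmoothST.dt_fderiv_apply {f : ℝ × (Fin d → ℝ) → ℝ} (hf : SmoothST f)
    (z : ℝ × (Fin d → ℝ)) :
    Dafermos.dt (fun p => fderiv ℝ f p z) = fun p => fderiv ℝ (Dafermos.dt f) p z := by
  ext p
  rw [(hf.fderiv_apply z).dt_eq, hf.dt_eq]
  have hd : DifferentiableAt ℝ (fderiv ℝ f) p :=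
    (hf.1.fderiv_right (m := ∞) (by simp)).differentiable (by simp) p
  have h1 : ∀ a b : ℝ × (Fin d → ℝ),
      fderiv ℝ (fun p => fderiv ℝ f p a) p b = fderiv ℝ (fderiv ℝ f) p b a := fun a b => by
    rw [fderiv_clm_apply hd (differentiableAt_const a)]
    simp
  beta_reduce
  rw [h1, h1]
  exact second_derivative_symmetric (fun y => (hf.differentiable y).hasFDerivAt) hd.hasFDerivAt _ _

theorem SmoothST.pdMulti_slice {f : ℝ × (Fin d → ℝ) → ℝ} (hf : SmoothST f) (α : Fin d → ℕ) :
    SmoothST (fun p : ℝ × (Fin d → ℝ) => pdMulti α (fun y => f (p.1, y)) p.2) ∧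
    Dafermos.dt (fun p : ℝ × (Fin d → ℝ) => pdMulti α (fun y => f (p.1, y)) p.2) =
      fun p => pdMulti α (fun y => Dafermos.dt f (p.1, y)) p.2 := by
  have step : ∀ (i : Fin d) (g : ℝ × (Fin d → ℝ) → ℝ), SmoothST g →
      SmoothST (fun p : ℝ × (Fin d → ℝ) => pd i (fun y => g (p.1, y)) p.2) ∧
      Dafermos.dt (fun p : ℝ × (Fin d → ℝ) => pd i (fun y => g (p.1, y)) p.2) =
        fun p => pd i (fun y => Dafermos.dt g (p.1, y)) p.2 := by
    intro i g hg
    rw [hg.pd_slice, hg.dt.pd_slice]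
    exact ⟨hg.fderiv_apply _, hg.dt_fderiv_apply _⟩
  have hiter : ∀ (i : Fin d) (k : ℕ) (g : ℝ × (Fin d → ℝ) → ℝ), SmoothST g →
      SmoothST (fun p : ℝ × (Fin d → ℝ) => (pd i)^[k] (fun y => g (p.1, y)) p.2) ∧
      Dafermos.dt (fun p : ℝ × (Fin d → ℝ) => (pd i)^[k] (fun y => g (p.1, y)) p.2) =
        fun p => (pd i)^[k] (fun y => Dafermos.dt g (p.1, y)) p.2 := by
    intro i k
    induction k with
    | zero => exact fun g hg => ⟨hg, rfl⟩
    | succ k ih =>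
      intro g hg
      simp only [Function.iterate_succ_apply]
      have h1 := step i g hg
      have h2 := ih _ h1.1
      rw [h1.2] at h2
      exact h2
  unfold pdMulti
  induction List.finRange d with
  | nil => exact ⟨hf, rfl⟩
  | cons i l ih =>
    simp only [List.foldr_cons]
    have h2 := hiter i (α i) _ ih.1
    rw [ih.2] at h2
    exact h2

theorem SmoothST.sum {ι : Type*} (s : Finset ι) {f : ι → ℝ × (Fin d → ℝ) → ℝ}
    (hf : ∀ i ∈ s, SmoothST (f i)) : SmoothST (fun p => ∑ i ∈ s, f i p) :=
  ⟨ContDiff.sum fun i hi => (hf i hi).1, fun t k x =>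
    Finset.sum_congr rfl fun i hi => (hf i hi).2 t k x⟩

theorem SmoothST.const_mul {f : ℝ × (Fin d → ℝ) → ℝ} (hf : SmoothST f) (c : ℝ) :
    SmoothST (fun p => c * f p) :=
  ⟨contDiff_const.mul hf.1, fun t k x => by simp only [hf.2 t k x]⟩

theorem SmoothST.time_mul {f : ℝ × (Fin d → ℝ) → ℝ} (hf : SmoothST f) {θ : ℝ → ℝ}
    (hθ : ContDiff ℝ ∞ θ) : SmoothST (fun p => θ p.1 * f p) :=
  ⟨(hθ.comp contDiff_fst).mul hf.1, fun t k x => by simp only [hf.2 t k x]⟩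

theorem dt_sum {ι : Type*} (s : Finset ι) {f : ι → ℝ × (Fin d → ℝ) → ℝ}
    (hf : ∀ i ∈ s, SmoothST (f i)) (p : ℝ × (Fin d → ℝ)) :
    dt (fun p => ∑ i ∈ s, f i p) p = ∑ i ∈ s, dt (f i) p :=
  (HasDerivAt.fun_sum fun i hi => (hf i hi).hasDerivAt p).deriv

theorem dt_const_mul {f : ℝ × (Fin d → ℝ) → ℝ} (c : ℝ) (hf : SmoothST f)
    (p : ℝ × (Fin d → ℝ)) : dt (fun p => c * f p) p = c * dt f p :=
  ((hf.hasDerivAt p).const_mul c).deriv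

theorem SmoothVecST.contDiff {φ : ℝ × (Fin d → ℝ) → EuclideanSpace ℝ (Fin n)}
    (hφ : SmoothVecST φ) : ContDiff ℝ ∞ φ := contDiff_euclidean.2 fun i => (hφ i).1

theorem SmoothVecST.continuous {φ : ℝ × (Fin d → ℝ) → EuclideanSpace ℝ (Fin n)}
    (hφ : SmoothVecST φ) : Continuous φ := hφ.contDiff.continuous

theorem SmoothVecST.hasDerivAt {φ : ℝ × (Fin d → ℝ) → EuclideanSpace ℝ (Fin n)}
    (hφ : SmoothVecST φ) (p : ℝ × (Fin d → ℝ)) :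
    HasDerivAt (fun s => φ (s, p.2)) (dtVec φ p) p.1 := by
  have h : DifferentiableAt ℝ (fun s => φ (s, p.2)) p.1 :=
    (hφ.contDiff.differentiable (by simp) (p.1, p.2)).comp p.1
      (differentiableAt_id.prodMk (differentiableAt_const _))
  exact h.hasDerivAt

theorem SmoothVecST.dtVec_apply {φ : ℝ × (Fin d → ℝ) → EuclideanSpace ℝ (Fin n)}
    (hφ : SmoothVecST φ) (p : ℝ × (Fin d → ℝ)) (i : Fin n) :
    dtVec φ p i = dt (fun p => φ p i) p := by
  have h := ((EuclideanSpace.proj (𝕜 := ℝ) i).hasFDerivAt (x := φ (p.1, p.2))).comp_hasDerivAt p.1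
    (hφ.hasDerivAt p)
  exact h.deriv.symm

theorem SmoothVecST.dtVec {φ : ℝ × (Fin d → ℝ) → EuclideanSpace ℝ (Fin n)}
    (hφ : SmoothVecST φ) : SmoothVecST (dtVec φ) := fun i => by
  simp only [hφ.dtVec_apply]
  exact (hφ i).dt

theorem SmoothVecST.time_smul {φ : ℝ × (Fin d → ℝ) → EuclideanSpace ℝ (Fin n)}
    (hφ : SmoothVecST φ) {θ : ℝ → ℝ} (hθ : ContDiff ℝ ∞ θ) :
    SmoothVecST (fun p => θ p.1 • φ p) := fun i => (hφ i).time_mul hθ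

theorem SmoothVecST.dtVec_time_smul {φ : ℝ × (Fin d → ℝ) → EuclideanSpace ℝ (Fin n)}
    (hφ : SmoothVecST φ) {θ : ℝ → ℝ} (hθ : ContDiff ℝ ∞ θ) (p : ℝ × (Fin d → ℝ)) :
    Dafermos.dtVec (fun p => θ p.1 • φ p) p =
      deriv θ p.1 • φ p + θ p.1 • Dafermos.dtVec φ p := by
  have h := ((hθ.differentiable (by simp) p.1).hasDerivAt).smul (hφ.hasDerivAt p)
  rw [Dafermos.dtVec, add_comm]
  exact h.deriv

theorem SmoothMatST.dtMat {Ψ : ℝ × (Fin d → ℝ) → Matrix (Fin N) (Fin N) ℝ}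
    (hΨ : SmoothMatST Ψ) : SmoothMatST (dtMat Ψ) := by
  refine ⟨fun p => ?_, fun l m => (hΨ.2 l m).dt⟩
  ext l m
  simp only [Matrix.transpose_apply, Dafermos.dtMat, Matrix.of_apply]
  congr 1
  ext s
  exact (hΨ.1 (s, p.2)).apply l m

theorem SmoothMatST.time_smul {Ψ : ℝ × (Fin d → ℝ) → Matrix (Fin N) (Fin N) ℝ}
    (hΨ : SmoothMatST Ψ) {θ : ℝ → ℝ} (hθ : ContDiff ℝ ∞ θ) :
    SmoothMatST (fun p => θ p.1 • Ψ p) :=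
  ⟨fun p => (hΨ.1 p).smul _, fun l m => (hΨ.2 l m).time_mul hθ⟩

theorem DiffOp.appST_time_smul (L : DiffOp d n N) (θ : ℝ → ℝ)
    (Ψ : ℝ × (Fin d → ℝ) → Matrix (Fin N) (Fin N) ℝ) (p : ℝ × (Fin d → ℝ)) :
    L.appST (fun p => θ p.1 • Ψ p) p = θ p.1 • L.appST Ψ p :=
  L.app_const_smul (θ p.1) (fun y => Ψ (p.1, y)) p.2

theorem DiffOp.smoothVecST_appST (L : DiffOp d n N)
    {Ψ : ℝ × (Fin d → ℝ) → Matrix (Fin N) (Fin N) ℝ} (hΨ : SmoothMatST Ψ) :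
    SmoothVecST (L.appST Ψ) := fun i => by
  simp only [DiffOp.appST, DiffOp.app]
  exact SmoothST.sum _ fun j _ => SmoothST.sum _ fun l _ => SmoothST.sum _ fun m _ =>
    SmoothST.sum _ fun α _ => ((hΨ.2 l m).pdMulti_slice α).1.const_mul _

theorem DiffOp.dtVec_appST (L : DiffOp d n N)
    {Ψ : ℝ × (Fin d → ℝ) → Matrix (Fin N) (Fin N) ℝ} (hΨ : SmoothMatST Ψ)
    (p : ℝ × (Fin d → ℝ)) : dtVec (L.appST Ψ) p = L.appST (dtMat Ψ) p := by
  ext i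
  rw [(L.smoothVecST_appST hΨ).dtVec_apply]
  simp only [DiffOp.appST, DiffOp.app]
  have h4 : ∀ l m (α : Fin d → ℕ), SmoothST fun p : ℝ × (Fin d → ℝ) =>
      L.coeff i l m α * pdMulti α (fun y => Ψ (p.1, y) l m) p.2 := fun l m α =>
    ((hΨ.2 l m).pdMulti_slice α).1.const_mul _
  have h3 : ∀ l m j, SmoothST fun p : ℝ × (Fin d → ℝ) =>
      ∑ α ∈ Finset.piAntidiag Finset.univ j,
        L.coeff i l m α * pdMulti α (fun y => Ψ (p.1, y) l m) p.2 := fun l m j =>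
    SmoothST.sum _ fun α _ => h4 l m α
  have h2 := fun l j => SmoothST.sum Finset.univ fun m _ => h3 l m j
  have h1 := fun j => SmoothST.sum Finset.univ fun l _ => h2 l j
  rw [dt_sum _ fun j _ => h1 j]
  refine Finset.sum_congr rfl fun j _ => ?_
  rw [dt_sum _ fun l _ => h2 l j]
  refine Finset.sum_congr rfl fun l _ => ?_
  rw [dt_sum _ fun m _ => h3 l m j]
  refine Finset.sum_congr rfl fun m _ => ?_
  rw [dt_sum _ fun α _ => h4 l m α]
  refine Finset.sum_congr rfl fun α _ => ?_
  rw [dt_const_mul _ ((hΨ.2 l m).pdMulti_slice α).1, ((hΨ.2 l m).pdMulti_slice α).2]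
  rfl

theorem exists_bound_of_periodic {f : ℝ × (Fin d → ℝ) → ℝ} (hf : Continuous f)
    (hp : ∀ t, IsPeriodic fun x => f (t, x)) (τ : ℝ) :
    ∃ C, 0 ≤ C ∧ ∀ t ∈ Icc 0 τ, ∀ x, |f (t, x)| ≤ C := by
  obtain ⟨C, hC⟩ := ((isCompact_Icc (a := (0 : ℝ)) (b := τ)).prod
    (isCompact_Icc (a := (0 : Fin d → ℝ)) (b := 1))).exists_bound_of_continuousOn hf.continuousOn
  refine ⟨|C|, abs_nonneg _, fun t ht x => ?_⟩
  obtain ⟨y, hy, e⟩ := (hp t).exists_mem_cell x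
  rw [e]
  exact (hC (t, y) ⟨ht, cell_subset_Icc d hy⟩).trans (le_abs_self C)

theorem SmoothST.exists_bound {f : ℝ × (Fin d → ℝ) → ℝ} (hf : SmoothST f) (τ : ℝ) :
    ∃ C, 0 ≤ C ∧ ∀ t ∈ Icc 0 τ, ∀ x, |f (t, x)| ≤ C :=
  exists_bound_of_periodic hf.1.continuous hf.2 τ

theorem SmoothVecST.exists_bound {φ : ℝ × (Fin d → ℝ) → EuclideanSpace ℝ (Fin n)}
    (hφ : SmoothVecST φ) (τ : ℝ) : ∃ C, 0 ≤ C ∧ ∀ t ∈ Icc 0 τ, ∀ x, ‖φ (t, x)‖ ≤ C := by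
  obtain ⟨C, h0, hC⟩ := exists_bound_of_periodic (f := fun p => ‖φ p‖) hφ.continuous.norm
    (fun t k x => by
      have : φ (t, x + fun i => (k i : ℝ)) = φ (t, x) := by
        ext i
        exact (hφ i).2 t k x
      simp only [this]) τ
  exact ⟨C, h0, fun t ht x => (le_abs_self _).trans (hC t ht x)⟩

theorem integrable_inner_of_bound {X : Type*} [MeasurableSpace X] {μ : Measure X}
    {w φ : X → EuclideanSpace ℝ (Fin n)} (hw : Integrable w μ) (hφ : AEStronglyMeasurable φ μ)
    {C : ℝ} (hC : ∀ᵐ p ∂μ, ‖φ p‖ ≤ C) : Integrable (fun p => inner ℝ (w p) (φ p)) μ := by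
  refine (hw.norm.mul_const C).mono' (hw.aestronglyMeasurable.inner hφ) ?_
  filter_upwards [hC] with p hp
  exact (norm_inner_le_norm _ _).trans (mul_le_mul_of_nonneg_left hp (norm_nonneg _))

theorem ae_mem_cylinder (d : ℕ) (τ : ℝ) :
    ∀ᵐ p ∂(volume.restrict (cylinder d τ)), p ∈ cylinder d τ :=
  ae_restrict_mem (measurableSet_cylinder d τ)

theorem SmoothVecST.integrable_inner {w φ : ℝ × (Fin d → ℝ) → EuclideanSpace ℝ (Fin n)}
    (hφ : SmoothVecST φ) (hw : Integrable w (volume.restrict (cylinder d τ))) :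
    Integrable (fun p => inner ℝ (w p) (φ p)) (volume.restrict (cylinder d τ)) := by
  obtain ⟨C, -, hC⟩ := hφ.exists_bound τ
  refine integrable_inner_of_bound hw hφ.continuous.aestronglyMeasurable (C := C) ?_
  filter_upwards [ae_mem_cylinder d τ] with p hp
  exact hC p.1 (Ioo_subset_Icc_self hp.1) p.2

theorem SmoothMatST.integrable_frob {G Ψ : ℝ × (Fin d → ℝ) → Matrix (Fin N) (Fin N) ℝ}
    (hΨ : SmoothMatST Ψ)
    (hG : ∀ l m, Integrable (fun p => G p l m) (volume.restrict (cylinder d τ))) :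
    Integrable (fun p => frob (G p) (Ψ p)) (volume.restrict (cylinder d τ)) := by
  unfold frob
  refine integrable_finsetSum _ fun l _ => integrable_finsetSum _ fun m _ => ?_
  obtain ⟨C, -, hC⟩ := (hΨ.2 l m).exists_bound τ
  refine (hG l m).mul_bdd (c := C) (hΨ.2 l m).1.continuous.aestronglyMeasurable ?_
  filter_upwards [ae_mem_cylinder d τ] with p hp
  exact hC p.1 (Ioo_subset_Icc_self hp.1) p.2

end SmoothFields

/-! ### Weak derivatives tested up to the initial time -/

section Cutoff

variable {d n N : ℕ} {T τ : ℝ}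

/-- A cutoff function in time that vanishes for `t ≤ δ` and equals one for `t ≥ 2δ`. -/
noncomputable def cutoff (δ t : ℝ) : ℝ := Real.smoothTransition (t / δ - 1)

theorem contDiff_cutoff (δ : ℝ) : ContDiff ℝ ∞ (cutoff δ) :=
  Real.smoothTransition.contDiff.comp ((contDiff_id.div_const δ).sub contDiff_const)

theorem cutoff_nonneg (δ t : ℝ) : 0 ≤ cutoff δ t := Real.smoothTransition.nonneg _

theorem cutoff_le_one (δ t : ℝ) : cutoff δ t ≤ 1 := Real.smoothTransition.le_one _

theorem cutoff_eq_zero {δ t : ℝ} (hδ : 0 < δ) (h : t ≤ δ) : cutoff δ t = 0 :=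
  Real.smoothTransition.zero_of_nonpos (by rw [sub_nonpos, div_le_one hδ]; exact h)

theorem cutoff_eq_one {δ t : ℝ} (hδ : 0 < δ) (h : 2 * δ ≤ t) : cutoff δ t = 1 :=
  Real.smoothTransition.one_of_one_le (by rw [le_sub_iff_add_le, le_div_iff₀ hδ]; linarith)

theorem deriv_cutoff_nonneg {δ : ℝ} (hδ : 0 < δ) (t : ℝ) : 0 ≤ deriv (cutoff δ) t := by
  have : Monotone (cutoff δ) := fun a b hab =>
    Real.smoothTransition.monotone (sub_le_sub_right (div_le_div_of_nonneg_right hab hδ.le) 1)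
  exact this.deriv_nonneg

theorem deriv_cutoff_eq_zero {δ t : ℝ} (hδ : 0 < δ) (h : 2 * δ < t) :
    deriv (cutoff δ) t = 0 := by
  have : cutoff δ =ᶠ[𝓝 t] fun _ => 1 := by
    filter_upwards [lt_mem_nhds h] with s hs
    exact cutoff_eq_one hδ hs.le
  rw [this.deriv_eq, deriv_const]

theorem continuous_deriv_cutoff (δ : ℝ) : Continuous (deriv (cutoff δ)) :=
  (contDiff_cutoff δ).continuous_deriv (by simp)

theorem integral_deriv_cutoff {δ : ℝ} (hδ : 0 < δ) (h : 2 * δ ≤ τ) :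
    ∫ t in Ioo 0 τ, deriv (cutoff δ) t = 1 := by
  rw [← integral_Ioc_eq_integral_Ioo, ← intervalIntegral.integral_of_le (by linarith),
    intervalIntegral.integral_deriv_eq_sub (fun t _ =>
      (contDiff_cutoff δ).differentiable (by simp) t)
      ((continuous_deriv_cutoff δ).intervalIntegrable _ _), cutoff_eq_one hδ h,
    cutoff_eq_zero hδ hδ.le, sub_zero]

theorem tendsto_integral_cutoff_mul {f : ℝ × (Fin d → ℝ) → ℝ}
    (hf : Integrable f (volume.restrict (cylinder d τ))) :
    Tendsto (fun δ => ∫ p in cylinder d τ, cutoff δ p.1 * f p) (𝓝[>] 0)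
      (𝓝 (∫ p in cylinder d τ, f p)) := by
  refine tendsto_integral_filter_of_dominated_convergence (fun p => ‖f p‖)
    (Eventually.of_forall fun δ => ((contDiff_cutoff δ).continuous.comp
      continuous_fst).aestronglyMeasurable.mul hf.aestronglyMeasurable)
    (Eventually.of_forall fun δ => Eventually.of_forall fun p => ?_) hf.norm ?_
  · rw [norm_mul, Real.norm_of_nonneg (cutoff_nonneg _ _)]
    exact mul_le_of_le_one_left (norm_nonneg _) (cutoff_le_one _ _)
  · filter_upwards [ae_mem_cylinder d τ] with p hp
    refine tendsto_const_nhds.congr' ?_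
    have : Ioo 0 (p.1 / 2) ∈ 𝓝[>] (0 : ℝ) := Ioo_mem_nhdsGT (by linarith [hp.1.1])
    filter_upwards [this] with δ hδ
    rw [cutoff_eq_one hδ.1 (by linarith [hδ.2]), one_mul]

/-- On `(0,τ)` the derivative of the cutoff is nonnegative, has mass one and vanishes beyond `2δ`,
so it acts as a Dirac mass at `0⁺`. A limit along `𝓝[>] 0 ⊓ ae volume` is enough, since null sets of
times are invisible to the integral. -/
theorem tendsto_integral_deriv_cutoff_mul (hτ : 0 < τ) {ψ : ℝ → ℝ} {c : ℝ}
    (hψ : IntegrableOn ψ (Ioo 0 τ)) (h : Tendsto ψ (𝓝[>] 0 ⊓ ae volume) (𝓝 c)) :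
    Tendsto (fun δ => ∫ t in Ioo 0 τ, deriv (cutoff δ) t * ψ t) (𝓝[>] 0) (𝓝 c) := by
  rw [Metric.tendsto_nhds]
  intro ε hε
  have h1 := Metric.tendsto_nhds.1 h (ε / 2) (by positivity)
  rw [Filter.eventually_inf] at h1
  obtain ⟨s, hs, u, hu, hsu⟩ := h1
  obtain ⟨r, hr, hrs⟩ := mem_nhdsGT_iff_exists_Ioo_subset.1 hs
  have hr0 : 0 < r := hr
  have : Ioo 0 (min τ r / 2) ∈ 𝓝[>] (0 : ℝ) := Ioo_mem_nhdsGT (by positivity)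
  filter_upwards [this] with δ hδ
  have hδτ : 2 * δ ≤ τ := by linarith [hδ.2, min_le_left τ r]
  have hδr : 2 * δ < r := by linarith [hδ.2, min_le_right τ r]
  obtain ⟨C, hC⟩ := isCompact_Icc.exists_bound_of_continuousOn
    ((continuous_deriv_cutoff δ).continuousOn (s := Icc 0 τ))
  have hbd : ∀ᵐ t ∂(volume.restrict (Ioo 0 τ)), ‖deriv (cutoff δ) t‖ ≤ C := by
    filter_upwards [ae_restrict_mem measurableSet_Ioo] with t ht
    exact hC t (Ioo_subset_Icc_self ht)
  have hi0 : IntegrableOn (deriv (cutoff δ)) (Ioo 0 τ) :=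
    ((continuous_deriv_cutoff δ).integrableOn_Icc (a := 0) (b := τ)).mono_set Ioo_subset_Icc_self
  have hi1 : IntegrableOn (fun t => deriv (cutoff δ) t * ψ t) (Ioo 0 τ) :=
    hψ.bdd_mul (c := C) (continuous_deriv_cutoff δ).aestronglyMeasurable hbd
  have e : (∫ t in Ioo 0 τ, deriv (cutoff δ) t * ψ t) - c =
      ∫ t in Ioo 0 τ, deriv (cutoff δ) t * (ψ t - c) := by
    simp only [mul_sub]
    rw [integral_sub hi1 (hi0.mul_const c), integral_mul_const,
      integral_deriv_cutoff hδ.1 hδτ, one_mul]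
  rw [Real.dist_eq, e]
  have hle : ‖∫ t in Ioo 0 τ, deriv (cutoff δ) t * (ψ t - c)‖ ≤
      ∫ t in Ioo 0 τ, deriv (cutoff δ) t * (ε / 2) := by
    refine norm_integral_le_of_norm_le (hi0.mul_const _) ?_
    filter_upwards [ae_restrict_mem measurableSet_Ioo, ae_restrict_of_ae hu] with t ht htu
    rw [norm_mul, Real.norm_of_nonneg (deriv_cutoff_nonneg hδ.1 t)]
    by_cases htr : t < r
    · have := hsu t ⟨hrs ⟨ht.1, htr⟩, htu⟩
      rw [Real.dist_eq] at this
      exact mul_le_mul_of_nonneg_left this.le (deriv_cutoff_nonneg hδ.1 t)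
    · rw [deriv_cutoff_eq_zero hδ.1 (by linarith), zero_mul, zero_mul]
  rw [integral_mul_const, integral_deriv_cutoff hδ.1 hδτ, one_mul] at hle
  rw [← Real.norm_eq_abs]
  linarith

theorem ae_integrable_slice {E : Type*} [NormedAddCommGroup E] {f : ℝ × (Fin d → ℝ) → E}
    (hf : Integrable f (volume.restrict (cylinder d τ))) :
    ∀ᵐ t ∂(volume.restrict (Ioo 0 τ)),
      Integrable (fun x => f (t, x)) (volume.restrict (cell d)) := by
  rw [volume_restrict_cylinder] at hf
  exact hf.prod_right_ae

/-- The `L¹` trace handles `w(t) - w₀` against the bounded `φ`, and continuity of `φ` in time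
handles the rest. -/
theorem tendsto_integral_slice_inner (hτ : 0 < τ)
    {w : ℝ × (Fin d → ℝ) → EuclideanSpace ℝ (Fin n)}
    {w₀ : (Fin d → ℝ) → EuclideanSpace ℝ (Fin n)}
    (hw : Integrable w (volume.restrict (cylinder d τ)))
    (hw₀ : Integrable w₀ (volume.restrict (cell d)))
    (htr : Tendsto (fun t => ∫⁻ x in cell d, ‖w (t, x) - w₀ x‖ₑ) (𝓝[>] 0 ⊓ ae volume) (𝓝 0))
    {φ : ℝ × (Fin d → ℝ) → EuclideanSpace ℝ (Fin n)} (hφ : SmoothVecST φ) :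
    Tendsto (fun t => ∫ x in cell d, inner ℝ (w (t, x)) (φ (t, x))) (𝓝[>] 0 ⊓ ae volume)
      (𝓝 (∫ x in cell d, inner ℝ (w₀ x) (φ (0, x)))) := by
  obtain ⟨C, hC0, hC⟩ := hφ.exists_bound τ
  have hφs : ∀ t, Continuous fun x => φ (t, x) := fun t =>
    hφ.continuous.comp (Continuous.prodMk_right t)
  have hmem : ∀ᶠ t in 𝓝[>] (0 : ℝ), t ∈ Ioo 0 τ := Ioo_mem_nhdsGT hτ
  have h1 : Tendsto (fun t => ∫ x in cell d, inner ℝ (w₀ x) (φ (t, x))) (𝓝[>] 0)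
      (𝓝 (∫ x in cell d, inner ℝ (w₀ x) (φ (0, x)))) := by
    refine tendsto_integral_filter_of_dominated_convergence (fun x => ‖w₀ x‖ * C)
      (Eventually.of_forall fun t => hw₀.aestronglyMeasurable.inner (hφs t).aestronglyMeasurable)
      ?_ (hw₀.norm.mul_const C) (Eventually.of_forall fun x => ?_)
    · filter_upwards [hmem] with t ht
      refine Eventually.of_forall fun x => (norm_inner_le_norm _ _).trans ?_
      exact mul_le_mul_of_nonneg_left (hC t (Ioo_subset_Icc_self ht) x) (norm_nonneg _)
    · have : Continuous fun t => (inner ℝ (w₀ x) (φ (t, x)) : ℝ) :=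
        continuous_const.inner (hφ.continuous.comp (Continuous.prodMk_left x))
      exact (this.tendsto 0).mono_left nhdsWithin_le_nhds
  have h2 : Tendsto (fun t => ∫ x in cell d, inner ℝ (w (t, x) - w₀ x) (φ (t, x)))
      (𝓝[>] 0 ⊓ ae volume) (𝓝 0) := by
    rw [tendsto_zero_iff_enorm_tendsto_zero]
    have h3 : Tendsto (fun t => ENNReal.ofReal C * ∫⁻ x in cell d, ‖w (t, x) - w₀ x‖ₑ)
        (𝓝[>] 0 ⊓ ae volume) (𝓝 0) := by
      simpa using ENNReal.Tendsto.const_mul htr (Or.inr ENNReal.ofReal_ne_top)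
    refine tendsto_of_tendsto_of_tendsto_of_le_of_le' tendsto_const_nhds h3
      (Eventually.of_forall fun _ => zero_le) ?_
    filter_upwards [hmem.filter_mono inf_le_left] with t ht
    refine (enorm_integral_le_lintegral_enorm _).trans ?_
    rw [← lintegral_const_mul' _ _ ENNReal.ofReal_ne_top]
    refine lintegral_mono fun x => ?_
    rw [← ofReal_norm, ← ofReal_norm, ← ENNReal.ofReal_mul hC0]
    refine ENNReal.ofReal_le_ofReal ((norm_inner_le_norm _ _).trans ?_)
    rw [mul_comm]
    exact mul_le_mul_of_nonneg_right (hC t (Ioo_subset_Icc_self ht) x) (norm_nonneg _)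
  have h4 := h2.add (h1.mono_left (inf_le_left : 𝓝[>] (0 : ℝ) ⊓ ae volume ≤ _))
  rw [zero_add] at h4
  refine h4.congr' ?_
  have hae := (ae_restrict_iff' measurableSet_Ioo).1 (ae_integrable_slice hw)
  filter_upwards [hmem.filter_mono inf_le_left, hae.filter_mono inf_le_right] with t ht hwt
  have hb : ∀ᵐ x ∂(volume.restrict (cell d)), ‖φ (t, x)‖ ≤ C :=
    Eventually.of_forall (hC t (Ioo_subset_Icc_self ht))
  have hsub : Integrable (fun x => w (t, x) - w₀ x) (volume.restrict (cell d)) := (hwt ht).sub hw₀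
  rw [← integral_add
    (integrable_inner_of_bound hsub (hφs t).aestronglyMeasurable hb)
    (integrable_inner_of_bound hw₀ (hφs t).aestronglyMeasurable hb)]
  simp only [← inner_add_left, sub_add_cancel]

theorem compactInTime_cutoff_smul {V : Type*} [AddCommGroup V] [Module ℝ V] {δ b : ℝ} (hδ : 0 < δ)
    (hb : b < T) {φ : ℝ × (Fin d → ℝ) → V} (hφ : ∀ t x, b ≤ t → φ (t, x) = 0) :
    CompactInTime T (fun p => cutoff δ p.1 • φ p) := by
  refine ⟨δ, b, hδ, hb, fun t x ht => ?_⟩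
  by_cases h : t ≤ δ
  · simp only [cutoff_eq_zero hδ h, zero_smul]
  · have : b ≤ t := by
      by_contra! hlt
      exact ht ⟨(not_le.1 h).le, hlt.le⟩
    simp only [hφ t x this, smul_zero]

theorem dtVec_eq_zero {φ : ℝ × (Fin d → ℝ) → EuclideanSpace ℝ (Fin n)} {b : ℝ}
    (hb : ∀ t x, b ≤ t → φ (t, x) = 0) {p : ℝ × (Fin d → ℝ)} (hp : b < p.1) :
    dtVec φ p = 0 := by
  have : (fun s => φ (s, p.2)) =ᶠ[𝓝 p.1] fun _ => 0 := by
    filter_upwards [lt_mem_nhds hp] with s hs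
    exact hb s p.2 hs.le
  rw [dtVec, this.deriv_eq, deriv_const]

/-- The weak derivative is defined by test fields vanishing near `t = 0`. Inserting `cutoff δ • φ`
and letting `δ → 0`, the term with the derivative of the cutoff produces the initial value. -/
theorem HasWeakTimeDeriv.integral_add_eq {w D : ℝ × (Fin d → ℝ) → EuclideanSpace ℝ (Fin n)}
    (h : HasWeakTimeDeriv T w D) (hτ : 0 < τ) (hτT : τ ≤ T)
    {w₀ : (Fin d → ℝ) → EuclideanSpace ℝ (Fin n)}
    (hw : Integrable w (volume.restrict (cylinder d τ)))
    (hD : Integrable D (volume.restrict (cylinder d τ)))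
    (hw₀ : Integrable w₀ (volume.restrict (cell d)))
    (htr : Tendsto (fun t => ∫⁻ x in cell d, ‖w (t, x) - w₀ x‖ₑ) (𝓝[>] 0 ⊓ ae volume) (𝓝 0))
    {φ : ℝ × (Fin d → ℝ) → EuclideanSpace ℝ (Fin n)} (hφ : SmoothVecST φ) {b : ℝ} (hb : b < τ)
    (hφb : ∀ t x, b ≤ t → φ (t, x) = 0) :
    ∫ p in cylinder d τ, (inner ℝ (w p) (dtVec φ p) + inner ℝ (D p) (φ p)) =
      -∫ x in cell d, inner ℝ (w₀ x) (φ (0, x)) := by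
  have i1 := hφ.dtVec.integrable_inner hw
  have i2 := hφ.integrable_inner hD
  have i3 := hφ.integrable_inner hw
  have hlim1 := tendsto_integral_cutoff_mul (i1.add i2)
  have i3' := i3
  rw [volume_restrict_cylinder] at i3'
  have hlim2 := (tendsto_integral_deriv_cutoff_mul hτ i3'.integral_prod_left
    (tendsto_integral_slice_inner hτ hw hw₀ htr hφ)).neg
  refine tendsto_nhds_unique (hlim1.congr' ?_) hlim2
  filter_upwards [self_mem_nhdsWithin] with δ hδ
  have hδ0 : 0 < δ := hδ
  have hc := contDiff_cutoff δ
  have h1 := h.2 _ (hφ.time_smul hc) (compactInTime_cutoff_smul hδ0 (hb.trans_le hτT) hφb)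
  have z1 : ∀ p : ℝ × (Fin d → ℝ), τ ≤ p.1 → φ p = 0 := fun p hp => hφb p.1 p.2 (hb.le.trans hp)
  have z2 : ∀ p : ℝ × (Fin d → ℝ), τ ≤ p.1 → dtVec φ p = 0 := fun p hp =>
    dtVec_eq_zero hφb (hb.trans_le hp)
  simp only [hφ.dtVec_time_smul hc] at h1
  rw [setIntegral_cylinder_eq hτT fun p hp => by simp [z1 p hp, z2 p hp],
    setIntegral_cylinder_eq hτT fun p hp => by simp [z1 p hp]] at h1
  simp only [inner_add_right, real_inner_smul_right] at h1
  obtain ⟨C, hC⟩ := isCompact_Icc.exists_bound_of_continuousOn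
    ((continuous_deriv_cutoff δ).continuousOn (s := Icc 0 τ))
  have j3 : Integrable (fun p : ℝ × (Fin d → ℝ) => deriv (cutoff δ) p.1 * inner ℝ (w p) (φ p))
      (volume.restrict (cylinder d τ)) := by
    refine i3.bdd_mul (c := C)
      ((continuous_deriv_cutoff δ).comp continuous_fst).aestronglyMeasurable ?_
    filter_upwards [ae_mem_cylinder d τ] with p hp
    exact hC _ (Ioo_subset_Icc_self hp.1)
  have hcb : ∀ p : ℝ × (Fin d → ℝ), ‖cutoff δ p.1‖ ≤ 1 := fun p => by
    rw [Real.norm_of_nonneg (cutoff_nonneg _ _)]; exact cutoff_le_one _ _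
  have hcm : AEStronglyMeasurable (fun p : ℝ × (Fin d → ℝ) => cutoff δ p.1)
    (volume.restrict (cylinder d τ)) := (hc.continuous.comp continuous_fst).aestronglyMeasurable
  have j1 : Integrable (fun p : ℝ × (Fin d → ℝ) => cutoff δ p.1 * inner ℝ (w p) (dtVec φ p))
    (volume.restrict (cylinder d τ)) := i1.bdd_mul (c := 1) hcm (Eventually.of_forall hcb)
  have j2 : Integrable (fun p : ℝ × (Fin d → ℝ) => cutoff δ p.1 * inner ℝ (D p) (φ p))
    (volume.restrict (cylinder d τ)) := i2.bdd_mul (c := 1) hcm (Eventually.of_forall hcb)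
  rw [integral_add j3 j1] at h1
  have e3 := integral_cylinder j3
  simp only [integral_const_mul] at e3
  simp only [Pi.add_apply, mul_add]
  rw [integral_add j1 j2, ← e3]
  linarith

/-- The same cutoff argument; `L` involves no time derivative, so no initial term appears. -/
theorem HasWeakAdj.integral_eq {L : DiffOp d n N}
    {w : ℝ × (Fin d → ℝ) → EuclideanSpace ℝ (Fin n)}
    {G : ℝ × (Fin d → ℝ) → Matrix (Fin N) (Fin N) ℝ}
    (h : HasWeakAdj L T w G) (hτT : τ ≤ T)
    (hw : Integrable w (volume.restrict (cylinder d τ)))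
    (hG : ∀ l m, Integrable (fun p => G p l m) (volume.restrict (cylinder d τ)))
    {Ψ : ℝ × (Fin d → ℝ) → Matrix (Fin N) (Fin N) ℝ} (hΨ : SmoothMatST Ψ) {b : ℝ} (hb : b < τ)
    (hΨb : ∀ t x, b ≤ t → Ψ (t, x) = 0) :
    ∫ p in cylinder d τ, inner ℝ (w p) (L.appST Ψ p) = ∫ p in cylinder d τ, frob (G p) (Ψ p) := by
  have hlim1 := tendsto_integral_cutoff_mul ((L.smoothVecST_appST hΨ).integrable_inner hw)
  have hlim2 := tendsto_integral_cutoff_mul (hΨ.integrable_frob hG)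
  refine tendsto_nhds_unique (hlim1.congr' ?_) hlim2
  filter_upwards [self_mem_nhdsWithin] with δ hδ
  have hδ0 : 0 < δ := hδ
  have h1 := h.2.2 _ (hΨ.time_smul (contDiff_cutoff δ))
    (compactInTime_cutoff_smul hδ0 (hb.trans_le hτT) hΨb)
  have z1 : ∀ p : ℝ × (Fin d → ℝ), τ ≤ p.1 → Ψ p = 0 := fun p hp => hΨb p.1 p.2 (hb.le.trans hp)
  have z2 : ∀ p : ℝ × (Fin d → ℝ), τ ≤ p.1 → L.appST Ψ p = 0 := fun p hp => by
    have e : (fun y => Ψ (p.1, y)) = fun y => (0 : ℝ) • Ψ (p.1, y) := by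
      ext1 y
      rw [z1 (p.1, y) hp, smul_zero]
    rw [DiffOp.appST, e, L.app_const_smul, zero_smul]
  simp only [L.appST_time_smul, real_inner_smul_right, frob_smul_right] at h1
  rwa [setIntegral_cylinder_eq hτT fun p hp => by simp [z2 p hp],
    setIntegral_cylinder_eq hτT fun p hp => by simp [z1 p hp, frob_zero_right]] at h1

end Cutoff

/-! ### Time slices of weak derivatives -/

section Slices

variable {d n N : ℕ} {T τ : ℝ}

/-- The converse of slicing needs a measurable exceptional set; it is obtained from a strongly
measurable representative and the closedness of `S`. -/
theorem ae_prod_mem_of_ae_ae_mem {X Y Z : Type*} [MeasurableSpace X] [MeasurableSpace Y]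
    [TopologicalSpace Z] [TopologicalSpace.PseudoMetrizableSpace Z] [MeasurableSpace Z]
    [BorelSpace Z] {μ : Measure X} {ν : Measure Y} [SFinite μ] [SFinite ν] {f : X × Y → Z}
    (hf : AEStronglyMeasurable f (μ.prod ν)) {S : Set Z} (hS : IsClosed S)
    (h : ∀ᵐ x ∂μ, ∀ᵐ y ∂ν, f (x, y) ∈ S) : ∀ᵐ p ∂(μ.prod ν), f p ∈ S := by
  obtain ⟨g, hg, hfg⟩ := hf
  have h1 : ∀ᵐ p ∂(μ.prod ν), g p ∈ S := by
    refine (Measure.ae_prod_iff_ae_ae (p := fun p => g p ∈ S)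
      (hg.measurable hS.measurableSet)).2 ?_
    filter_upwards [h, Measure.ae_ae_of_ae_prod hfg] with x hx hx'
    filter_upwards [hx, hx'] with y hy hy'
    rwa [← hy']
  filter_upwards [h1, hfg] with p hp hp'
  rwa [hp']

/-- Continuity in `x` lets the exceptional null set of times be chosen independently of `x`:
countably many points suffice. -/
theorem ae_of_forall_denseSeq {f : ℝ → ℕ → (Fin d → ℝ) → ℝ}
    (hc : ∀ᵐ t ∂(volume.restrict (Ioo 0 τ)), ∀ k, Continuous (f t k))
    (h : ∀ k x, ∀ᵐ t ∂(volume.restrict (Ioo 0 τ)), f t k x = 0) :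
    ∀ᵐ t ∂(volume.restrict (Ioo 0 τ)), ∀ k x, f t k x = 0 := by
  have h1 : ∀ᵐ t ∂(volume.restrict (Ioo 0 τ)), ∀ k m,
      f t k (TopologicalSpace.denseSeq (Fin d → ℝ) m) = 0 :=
    ae_all_iff.2 fun k => ae_all_iff.2 fun m => h k _
  filter_upwards [hc, h1] with t htc ht k
  have := (TopologicalSpace.denseRange_denseSeq (Fin d → ℝ)).equalizer (htc k)
    (continuous_const (y := (0 : ℝ))) (funext fun m => ht k m)
  exact fun x => congrFun this x

theorem eq_zero_of_mollify_eq_zero {g : (Fin d → ℝ) → ℝ}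
    (hg : Integrable g (volume.restrict (cell d)))
    (h : ∀ k x, mollify (torusKer d k) g x = 0) : ∀ᵐ x ∂(volume.restrict (cell d)), g x = 0 := by
  obtain ⟨φ, -, hφ⟩ := exists_seq_tendsto_mollify (fun _ : Unit => hg)
  filter_upwards [hφ] with x hx
  have := hx ()
  simp only [h] at this
  exact (tendsto_nhds_unique this tendsto_const_nhds)

theorem smoothMatST_kernel {ρ : (Fin d → ℝ) → ℝ} (hρ : SmoothPer ρ) (x : Fin d → ℝ)
    (a b : Fin N) : SmoothMatST fun p : ℝ × (Fin d → ℝ) => ρ (x - p.2) • symBasis a b := by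
  refine ⟨fun p => (isSymm_symBasis a b).smul _, fun l m => ⟨?_, fun t k y => ?_⟩⟩
  · exact (hρ.1.comp (contDiff_const.sub contDiff_snd)).mul contDiff_const
  · simp only [Matrix.smul_apply]
    congr 1
    have := hρ.2 (-k) (x - y)
    rw [← this]
    congr 1
    ext i
    simp only [Pi.add_apply, Pi.sub_apply, Pi.neg_apply, Int.cast_neg]
    ring

/-- Testing with `θ(t) ρ(x - y)` times a symmetric basis matrix and varying `θ` localises the weak
identity in time. In mollified form `G = L^* w` then holds classically on almost every slice. -/
theorem HasWeakAdj.ae_slice {L : DiffOp d n N} {w : ℝ × (Fin d → ℝ) → EuclideanSpace ℝ (Fin n)}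
    {G : ℝ × (Fin d → ℝ) → Matrix (Fin N) (Fin N) ℝ} (h : HasWeakAdj L T w G)
    (hτ : 0 < τ) (hτT : τ ≤ T) (hw : Integrable w (volume.restrict (cylinder d τ)))
    (hG : ∀ l m, Integrable (fun p => G p l m) (volume.restrict (cylinder d τ))) :
    ∀ᵐ t ∂(volume.restrict (Ioo 0 τ)), ∀ k x,
      mollifyMat (torusKer d k) (fun y => G (t, y)) x =
        L.adj (mollifyVec (torusKer d k) (fun y => w (t, y))) x := by
  have hsymm : ∀ᵐ t ∂(volume.restrict (Ioo 0 τ)), ∀ᵐ y ∂(volume.restrict (cell d)),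
      (G (t, y)).IsSymm := by
    have h1 := ae_restrict_of_ae_restrict_of_subset (cylinder_mono d hτT) h.2.1
    rw [volume_restrict_cylinder] at h1
    exact Measure.ae_ae_of_ae_prod h1
  have hws := ae_integrable_slice hw
  have hGs : ∀ᵐ t ∂(volume.restrict (Ioo 0 τ)), ∀ l m,
      Integrable (fun x => G (t, x) l m) (volume.restrict (cell d)) :=
    ae_all_iff.2 fun l => ae_all_iff.2 fun m => ae_integrable_slice (hG l m)
  have key : ∀ a b, ∀ᵐ t ∂(volume.restrict (Ioo 0 τ)), ∀ k x,
      mollifyMat (torusKer d k) (fun y => G (t, y)) x a b -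
        L.adj (mollifyVec (torusKer d k) (fun y => w (t, y))) x a b = 0 := by
    intro a b
    refine ae_of_forall_denseSeq (f := fun t k x =>
      mollifyMat (torusKer d k) (fun y => G (t, y)) x a b -
        L.adj (mollifyVec (torusKer d k) (fun y => w (t, y))) x a b) ?_ fun k x => ?_
    · filter_upwards [hws, hGs] with t hwt hGt k
      exact (continuous_mollify (smoothPer_torusKer d k) (hGt a b)).sub
        (L.continuous_adj_mollifyVec (smoothPer_torusKer d k) hwt a b)
    · have hρ := smoothPer_torusKer d k
      have hΞ := smoothMatST_kernel hρ x a b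
      have i1 := (L.smoothVecST_appST hΞ).integrable_inner hw
      have i2 := hΞ.integrable_frob hG
      have h0 := ae_integral_slice_eq_zero (i1.sub i2) fun θ hθ hc hs => by
        obtain ⟨c, e, -, he, hce⟩ := exists_Icc_of_tsupport_subset hτ hc hs
        obtain ⟨C, hC⟩ := hc.exists_bound_of_continuous hθ.continuous
        -- `θ` is known to vanish only strictly after `e`, so the vanishing time is taken halfway
        -- between `e` and `τ`.
        have h1 := h.integral_eq hτT hw hG (hΞ.time_smul hθ) (b := (e + τ) / 2) (by linarith)
          fun t y ht => by
            simp only [hce t fun hmem => by linarith [hmem.2], zero_smul]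
        simp only [L.appST_time_smul, real_inner_smul_right, frob_smul_right (θ _)] at h1
        have hθm : AEStronglyMeasurable (fun p : ℝ × (Fin d → ℝ) => θ p.1)
          (volume.restrict (cylinder d τ)) :=
          (hθ.continuous.comp continuous_fst).aestronglyMeasurable
        simp only [Pi.sub_apply, mul_sub]
        rw [integral_sub (i1.bdd_mul (c := C) hθm (Eventually.of_forall fun p => hC _))
          (i2.bdd_mul (c := C) hθm (Eventually.of_forall fun p => hC _)), h1, sub_self]
      filter_upwards [h0, ae_integrable_slice i1, ae_integrable_slice i2, hws, hGs, hsymm] with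
        t ht hi1 hi2 hwt hGt hst
      simp only [Pi.sub_apply] at ht
      rw [integral_sub hi1 hi2] at ht
      have e1 : ∫ y in cell d, inner ℝ (w (t, y))
          (L.appST (fun p => torusKer d k (x - p.2) • symBasis a b) (t, y)) =
          2 * L.adj (mollifyVec (torusKer d k) (fun y => w (t, y))) x a b :=
        L.integral_inner_app_kernel hρ hwt x a b
      have e2 : ∫ y in cell d, frob (G (t, y)) (torusKer d k (x - y) • symBasis a b) =
          2 * mollifyMat (torusKer d k) (fun y => G (t, y)) x a b := by
        simp only [mollifyMat, Matrix.of_apply, mollify]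
        rw [← integral_const_mul]
        refine integral_congr_ae ?_
        filter_upwards [hst] with y hy
        simp only [frob_smul_symBasis]
        rw [hy.apply a b]
        ring
      rw [e1, e2] at ht
      linarith
  have key' : ∀ᵐ t ∂(volume.restrict (Ioo 0 τ)), ∀ a b k x,
      mollifyMat (torusKer d k) (fun y => G (t, y)) x a b -
        L.adj (mollifyVec (torusKer d k) (fun y => w (t, y))) x a b = 0 :=
    ae_all_iff.2 fun a => ae_all_iff.2 fun b => key a b
  filter_upwards [key'] with t ht k x
  ext a b
  exact sub_eq_zero.1 (ht a b k x)

/-- Mollified slices of `G` are values of `L^*` on smooth fields, hence in `Λ`. The space `Λ` is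
finite dimensional, therefore closed, and the mollifications converge almost everywhere along a
subsequence. -/
theorem HasWeakAdj.ae_mem_Lam {L : DiffOp d n N}
    {w : ℝ × (Fin d → ℝ) → EuclideanSpace ℝ (Fin n)}
    {G : ℝ × (Fin d → ℝ) → Matrix (Fin N) (Fin N) ℝ} (h : HasWeakAdj L T w G)
    (hτ : 0 < τ) (hτT : τ ≤ T) (hw : Integrable w (volume.restrict (cylinder d τ)))
    (hG : ∀ l m, Integrable (fun p => G p l m) (volume.restrict (cylinder d τ))) :
    ∀ᵐ p ∂(volume.restrict (cylinder d τ)), G p ∈ L.Lam := by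
  have hclosed : IsClosed (L.Lam : Set (Matrix (Fin N) (Fin N) ℝ)) :=
    Submodule.closed_of_finiteDimensional _
  let S : Set (Fin N → Fin N → ℝ) := (L.Lam : Set (Matrix (Fin N) (Fin N) ℝ))
  have hS : IsClosed S := hclosed
  let G' : ℝ × (Fin d → ℝ) → Fin N → Fin N → ℝ := fun p => G p
  have hGm : AEStronglyMeasurable G'
      (volume.restrict (cylinder d τ)) :=
    (aemeasurable_pi_lambda _ fun l => aemeasurable_pi_lambda _ fun m =>
      (hG l m).aestronglyMeasurable.aemeasurable).aestronglyMeasurable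
  rw [volume_restrict_cylinder] at hGm ⊢
  refine ae_prod_mem_of_ae_ae_mem (f := G') hGm hS ?_
  have hGs : ∀ᵐ t ∂(volume.restrict (Ioo 0 τ)), ∀ l m,
      Integrable (fun x => G (t, x) l m) (volume.restrict (cell d)) :=
    ae_all_iff.2 fun l => ae_all_iff.2 fun m => ae_integrable_slice (hG l m)
  filter_upwards [h.ae_slice hτ hτT hw hG, ae_integrable_slice hw, hGs] with t ht hwt hGt
  obtain ⟨φ, -, hφ⟩ := exists_seq_tendsto_mollify
    (g := fun (j : Fin N × Fin N) x => G (t, x) j.1 j.2) fun j => hGt j.1 j.2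
  filter_upwards [hφ] with x hx
  refine hclosed.mem_of_tendsto (f := fun k =>
    mollifyMat (torusKer d (φ k)) (fun y => G (t, y)) x) (b := atTop) ?_ ?_
  · exact tendsto_pi_nhds.2 fun l => tendsto_pi_nhds.2 fun m => hx (l, m)
  · refine Eventually.of_forall fun k => ?_
    rw [ht (φ k) x]
    exact DiffOp.adj_mem_Lam (smoothVec_mollifyVec (smoothPer_torusKer d _) hwt) x

theorem smoothVecST_kernel {ρ : (Fin d → ℝ) → ℝ} (hρ : SmoothPer ρ) (x : Fin d → ℝ)
    (i : Fin n) : SmoothVecST fun p : ℝ × (Fin d → ℝ) =>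
      (EuclideanSpace.single i (ρ (x - p.2)) : EuclideanSpace ℝ (Fin n)) := by
  intro l
  by_cases hl : l = i
  · subst hl
    simp only [PiLp.single_apply, if_true]
    refine ⟨hρ.1.comp (contDiff_const.sub contDiff_snd), fun t k y => ?_⟩
    have := hρ.2 (-k) (x - y)
    simp only
    rw [← this]
    congr 1
    ext i
    simp only [Pi.add_apply, Pi.sub_apply, Pi.neg_apply, Int.cast_neg]
    ring
  · simp only [PiLp.single_apply, hl, if_false]
    exact ⟨contDiff_const, fun t k y => rfl⟩

/-- After testing with kernels in space, the claim becomes the one-dimensional statement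
`ae_eq_add_integral_of_weak` for each mollified coordinate. An integrable function all of whose
mollifications vanish is zero almost everywhere, which removes the mollification. -/
theorem HasWeakTimeDeriv.ae_slice {w D : ℝ × (Fin d → ℝ) → EuclideanSpace ℝ (Fin n)}
    (h : HasWeakTimeDeriv T w D) (hτ : 0 < τ) (hτT : τ ≤ T)
    {w₀ : (Fin d → ℝ) → EuclideanSpace ℝ (Fin n)}
    (hw : Integrable w (volume.restrict (cylinder d τ)))
    (hD : Integrable D (volume.restrict (cylinder d τ)))
    (hw₀ : Integrable w₀ (volume.restrict (cell d)))
    (htr : Tendsto (fun t => ∫⁻ x in cell d, ‖w (t, x) - w₀ x‖ₑ) (𝓝[>] 0 ⊓ ae volume) (𝓝 0))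
    (i : Fin n) :
    ∀ᵐ t ∂(volume.restrict (Ioo 0 τ)), ∀ᵐ x ∂(volume.restrict (cell d)),
      w (t, x) i = w₀ x i + ∫ s in (0)..t, D (s, x) i := by
  have hwi := integrable_euclidean_apply hw i
  have hDi := integrable_euclidean_apply hD i
  have hw₀i := integrable_euclidean_apply hw₀ i
  have hDt : ∀ t ∈ Ioo 0 τ, Integrable (fun p : ℝ × (Fin d → ℝ) => D p i)
      ((volume.restrict (Ioo 0 t)).prod (volume.restrict (cell d))) := fun t ht => by
    rw [← volume_restrict_cylinder]
    exact IntegrableOn.mono_set hDi (cylinder_mono d ht.2.le)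
  have hconv : ∀ t ∈ Ioo 0 τ, ∀ f : ℝ → ℝ, ∫ s in (0)..t, f s = ∫ s in Ioo 0 t, f s :=
    fun t ht f => by
      rw [intervalIntegral.integral_of_le ht.1.le, integral_Ioc_eq_integral_Ioo]
  have hI : ∀ t ∈ Ioo 0 τ, Integrable (fun x => ∫ s in (0)..t, D (s, x) i)
      (volume.restrict (cell d)) := fun t ht => by
    simp only [hconv t ht]
    exact (hDt t ht).integral_prod_right
  have hZ : ∀ᵐ t ∂(volume.restrict (Ioo 0 τ)), Integrable
      (fun x => w (t, x) i - (w₀ x i + ∫ s in (0)..t, D (s, x) i)) (volume.restrict (cell d)) := by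
    filter_upwards [ae_integrable_slice hwi, ae_restrict_mem measurableSet_Ioo] with t h1 ht
    exact h1.sub (hw₀i.add (hI t ht))
  have key := ae_of_forall_denseSeq (τ := τ) (f := fun t k x => mollify (torusKer d k)
    (fun y => w (t, y) i - (w₀ y i + ∫ s in (0)..t, D (s, y) i)) x) (by
      filter_upwards [hZ] with t ht k
      exact continuous_mollify (smoothPer_torusKer d k) ht) fun k x => by
    have hρ := smoothPer_torusKer d k
    obtain ⟨C, -, hC⟩ := hρ.exists_bound
    have hρm : ∀ μ : Measure (ℝ × (Fin d → ℝ)),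
        AEStronglyMeasurable (fun p : ℝ × (Fin d → ℝ) => torusKer d k (x - p.2)) μ := fun μ =>
      (hρ.1.continuous.comp (continuous_const.sub continuous_snd)).aestronglyMeasurable
    have j1 : Integrable (fun p : ℝ × (Fin d → ℝ) => torusKer d k (x - p.2) * w p i)
        (volume.restrict (cylinder d τ)) :=
      hwi.bdd_mul (c := C) (hρm _) (Eventually.of_forall fun p => hC _)
    have j2 : Integrable (fun p : ℝ × (Fin d → ℝ) => torusKer d k (x - p.2) * D p i)
        (volume.restrict (cylinder d τ)) :=
      hDi.bdd_mul (c := C) (hρm _) (Eventually.of_forall fun p => hC _)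
    have j1' := j1
    have j2' := j2
    rw [volume_restrict_cylinder] at j1' j2'
    have hA := ae_eq_add_integral_of_weak hτ (m₀ := mollify (torusKer d k) (fun y => w₀ y i) x)
      j1'.integral_prod_left j2'.integral_prod_left fun θ hθ ⟨b, hb, hθb⟩ => by
        have hφ := smoothVecST_kernel (n := n) hρ x i
        have hdt : ∀ p, dtVec (fun p : ℝ × (Fin d → ℝ) =>
            (EuclideanSpace.single i (torusKer d k (x - p.2)) : EuclideanSpace ℝ (Fin n))) p = 0 :=
          fun p => by
            simp only [dtVec]
            exact deriv_const _ _
        have h1 := h.integral_add_eq hτ hτT hw hD hw₀ htr (hφ.time_smul hθ) hb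
          fun t y ht => by simp only [hθb t ht, zero_smul]
        simp only [hφ.dtVec_time_smul hθ, hdt, smul_zero, add_zero, real_inner_smul_right,
          EuclideanSpace.inner_single_right, conj_trivial] at h1
        obtain ⟨C1, hC1⟩ := isCompact_Icc.exists_bound_of_continuousOn
          ((hθ.continuous_deriv (by simp)).continuousOn (s := Icc 0 τ))
        obtain ⟨C2, hC2⟩ := isCompact_Icc.exists_bound_of_continuousOn
          (hθ.continuous.continuousOn (s := Icc 0 τ))
        have l1 : Integrable (fun p : ℝ × (Fin d → ℝ) =>
            deriv θ p.1 * (torusKer d k (x - p.2) * w p i)) (volume.restrict (cylinder d τ)) := by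
          refine j1.bdd_mul (c := C1)
            ((hθ.continuous_deriv (by simp)).comp continuous_fst).aestronglyMeasurable ?_
          filter_upwards [ae_mem_cylinder d τ] with p hp
          exact hC1 _ (Ioo_subset_Icc_self hp.1)
        have l2 : Integrable (fun p : ℝ × (Fin d → ℝ) =>
            θ p.1 * (torusKer d k (x - p.2) * D p i)) (volume.restrict (cylinder d τ)) := by
          refine j2.bdd_mul (c := C2) (hθ.continuous.comp continuous_fst).aestronglyMeasurable ?_
          filter_upwards [ae_mem_cylinder d τ] with p hp
          exact hC2 _ (Ioo_subset_Icc_self hp.1)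
        rw [integral_add l1 l2, integral_cylinder l1, integral_cylinder l2] at h1
        simp only [integral_const_mul] at h1
        have l1' := l1
        have l2' := l2
        rw [volume_restrict_cylinder] at l1' l2'
        have m1 := l1'.integral_prod_left
        have m2 := l2'.integral_prod_left
        simp only [integral_const_mul] at m1 m2
        rw [integral_add m1 m2, h1]
        rfl
    filter_upwards [hA, ae_integrable_slice hwi, ae_restrict_mem measurableSet_Ioo] with t ht hwt htm
    have hsw : mollify (torusKer d k) (fun y => ∫ s in (0)..t, D (s, y) i) x =
        ∫ s in (0)..t, ∫ y in cell d, torusKer d k (x - y) * D (s, y) i := by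
      simp only [hconv t htm, mollify, ← integral_const_mul]
      refine (integral_integral_swap (f := fun s y => torusKer d k (x - y) * D (s, y) i) ?_).symm
      exact (hDt t htm).bdd_mul (c := C) (hρm _) (Eventually.of_forall fun p => hC _)
    have hadd : mollify (torusKer d k) (fun y => w₀ y i + ∫ s in (0)..t, D (s, y) i) x =
        mollify (torusKer d k) (fun y => w₀ y i) x +
          mollify (torusKer d k) (fun y => ∫ s in (0)..t, D (s, y) i) x := by
      simp only [mollify, mul_add]
      exact integral_add (hρ.integrable_mul hw₀i x) (hρ.integrable_mul (hI t htm) x)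
    have hw₀I : Integrable (fun y => w₀ y i + ∫ s in (0)..t, D (s, y) i)
        (volume.restrict (cell d)) := hw₀i.add (hI t htm)
    rw [mollify_sub hρ hwt hw₀I, hadd, hsw, ← ht]
    exact sub_self _
  filter_upwards [key, hZ] with t ht hZt
  filter_upwards [eq_zero_of_mollify_eq_zero hZt ht] with x hx
  linarith

end Slices

/-! ### Strong solutions on shorter time intervals -/

section Extension

variable {d n N : ℕ} {T τ : ℝ}

/-- Weak derivatives come with regularity only on compact time intervals; countably many strips
`[1/(k+1), τ]` exhaust the cylinder. -/
theorem aestronglyMeasurable_cylinder {E : Type*} [NormedAddCommGroup E]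
    {f : ℝ × (Fin d → ℝ) → E} (hτT : τ < T)
    (hf : ∀ a b : ℝ, 0 < a → b < T →
      AEStronglyMeasurable f (volume.restrict (Icc a b ×ˢ cell d))) :
    AEStronglyMeasurable f (volume.restrict (cylinder d τ)) := by
  have h : AEStronglyMeasurable f
      (volume.restrict (⋃ k : ℕ, Icc (1 / ((k : ℝ) + 1)) τ ×ˢ cell d)) :=
    AEStronglyMeasurable.iUnion fun k => hf _ _ (by positivity) hτT
  refine h.mono_measure (Measure.restrict_mono_set _ fun p hp => ?_)
  obtain ⟨k, hk⟩ := exists_nat_one_div_lt hp.1.1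
  exact mem_iUnion.2 ⟨k, ⟨hk.le, hp.1.2.le⟩, hp.2⟩

theorem cylinder_inter (d : ℕ) (h : τ ≤ T) :
    {p : ℝ × (Fin d → ℝ) | p.1 < τ} ∩ cylinder d T = cylinder d τ := by
  ext p
  constructor
  · rintro ⟨h1, h2⟩
    exact ⟨⟨h2.1.1, h1⟩, h2.2⟩
  · rintro ⟨h1, h2⟩
    exact ⟨h1.2, ⟨h1.1, h1.2.trans_le h⟩, h2⟩

theorem aestronglyMeasurable_extend {E : Type*} [NormedAddCommGroup E]
    {f : ℝ × (Fin d → ℝ) → E} (h : τ ≤ T)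
    (hf : AEStronglyMeasurable f (volume.restrict (cylinder d τ)))
    (h0 : ∀ p : ℝ × (Fin d → ℝ), τ ≤ p.1 → f p = 0) :
    AEStronglyMeasurable f (volume.restrict (cylinder d T)) := by
  have hm : MeasurableSet {p : ℝ × (Fin d → ℝ) | p.1 < τ} :=
    measurableSet_lt measurable_fst measurable_const
  have e : f = {p : ℝ × (Fin d → ℝ) | p.1 < τ}.indicator f := by
    ext1 p
    by_cases hp : p.1 < τ
    · exact (indicator_of_mem (s := {p : ℝ × (Fin d → ℝ) | p.1 < τ}) hp f).symm
    · rw [indicator_of_notMem (s := {p : ℝ × (Fin d → ℝ) | p.1 < τ}) hp, h0 p (not_lt.1 hp)]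
  rw [e, aestronglyMeasurable_indicator_iff hm, Measure.restrict_restrict hm, cylinder_inter d h]
  exact hf

theorem ae_extend {P : ℝ × (Fin d → ℝ) → Prop}
    (hf : ∀ᵐ p ∂(volume.restrict (cylinder d τ)), P p)
    (h0 : ∀ p : ℝ × (Fin d → ℝ), τ ≤ p.1 → P p) :
    ∀ᵐ p ∂(volume.restrict (cylinder d T)), P p := by
  rw [ae_restrict_iff' (measurableSet_cylinder d _)] at hf ⊢
  filter_upwards [hf] with p hp hpT
  by_cases h : p.1 < τ
  · exact hp ⟨⟨hpT.1.1, h⟩, hpT.2⟩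
  · exact h0 p (not_lt.1 h)

theorem ae_of_ae_cylinder {P : ℝ × (Fin d → ℝ) → Prop} (h : τ ≤ T)
    (hf : ∀ᵐ p ∂(volume.restrict (cylinder d T)), P p) :
    ∀ᵐ p ∂(volume.restrict (cylinder d τ)), P p :=
  ae_mono (Measure.restrict_mono_set _ (cylinder_mono d h)) hf

theorem exists_ae_bound_of_memLp_top {X : Type*} [MeasurableSpace X] {μ : Measure X} {f : X → ℝ}
    (hf : MemLp f ⊤ μ) : ∃ C, 0 ≤ C ∧ ∀ᵐ x ∂μ, |f x| ≤ C := by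
  refine ⟨(eLpNormEssSup f μ).toReal, ENNReal.toReal_nonneg, ?_⟩
  have hlt : eLpNormEssSup f μ ≠ ⊤ := by
    have := hf.2.ne
    rwa [eLpNorm_exponent_top] at this
  filter_upwards [ae_le_eLpNormEssSup (f := f) (μ := μ)] with x hx
  have := ENNReal.toReal_mono hlt hx
  rwa [toReal_enorm, Real.norm_eq_abs] at this

/-- Away from `T` the integrated weight is at least `c (T - τ)`, so bounds on `H L^*(v^#)` become
bounds on `L^*(v^#)` itself. -/
theorem exists_intWeight_lower_bound {κ : ℝ → ℝ} (hκ : IsWeight T κ) (hτT : τ < T) :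
    ∃ c, 0 < c ∧ ∀ t ∈ Ioo 0 τ, c ≤ intWeight T κ t := by
  obtain ⟨hm, c, C, hc, hκ⟩ := hκ
  refine ⟨c * (T - τ), mul_pos hc (by linarith), fun t ht => ?_⟩
  have htT : t ≤ T := (ht.2.trans hτT).le
  have hi : IntervalIntegrable κ volume t T := by
    rw [intervalIntegrable_iff_integrableOn_Icc_of_le htT]
    refine Measure.integrableOn_of_bounded (M := C) measure_Icc_lt_top.ne
      hm.aestronglyMeasurable ?_
    filter_upwards [ae_restrict_mem measurableSet_Icc] with s hs
    have := hκ s ⟨ht.1.le.trans hs.1, hs.2⟩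
    rw [Real.norm_of_nonneg (hc.le.trans this.1)]
    exact this.2
  have h1 := intervalIntegral.integral_mono_on htT (intervalIntegrable_const (c := c)) hi
    fun s hs => (hκ s ⟨ht.1.le.trans hs.1, hs.2⟩).1
  rw [intervalIntegral.integral_const, smul_eq_mul] at h1
  refine le_trans ?_ h1
  rw [mul_comm]
  exact mul_le_mul_of_nonneg_right (by linarith [ht.2]) hc.le

end Extension

/-! ### Bounds and integrability for a strong solution before the final time. -/

section Local

variable {d n N : ℕ} {T τ : ℝ} {L : DiffOp d n N}
  {F : EuclideanSpace ℝ (Fin n) → Matrix (Fin N) (Fin N) ℝ}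

theorem StandingAssumptions.exists_norm_sharp_le (h : StandingAssumptions L F) :
    ∃ A, 0 ≤ A ∧ ∀ v, ‖sharp F v‖ ≤ A * (entropy F v + 1) := by
  obtain ⟨A, hA0, hA⟩ := norm_le_of_inner_le (entropy F)
  obtain ⟨C, hC0, hC⟩ := h.nFunction.abs_inner_gradient_le h.deltaTwo h.differentiable_entropy
  refine ⟨A * C * 2, by positivity, fun v => ?_⟩
  have hv := h.nFunction.nonneg v
  have h1 := hA C (entropy F v + 1) (sharp F v) hC0 (by linarith) fun y => by
    rw [real_inner_comm]
    refine (hC v y).trans (le_of_eq (by ring))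
  refine h1.trans ?_
  rw [mul_assoc (A * C)]
  exact mul_le_mul_of_nonneg_left (by linarith) (by positivity)

theorem StandingAssumptions.exists_norm_fluxGrad_le (h : StandingAssumptions L F) {C : ℝ}
    (hC0 : 0 ≤ C) :
    ∃ A, 0 ≤ A ∧ ∀ Q ∈ L.Lam, (∀ l m, |Q l m| ≤ C) → ∀ v,
      ‖fluxGrad F Q v‖ ≤ A * (entropy F v + 1) := by
  obtain ⟨A, hA0, hA⟩ := norm_le_of_inner_le (entropy F)
  obtain ⟨C', hC'0, hC'⟩ := h.abs_inner_fluxGrad_le hC0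
  refine ⟨A * C' * 2, by positivity, fun Q hQ hQC v => ?_⟩
  have hv := h.nFunction.nonneg v
  have h1 := hA C' (entropy F v + 1) (fluxGrad F Q v) hC'0 (by linarith) fun y =>
    (hC' Q hQ hQC v y).trans (le_of_eq (by ring))
  refine h1.trans ?_
  rw [mul_assoc (A * C')]
  exact mul_le_mul_of_nonneg_left (by linarith) (by positivity)

theorem StandingAssumptions.continuous_apply (h : StandingAssumptions L F) (a b : Fin N) :
    Continuous (fun v => F v a b) := (h.differentiable_apply a b).continuous

theorem aestronglyMeasurable_frob {X : Type*} [MeasurableSpace X] {μ : Measure X}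
    {A B : X → Matrix (Fin N) (Fin N) ℝ} (hA : ∀ l m, AEStronglyMeasurable (fun p => A p l m) μ)
    (hB : ∀ l m, AEStronglyMeasurable (fun p => B p l m) μ) :
    AEStronglyMeasurable (fun p => frob (A p) (B p)) μ := by
  unfold frob
  exact Finset.aestronglyMeasurable_fun_sum _ fun l _ =>
    Finset.aestronglyMeasurable_fun_sum _ fun m _ => (hA l m).mul (hB l m)

/-- The regularity of a strong solution on the subinterval `(0,τ)`. -/
structure RegularOn (L : DiffOp d n N)
    (F : EuclideanSpace ℝ (Fin n) → Matrix (Fin N) (Fin N) ℝ) (T τ : ℝ)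
    (v₀ : (Fin d → ℝ) → EuclideanSpace ℝ (Fin n))
    (v D : ℝ × (Fin d → ℝ) → EuclideanSpace ℝ (Fin n))
    (G : ℝ × (Fin d → ℝ) → Matrix (Fin N) (Fin N) ℝ) (C : ℝ) : Prop where
  timeDeriv : HasWeakTimeDeriv T (fun p => sharp F (v p)) D
  weakAdj : HasWeakAdj L T (fun p => sharp F (v p)) G
  initial : Tendsto (fun t => ∫⁻ x in cell d, ‖sharp F (v (t, x)) - sharp F (v₀ x)‖ₑ)
    (𝓝[>] 0 ⊓ ae volume) (𝓝 0)
  mem : MemOrlicz (entropy F) v (volume.restrict (cylinder d T))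
  mem_initial : MemOrlicz (entropy F) v₀ (volume.restrict (cell d))
  integrable_sharp : Integrable (fun p => sharp F (v p)) (volume.restrict (cylinder d τ))
  integrable_sharp_initial : Integrable (fun x => sharp F (v₀ x)) (volume.restrict (cell d))
  integrable_deriv : Integrable D (volume.restrict (cylinder d τ))
  integrable_adj : ∀ l m, Integrable (fun p => G p l m) (volume.restrict (cylinder d τ))
  bound_nonneg : 0 ≤ C
  abs_adj_le : ∀ᵐ p ∂(volume.restrict (cylinder d τ)), ∀ l m, |G p l m| ≤ C
  adj_mem : ∀ᵐ p ∂(volume.restrict (cylinder d τ)), G p ∈ L.Lam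
  deriv_eq : ∀ᵐ p ∂(volume.restrict (cylinder d τ)), D p = -fluxGrad F (G p) (v p)

instance isFiniteMeasure_cylinder (d : ℕ) (τ : ℝ) :
    IsFiniteMeasure (volume.restrict (cylinder d τ)) := by
  rw [volume_restrict_cylinder]
  infer_instance

theorem MemOrlicz.integrable_sharp {X : Type*} [MeasurableSpace X] {μ : Measure X}
    [IsFiniteMeasure μ] (h : StandingAssumptions L F) {v : X → EuclideanSpace ℝ (Fin n)}
    (hv : MemOrlicz (entropy F) v μ) : Integrable (fun p => sharp F (v p)) μ := by
  obtain ⟨A, -, hA⟩ := h.exists_norm_sharp_le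
  exact ((hv.2.add (integrable_const 1)).const_mul A).mono'
    (h.continuous_sharp.comp_aestronglyMeasurable hv.1) (Eventually.of_forall fun p => hA (v p))

/-- Before `T` the weight can be divided out, which bounds `G`; the slicing argument puts `G` in
`Λ`; the equation then expresses `D` by the flux gradient. -/
theorem IsStrongSolution.exists_regularOn {κ : ℝ → ℝ} (h : StandingAssumptions L F)
    (hκ : IsWeight T κ) {v₀ : (Fin d → ℝ) → EuclideanSpace ℝ (Fin n)}
    (hv₀ : MemOrlicz (entropy F) v₀ (volume.restrict (cell d)))
    {v : ℝ × (Fin d → ℝ) → EuclideanSpace ℝ (Fin n)} (hv : IsStrongSolution L F T κ v₀ v)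
    (hτ : 0 < τ) (hτT : τ < T) : ∃ D G C, RegularOn L F T τ v₀ v D G C := by
  obtain ⟨D, G, hD, hG, hHG, heq⟩ := hv.equation
  have hm := hv.weak.mem
  have hw : Integrable (fun p => sharp F (v p)) (volume.restrict (cylinder d τ)) :=
    IntegrableOn.mono_set (hm.integrable_sharp h) (cylinder_mono d hτT.le)
  obtain ⟨c, hc, hcH⟩ := exists_intWeight_lower_bound hκ hτT
  choose B hB0 hB using fun l m => exists_ae_bound_of_memLp_top (hHG l m)
  set C : ℝ := (∑ l, ∑ m, B l m) / c with hCdef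
  have hC0 : 0 ≤ C :=
    div_nonneg (Finset.sum_nonneg fun l _ => Finset.sum_nonneg fun m _ => hB0 l m) hc.le
  have hGC : ∀ᵐ p ∂(volume.restrict (cylinder d τ)), ∀ l m, |G p l m| ≤ C := by
    have h1 : ∀ᵐ p ∂(volume.restrict (cylinder d τ)), ∀ l m,
        |intWeight T κ p.1 * G p l m| ≤ B l m :=
      ae_all_iff.2 fun l => ae_all_iff.2 fun m => ae_of_ae_cylinder hτT.le (hB l m)
    filter_upwards [h1, ae_mem_cylinder d τ] with p hp hpm l m
    have h2 := hcH p.1 hpm.1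
    have h3 := hp l m
    rw [abs_mul, abs_of_pos (hc.trans_le h2)] at h3
    rw [hCdef, le_div_iff₀ hc, mul_comm]
    refine (mul_le_mul_of_nonneg_right h2 (abs_nonneg _)).trans (h3.trans ?_)
    refine (Finset.single_le_sum (f := fun m => B l m) (fun m _ => hB0 l m)
      (Finset.mem_univ m)).trans ?_
    exact Finset.single_le_sum (f := fun l => ∑ m, B l m)
      (fun l _ => Finset.sum_nonneg fun m _ => hB0 l m) (Finset.mem_univ l)
  have hGi : ∀ l m, Integrable (fun p => G p l m) (volume.restrict (cylinder d τ)) := fun l m => by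
    refine (integrable_const C).mono' (aestronglyMeasurable_cylinder hτT fun a b ha hb =>
      ((hG.1 a b ha hb).2 l m).aestronglyMeasurable) ?_
    filter_upwards [hGC] with p hp
    exact hp l m
  have hGL := hG.ae_mem_Lam hτ hτT.le hw hGi
  have hDeq : ∀ᵐ p ∂(volume.restrict (cylinder d τ)), D p = -fluxGrad F (G p) (v p) := by
    filter_upwards [ae_of_ae_cylinder hτT.le heq] with p hp
    ext l
    have := hp l
    simp only [fluxGrad, PiLp.neg_apply]
    linarith
  obtain ⟨A, hA0, hA⟩ := h.exists_norm_fluxGrad_le hC0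
  -- Integrability of `D` up to `t = 0` is not part of the weak derivative; it follows from the
  -- equation and the entropy bound for the flux gradient.
  have hDi : Integrable D (volume.restrict (cylinder d τ)) := by
    have hK : Integrable (fun p => entropy F (v p)) (volume.restrict (cylinder d τ)) :=
      IntegrableOn.mono_set hm.2 (cylinder_mono d hτT.le)
    refine ((hK.add (integrable_const 1)).const_mul A).mono'
      (aestronglyMeasurable_cylinder hτT fun a b ha hb =>
        (hD.1 a b ha hb).2.aestronglyMeasurable) ?_
    filter_upwards [hDeq, hGC, hGL] with p hp hpC hpL
    rw [hp, norm_neg]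
    exact hA _ hpL hpC (v p)
  exact ⟨D, G, C, hD, hG, hv.initial, hm, hv₀, hw, hv₀.integrable_sharp h, hDi, hGi, hC0, hGC, hGL,
    hDeq⟩

end Local

/-! ### Test pairs built from a strong solution -/

section TestPair

variable {d n N : ℕ} {T τ : ℝ} {L : DiffOp d n N}
  {F : EuclideanSpace ℝ (Fin n) → Matrix (Fin N) (Fin N) ℝ}
  {v₀ : (Fin d → ℝ) → EuclideanSpace ℝ (Fin n)}
  {v D : ℝ × (Fin d → ℝ) → EuclideanSpace ℝ (Fin n)}
  {G : ℝ × (Fin d → ℝ) → Matrix (Fin N) (Fin N) ℝ} {C : ℝ}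

/-- The field `∂_t (θ v^#)` when `D = ∂_t v^#`. -/
noncomputable def testField (F : EuclideanSpace ℝ (Fin n) → Matrix (Fin N) (Fin N) ℝ)
    (v D : ℝ × (Fin d → ℝ) → EuclideanSpace ℝ (Fin n)) (θ : ℝ → ℝ) (p : ℝ × (Fin d → ℝ)) :
    EuclideanSpace ℝ (Fin n) := deriv θ p.1 • sharp F (v p) + θ p.1 • D p

theorem RegularOn.exists_abs_inner_testField_le (h : StandingAssumptions L F)
    (r : RegularOn L F T τ v₀ v D G C) {θ : ℝ → ℝ} (hθ : ContDiff ℝ ∞ θ) :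
    ∃ A, 0 ≤ A ∧ ∀ᵐ p ∂(volume.restrict (cylinder d τ)), ∀ y,
      |inner ℝ y (testField F v D θ p)| ≤ A * (entropy F (v p) + entropy F y + 1) := by
  obtain ⟨C₁, hC₁0, hC₁⟩ := h.nFunction.abs_inner_gradient_le h.deltaTwo h.differentiable_entropy
  obtain ⟨C₂, hC₂0, hC₂⟩ := h.abs_inner_fluxGrad_le r.bound_nonneg
  obtain ⟨B₁, hB₁⟩ := isCompact_Icc.exists_bound_of_continuousOn
    ((hθ.continuous_deriv (by simp)).continuousOn (s := Icc 0 τ))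
  obtain ⟨B₂, hB₂⟩ := isCompact_Icc.exists_bound_of_continuousOn
    (hθ.continuous.continuousOn (s := Icc 0 τ))
  refine ⟨|B₁| * C₁ + |B₂| * C₂, by positivity, ?_⟩
  filter_upwards [r.deriv_eq, r.abs_adj_le, r.adj_mem, ae_mem_cylinder d τ] with p hp hpC hpL hpm y
  have ht : p.1 ∈ Icc 0 τ := Ioo_subset_Icc_self hpm.1
  have h1 := hC₁ (v p) y
  have h2 := hC₂ _ hpL hpC (v p) y
  have b1 : |deriv θ p.1| ≤ |B₁| := (hB₁ _ ht).trans (le_abs_self _)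
  have b2 : |θ p.1| ≤ |B₂| := (hB₂ _ ht).trans (le_abs_self _)
  rw [testField, hp, inner_add_right, real_inner_smul_right, real_inner_smul_right,
    inner_neg_right, real_inner_comm, add_mul]
  refine (abs_add_le _ _).trans (add_le_add ?_ ?_)
  · rw [abs_mul, mul_assoc]
    exact mul_le_mul b1 h1 (abs_nonneg _) (abs_nonneg _)
  · rw [abs_mul, abs_neg, mul_assoc]
    exact mul_le_mul b2 h2 (abs_nonneg _) (abs_nonneg _)

theorem testField_eq_zero {θ : ℝ → ℝ} {b : ℝ} (hθb : ∀ t, b ≤ t → θ t = 0)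
    {p : ℝ × (Fin d → ℝ)} (hp : b < p.1) : testField F v D θ p = 0 := by
  have : θ =ᶠ[𝓝 p.1] fun _ => 0 := by
    filter_upwards [lt_mem_nhds hp] with s hs
    exact hθb s hs.le
  rw [testField, this.deriv_eq, deriv_const, hθb _ hp.le, zero_smul, zero_smul, add_zero]

theorem RegularOn.integrable_testField (r : RegularOn L F T τ v₀ v D G C) {θ : ℝ → ℝ}
    (hθ : ContDiff ℝ ∞ θ) :
    Integrable (testField F v D θ) (volume.restrict (cylinder d τ)) := by
  obtain ⟨B₁, hB₁⟩ := isCompact_Icc.exists_bound_of_continuousOn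
    ((hθ.continuous_deriv (by simp)).continuousOn (s := Icc 0 τ))
  obtain ⟨B₂, hB₂⟩ := isCompact_Icc.exists_bound_of_continuousOn
    (hθ.continuous.continuousOn (s := Icc 0 τ))
  refine Integrable.add ?_ ?_
  · refine r.integrable_sharp.bdd_smul (C := B₁)
      (hφ1 := ((hθ.continuous_deriv (by simp)).comp continuous_fst).aestronglyMeasurable) (hφ2 := ?_)
    filter_upwards [ae_mem_cylinder d τ] with p hp
    exact hB₁ _ (Ioo_subset_Icc_self hp.1)
  · refine r.integrable_deriv.bdd_smul (C := B₂)
      (hφ1 := (hθ.continuous.comp continuous_fst).aestronglyMeasurable) (hφ2 := ?_)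
    filter_upwards [ae_mem_cylinder d τ] with p hp
    exact hB₂ _ (Ioo_subset_Icc_self hp.1)

theorem RegularOn.integrable_inner_testField (h : StandingAssumptions L F)
    (r : RegularOn L F T τ v₀ v D G C) (hτT : τ ≤ T) {θ : ℝ → ℝ} (hθ : ContDiff ℝ ∞ θ)
    {y : ℝ × (Fin d → ℝ) → EuclideanSpace ℝ (Fin n)}
    (hy : MemOrlicz (entropy F) y (volume.restrict (cylinder d τ))) :
    Integrable (fun p => inner ℝ (y p) (testField F v D θ p)) (volume.restrict (cylinder d τ)) := by
  obtain ⟨A, -, hA⟩ := r.exists_abs_inner_testField_le h hθ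
  have hK : Integrable (fun p => entropy F (v p)) (volume.restrict (cylinder d τ)) :=
    IntegrableOn.mono_set r.mem.2 (cylinder_mono d hτT)
  refine (((hK.add hy.2).add (integrable_const 1)).const_mul A).mono'
    (hy.1.inner (r.integrable_testField hθ).aestronglyMeasurable) ?_
  filter_upwards [hA] with p hp
  exact hp (y p)

theorem RegularOn.integrable_frob (r : RegularOn L F T τ v₀ v D G C) {θ : ℝ → ℝ}
    (hθ : ContDiff ℝ ∞ θ) {Q : ℝ × (Fin d → ℝ) → Matrix (Fin N) (Fin N) ℝ}
    (hQ : ∀ l m, Integrable (fun p => Q p l m) (volume.restrict (cylinder d τ))) :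
    Integrable (fun p => frob (Q p) (θ p.1 • G p)) (volume.restrict (cylinder d τ)) := by
  obtain ⟨B, hB⟩ := isCompact_Icc.exists_bound_of_continuousOn
    (hθ.continuous.continuousOn (s := Icc 0 τ))
  unfold frob
  refine integrable_finsetSum _ fun l _ => integrable_finsetSum _ fun m _ => ?_
  refine (hQ l m).mul_bdd (c := |B| * C)
    ((hθ.continuous.comp continuous_fst).aestronglyMeasurable.mul
      (r.integrable_adj l m).aestronglyMeasurable) ?_
  filter_upwards [r.abs_adj_le, ae_mem_cylinder d τ] with p hp hpm
  rw [Matrix.smul_apply, smul_eq_mul, norm_mul]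
  exact mul_le_mul ((hB _ (Ioo_subset_Icc_self hpm.1)).trans (le_abs_self _)) (hp l m)
    (abs_nonneg _) (abs_nonneg _)

theorem RegularOn.integrable_frob_flux (h : StandingAssumptions L F)
    (r : RegularOn L F T τ v₀ v D G C) (hτT : τ ≤ T) {θ : ℝ → ℝ} (hθ : ContDiff ℝ ∞ θ) :
    Integrable (fun p => frob (F (v p)) (θ p.1 • G p)) (volume.restrict (cylinder d τ)) := by
  obtain ⟨B, hB⟩ := isCompact_Icc.exists_bound_of_continuousOn
    (hθ.continuous.continuousOn (s := Icc 0 τ))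
  have hK : Integrable (fun p => entropy F (v p)) (volume.restrict (cylinder d τ)) :=
    IntegrableOn.mono_set r.mem.2 (cylinder_mono d hτT)
  have hvm := r.mem.1.mono_measure (Measure.restrict_mono_set volume (cylinder_mono d hτT))
  refine (((hK.const_mul 2).add (integrable_const (F 0).trace)).const_mul
    (|B| * (N * C))).mono' (aestronglyMeasurable_frob
      (fun l m => (h.continuous_apply l m).comp_aestronglyMeasurable hvm)
      fun l m => (hθ.continuous.comp continuous_fst).aestronglyMeasurable.mul
      (r.integrable_adj l m).aestronglyMeasurable) ?_
  filter_upwards [r.abs_adj_le, r.adj_mem, ae_mem_cylinder d τ] with p hp hpL hpm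
  rw [frob_smul_right, norm_mul, mul_assoc]
  exact mul_le_mul ((hB _ (Ioo_subset_Icc_self hpm.1)).trans (le_abs_self _))
    (h.abs_frob_le hpL hp (v p)) (abs_nonneg _) (abs_nonneg _)

theorem DiffOp.appST_eq_zero (L : DiffOp d n N)
    {Ψ : ℝ × (Fin d → ℝ) → Matrix (Fin N) (Fin N) ℝ} {t : ℝ} (h : ∀ x, Ψ (t, x) = 0)
    (x : Fin d → ℝ) : L.appST Ψ (t, x) = 0 := by
  have e : (fun y => Ψ (t, y)) = fun y => (0 : ℝ) • Ψ (t, y) := by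
    ext1 y
    rw [h y, smul_zero]
  rw [DiffOp.appST, e, L.app_const_smul, zero_smul]

/-- The constraint expresses `∂_t (θ L^* w) = L^* ∂_t (θ w)` in weak form: the time derivative is
tested with `θ LΨ` and the adjoint relation with `θ ∂_tΨ`. Both fields extend by zero from `(0,τ)`
to `(0,T)` because `θ` vanishes from `b < τ` on. -/
theorem RegularOn.isTestPair (h : StandingAssumptions L F)
    (r : RegularOn L F T τ v₀ v D G C) (hτ : 0 < τ) (hτT : τ ≤ T) {θ : ℝ → ℝ}
    (hθ : ContDiff ℝ ∞ θ) {b : ℝ} (hb : b < τ) (hθb : ∀ t, b ≤ t → θ t = 0) :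
    IsTestPair L F T (testField F v D θ) (fun p => θ p.1 • G p) := by
  have hE0 : ∀ p : ℝ × (Fin d → ℝ), τ ≤ p.1 → testField F v D θ p = 0 := fun p hp =>
    testField_eq_zero hθb (hb.trans_le hp)
  have hB0 : ∀ p : ℝ × (Fin d → ℝ), τ ≤ p.1 → θ p.1 • G p = 0 := fun p hp => by
    rw [hθb _ (hb.le.trans hp), zero_smul]
  have hEm := aestronglyMeasurable_extend hτT (r.integrable_testField hθ).aestronglyMeasurable hE0
  obtain ⟨B, hB⟩ := isCompact_Icc.exists_bound_of_continuousOn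
    (hθ.continuous.continuousOn (s := Icc 0 τ))
  have hθm : ∀ μ : Measure (ℝ × (Fin d → ℝ)), AEStronglyMeasurable (fun p => θ p.1) μ := fun μ =>
    (hθ.continuous.comp continuous_fst).aestronglyMeasurable
  refine ⟨⟨hEm, ?_⟩, fun l m => ?_, ?_, fun Ψ hΨ hΨ0 => ?_⟩
  · obtain ⟨A, hA0, hA⟩ := r.exists_abs_inner_testField_le h hθ
    -- Membership of `E` in `L_{K^*}` follows by duality: `E·y` is dominated by `K(v) + K(y) + 1`,
    -- and `Δ₂` for the Legendre transform converts this into `K^*(E) ≲ K(v) + 1`.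
    obtain ⟨A', hA'0, hA'⟩ := h.nFunction.legendre_le_of_inner_le h.deltaTwo_legendre A
    refine (((r.mem.2.add (integrable_const 1)).add (integrable_const 1)).const_mul A').mono'
      (h.nFunction.continuous_legendre.comp_aestronglyMeasurable hEm) ?_
    have key : ∀ᵐ p ∂(volume.restrict (cylinder d T)), ∀ y,
        |inner ℝ y (testField F v D θ p)| ≤ A * (entropy F (v p) + entropy F y + 1) := by
      refine ae_extend hA fun p hp y => ?_
      rw [hE0 p hp, inner_zero_right, abs_zero]
      have := h.nFunction.nonneg (v p)
      have := h.nFunction.nonneg y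
      positivity
    filter_upwards [key] with p hp
    rw [Real.norm_of_nonneg (h.nFunction.legendre_nonneg _)]
    refine hA' _ (entropy F (v p) + 1) (by linarith [h.nFunction.nonneg (v p)]) fun y => ?_
    exact ((le_abs_self _).trans (hp y)).trans (le_of_eq (by ring))
  · refine memLp_top_of_bound (C := |B| * C) (aestronglyMeasurable_extend hτT
      ((hθm _).mul (r.integrable_adj l m).aestronglyMeasurable) fun p hp => ?_) ?_
    · exact congrFun (congrFun (hB0 p hp) l) m
    · refine ae_extend (τ := τ) ?_ fun p hp => ?_
      · filter_upwards [r.abs_adj_le, ae_mem_cylinder d τ] with p hp hpm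
        rw [Matrix.smul_apply, smul_eq_mul, norm_mul]
        exact mul_le_mul ((hB _ (Ioo_subset_Icc_self hpm.1)).trans (le_abs_self _)) (hp l m)
          (abs_nonneg _) (abs_nonneg _)
      · rw [hB0 p hp, Matrix.zero_apply, norm_zero]
        have := r.bound_nonneg
        positivity
  · refine ae_extend (τ := τ) ?_ fun p hp => ?_
    · filter_upwards [r.adj_mem] with p hp
      exact (DiffOp.isSymm_of_mem_Lam hp).smul _
    · rw [hB0 p hp]
      exact Matrix.isSymm_zero
  · have hLΨ := L.smoothVecST_appST hΨ
    have hdΨ := hΨ.dtMat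
    rw [setIntegral_cylinder_eq hτT fun p hp => by
      rw [hE0 p hp, hB0 p hp, inner_zero_left, frob_comm, frob_zero_right, add_zero]]
    have h1 := r.timeDeriv.integral_add_eq hτ hτT r.integrable_sharp r.integrable_deriv
      r.integrable_sharp_initial r.initial (hLΨ.time_smul hθ) hb
      fun t x ht => by simp only [hθb t ht, zero_smul]
    simp only [L.appST_eq_zero hΨ0, smul_zero, inner_zero_right, integral_zero, neg_zero] at h1
    have h2 := r.weakAdj.integral_eq hτT r.integrable_sharp r.integrable_adj
      (hdΨ.time_smul hθ) hb fun t x ht => by simp only [hθb t ht, zero_smul]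
    have i1 : Integrable (fun p => (inner ℝ (sharp F (v p))
        (dtVec (fun p => θ p.1 • L.appST Ψ p) p) : ℝ) + inner ℝ (D p) (θ p.1 • L.appST Ψ p))
        (volume.restrict (cylinder d τ)) :=
      ((hLΨ.time_smul hθ).dtVec.integrable_inner r.integrable_sharp).add
        ((hLΨ.time_smul hθ).integrable_inner r.integrable_deriv)
    have i2 : Integrable (fun p => (inner ℝ (sharp F (v p))
        (L.appST (fun p => θ p.1 • dtMat Ψ p) p) : ℝ)) (volume.restrict (cylinder d τ)) :=
      (L.smoothVecST_appST (hdΨ.time_smul hθ)).integrable_inner r.integrable_sharp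
    have i3 : Integrable (fun p => frob (G p) (θ p.1 • dtMat Ψ p))
        (volume.restrict (cylinder d τ)) := (hdΨ.time_smul hθ).integrable_frob r.integrable_adj
    -- `L` has constant coefficients and commutes with `∂_t`, so the terms `θ w·L∂_tΨ` cancel
    -- between the two groups. The first group integrates to zero because `Ψ(0) = 0`, the second by
    -- the adjoint relation.
    have e : ∀ p, frob (θ p.1 • G p) (dtMat Ψ p) + inner ℝ (testField F v D θ p) (L.appST Ψ p) =
        ((inner ℝ (sharp F (v p)) (dtVec (fun p => θ p.1 • L.appST Ψ p) p) : ℝ) +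
          inner ℝ (D p) (θ p.1 • L.appST Ψ p)) -
        ((inner ℝ (sharp F (v p)) (L.appST (fun p => θ p.1 • dtMat Ψ p) p) : ℝ) -
          frob (G p) (θ p.1 • dtMat Ψ p)) := fun p => by
      rw [hLΨ.dtVec_time_smul hθ, L.appST_time_smul, L.dtVec_appST hΨ, frob_comm (θ p.1 • G p),
        frob_smul_right, frob_smul_right, frob_comm (dtMat Ψ p), testField]
      simp only [inner_add_left, inner_add_right, real_inner_smul_left, real_inner_smul_right]
      ring
    simp only [e]
    have i4 : Integrable (fun p => (inner ℝ (sharp F (v p))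
        (L.appST (fun p => θ p.1 • dtMat Ψ p) p) : ℝ) - frob (G p) (θ p.1 • dtMat Ψ p))
        (volume.restrict (cylinder d τ)) := i2.sub i3
    rw [integral_sub i1 i4, integral_sub i2 i3, h1, h2, sub_self, sub_self]

theorem RegularOn.integral_eq_zero (h : StandingAssumptions L F)
    (r : RegularOn L F T τ v₀ v D G C) (hτ : 0 < τ) (hτT : τ ≤ T) {θ : ℝ → ℝ}
    (hθ : ContDiff ℝ ∞ θ) {b : ℝ} (hb : b < τ) (hθb : ∀ t, b ≤ t → θ t = 0)
    {y : ℝ × (Fin d → ℝ) → EuclideanSpace ℝ (Fin n)}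
    {Q : ℝ × (Fin d → ℝ) → Matrix (Fin N) (Fin N) ℝ}
    (hy : ∀ E B, IsTestPair L F T E B →
      ∫ p in cylinder d T, (inner ℝ (y p - v₀ p.2) (E p) + frob (Q p) (B p)) = 0) :
    ∫ p in cylinder d τ, (inner ℝ (y p - v₀ p.2) (testField F v D θ p) +
      frob (Q p) (θ p.1 • G p)) = 0 := by
  rw [← setIntegral_cylinder_eq hτT]
  · exact hy _ _ (r.isTestPair h hτ hτT hθ hb hθb)
  · intro p hp
    rw [testField_eq_zero hθb (hb.trans_le hp), hθb _ (hb.le.trans hp), zero_smul,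
      inner_zero_right, frob_zero_right, add_zero]

end TestPair

/-! ### Comparison with subsolutions -/

section TimeWeight

/-- A nonnegative decreasing function of time that vanishes for `t ≥ b` and decays at least at
the exponential rate `c`. -/
noncomputable def timeWeight (c b t : ℝ) : ℝ := Real.exp (-(c * t)) * expNegInvGlue (b - t)

theorem contDiff_timeWeight (c b : ℝ) : ContDiff ℝ ∞ (timeWeight c b) :=
  (Real.contDiff_exp.comp (contDiff_const.mul contDiff_id).neg).mul
    (expNegInvGlue.contDiff.comp (contDiff_const.sub contDiff_id))

theorem timeWeight_nonneg (c b t : ℝ) : 0 ≤ timeWeight c b t :=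
  mul_nonneg (Real.exp_pos _).le (expNegInvGlue.nonneg _)

theorem timeWeight_pos {b t : ℝ} (c : ℝ) (h : t < b) : 0 < timeWeight c b t :=
  mul_pos (Real.exp_pos _) (expNegInvGlue.pos_of_pos (sub_pos.2 h))

theorem timeWeight_eq_zero {b t : ℝ} (c : ℝ) (h : b ≤ t) : timeWeight c b t = 0 := by
  rw [timeWeight, expNegInvGlue.zero_of_nonpos (sub_nonpos.2 h), mul_zero]

theorem deriv_timeWeight_le (c b t : ℝ) : deriv (timeWeight c b) t ≤ -(c * timeWeight c b t) := by
  have hg : HasDerivAt expNegInvGlue (deriv expNegInvGlue (b - t)) (b - t) :=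
    ((expNegInvGlue.contDiff (n := 1)).differentiable (by simp) _).hasDerivAt
  have h1 : HasDerivAt (fun s => expNegInvGlue (b - s)) (-deriv expNegInvGlue (b - t)) t := by
    have := hg.comp t ((hasDerivAt_id t).const_sub b)
    rwa [mul_neg_one] at this
  have h2 : HasDerivAt (fun s => Real.exp (-(c * s))) (Real.exp (-(c * t)) * -c) t := by
    simpa using (((hasDerivAt_id t).const_mul c).neg).exp
  have h3 : deriv (timeWeight c b) t = Real.exp (-(c * t)) * -c * expNegInvGlue (b - t) +
      Real.exp (-(c * t)) * -deriv expNegInvGlue (b - t) := (h2.mul h1).deriv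
  have h4 : 0 ≤ deriv expNegInvGlue (b - t) := expNegInvGlue.monotone.deriv_nonneg
  rw [h3, timeWeight]
  have := mul_nonneg (Real.exp_pos (-(c * t))).le h4
  linarith

theorem deriv_timeWeight_eq_zero {b t : ℝ} (c : ℝ) (h : b < t) :
    deriv (timeWeight c b) t = 0 := by
  have : timeWeight c b =ᶠ[𝓝 t] fun _ => 0 := by
    filter_upwards [lt_mem_nhds h] with s hs
    exact timeWeight_eq_zero c hs.le
  rw [this.deriv_eq, deriv_const]

end TimeWeight

/-! ### The relative entropy inequality and the comparison of total entropies. -/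

section Comparison

variable {d n N : ℕ} {T τ : ℝ} {L : DiffOp d n N}
  {F : EuclideanSpace ℝ (Fin n) → Matrix (Fin N) (Fin N) ℝ}
  {v₀ : (Fin d → ℝ) → EuclideanSpace ℝ (Fin n)}
  {v D : ℝ × (Fin d → ℝ) → EuclideanSpace ℝ (Fin n)}
  {G : ℝ × (Fin d → ℝ) → Matrix (Fin N) (Fin N) ℝ} {C : ℝ}

/-- Here `a` and `b` stand for `θ'` and `θ`, and `Q` for `L^*(v^#)`. Apply `Λ`-convexity at `x` and
`F(y) ≤ A`, both in the direction `P = -a I + 2b Q`. Its flux gradient at `x` is `-2` times the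
vector `a x^# - b (Q : ∂_l F(x))_l` on the right, so linear terms cancel and the trace part of `P`
leaves the entropy difference. -/
theorem StandingAssumptions.relative_entropy_le (h : StandingAssumptions L F)
    {a b C : ℝ} {Q A : Matrix (Fin N) (Fin N) ℝ} (hQ : Q ∈ L.Lam) (hC : ∀ l m, |Q l m| ≤ C)
    (hb : 0 ≤ b) (hab : a ≤ -((2 * N * C + 1) * b)) (x y : EuclideanSpace ℝ (Fin n))
    (hA : LambdaNonneg L.Lam (A - F y)) :
    a * ((1 / 2) * frob (A - F 0) 1 - entropy F x) ≤
      inner ℝ (y - x) (a • sharp F x + b • -fluxGrad F Q x) + frob (A - F x) (b • Q) := by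
  set P : Matrix (Fin N) (Fin N) ℝ := (-a) • 1 + (2 * b) • Q with hPdef
  have hPL : P ∈ L.Lam :=
    L.Lam.add_mem (L.Lam.smul_mem _ DiffOp.one_mem_Lam) (L.Lam.smul_mem _ hQ)
  have hPpos : P.PosSemidef := by
    -- The entries of `2b Q` are at most `2 b C`, so `-a ≥ 2 N C b` suffices; the extra `b` in the
    -- hypothesis is not needed for positivity.
    refine posSemidef_smul_one_add (C := 2 * b * C) ((DiffOp.isSymm_of_mem_Lam hQ).smul _)
      (fun l m => ?_) (by nlinarith)
    rw [Matrix.smul_apply, smul_eq_mul, abs_mul, abs_of_nonneg (by positivity : 0 ≤ 2 * b)]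
    exact mul_le_mul_of_nonneg_left (hC l m) (by positivity)
  have h1 := h.inner_fluxGrad_le hPL hPpos x y
  have h2 := hA.2 P hPL hPpos
  have h3 : fluxGrad F P x = (-2 * a) • sharp F x + (2 * b) • fluxGrad F Q x := by
    rw [hPdef, fluxGrad_add, fluxGrad_smul, fluxGrad_smul, h.fluxGrad_one, smul_smul]
    congr 2
    ring
  rw [h3, real_inner_comm, inner_add_right, real_inner_smul_right, real_inner_smul_right] at h1
  rw [inner_add_right, real_inner_smul_right, real_inner_smul_right, inner_neg_right,
    frob_smul_right, frob_sub_left, frob_sub_left, frob_one, frob_one, entropy,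
    Matrix.trace_sub]
  rw [hPdef] at h1 h2
  simp only [frob_sub_left, frob_add_right, frob_smul_right, frob_one, Matrix.trace_sub] at h1 h2
  linarith

theorem MemOrlicz.mono_cylinder {K : EuclideanSpace ℝ (Fin n) → ℝ}
    {y : ℝ × (Fin d → ℝ) → EuclideanSpace ℝ (Fin n)} (hτT : τ ≤ T)
    (hy : MemOrlicz K y (volume.restrict (cylinder d T))) :
    MemOrlicz K y (volume.restrict (cylinder d τ)) :=
  ⟨hy.1.mono_measure (Measure.restrict_mono_set volume (cylinder_mono d hτT)),
    IntegrableOn.mono_set hy.2 (cylinder_mono d hτT)⟩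

theorem MemOrlicz.comp_snd {K : EuclideanSpace ℝ (Fin n) → ℝ}
    (h : MemOrlicz K v₀ (volume.restrict (cell d))) (τ : ℝ) :
    MemOrlicz K (fun p : ℝ × (Fin d → ℝ) => v₀ p.2) (volume.restrict (cylinder d τ)) := by
  rw [volume_restrict_cylinder]
  exact ⟨h.1.comp_snd, h.2.comp_snd _⟩

/-- The pointwise relative entropy inequality is integrated over the cylinder; its right-hand side
is the difference of the weak identities for `(u,M)` and `v`, whose integral vanishes. -/
theorem RegularOn.integral_deriv_mul_entropy_le (h : StandingAssumptions L F)
    (r : RegularOn L F T τ v₀ v D G C) (hv : IsWeakSolution L F T v₀ v)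
    {u : ℝ × (Fin d → ℝ) → EuclideanSpace ℝ (Fin n)}
    {M : ℝ × (Fin d → ℝ) → Matrix (Fin N) (Fin N) ℝ} (huM : IsSubsolution L F T v₀ u M)
    (hτ : 0 < τ) (hτT : τ ≤ T) {b : ℝ} (hb : b < τ) :
    IntegrableOn (fun t => deriv (timeWeight (2 * N * C + 1) b) t *
      (subTotalEntropy F M t - totalEntropy F v t)) (Ioo 0 τ) ∧
    ∫ t in Ioo 0 τ, deriv (timeWeight (2 * N * C + 1) b) t *
      (subTotalEntropy F M t - totalEntropy F v t) ≤ 0 := by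
  set c : ℝ := 2 * N * C + 1
  have hθ := contDiff_timeWeight c b
  have hθb : ∀ t, b ≤ t → timeWeight c b t = 0 := fun t => timeWeight_eq_zero c
  have hK : Integrable (fun p => entropy F (v p)) (volume.restrict (cylinder d τ)) :=
    (r.mem.mono_cylinder hτT).2
  have hM : ∀ l m, Integrable (fun p => M p l m) (volume.restrict (cylinder d τ)) := fun l m =>
    IntegrableOn.mono_set (huM.memM l m) (cylinder_mono d hτT)
  have hMF : Integrable (fun p => frob (M p - F 0) 1) (volume.restrict (cylinder d τ)) := by
    unfold frob
    exact integrable_finsetSum _ fun l _ => integrable_finsetSum _ fun m _ =>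
      ((hM l m).sub (integrable_const _)).mul_const _
  have hv₀ := r.mem_initial.comp_snd τ
  have hvτ := r.mem.mono_cylinder hτT
  have huτ := huM.memu.mono_cylinder hτT
  have j1 := r.integrable_inner_testField h hτT hθ hvτ
  have j2 := r.integrable_inner_testField h hτT hθ huτ
  have j3 := r.integrable_inner_testField h hτT hθ hv₀
  have j4 := r.integrable_frob_flux h hτT hθ
  have j5 := r.integrable_frob hθ hM
  have k1 : Integrable (fun p => (inner ℝ (v p - v₀ p.2) (testField F v D (timeWeight c b) p) : ℝ) +
      frob (F (v p)) (timeWeight c b p.1 • G p)) (volume.restrict (cylinder d τ)) := by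
    simp only [inner_sub_left]
    exact (j1.sub j3).add j4
  have k2 : Integrable (fun p => (inner ℝ (u p - v₀ p.2) (testField F v D (timeWeight c b) p) : ℝ) +
      frob (M p) (timeWeight c b p.1 • G p)) (volume.restrict (cylinder d τ)) := by
    simp only [inner_sub_left]
    exact (j2.sub j3).add j5
  have e1 := r.integral_eq_zero h hτ hτT hθ hb hθb hv.weak
  have e2 := r.integral_eq_zero h hτ hτT hθ hb hθb huM.weak
  obtain ⟨B, hB⟩ := isCompact_Icc.exists_bound_of_continuousOn
    ((hθ.continuous_deriv (by simp)).continuousOn (s := Icc 0 τ))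
  have i0 : Integrable (fun p : ℝ × (Fin d → ℝ) =>
      (1 / 2) * frob (M p - F 0) 1 - entropy F (v p)) (volume.restrict (cylinder d τ)) :=
    (hMF.const_mul _).sub hK
  have i1 : Integrable (fun p : ℝ × (Fin d → ℝ) => deriv (timeWeight c b) p.1 *
      ((1 / 2) * frob (M p - F 0) 1 - entropy F (v p))) (volume.restrict (cylinder d τ)) := by
    refine i0.bdd_mul (c := B)
      ((hθ.continuous_deriv (by simp)).comp continuous_fst).aestronglyMeasurable ?_
    filter_upwards [ae_mem_cylinder d τ] with p hp
    exact hB _ (Ioo_subset_Icc_self hp.1)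
  have hle : ∫ p in cylinder d τ, deriv (timeWeight c b) p.1 *
      ((1 / 2) * frob (M p - F 0) 1 - entropy F (v p)) ≤ 0 := by
    rw [← sub_zero (0 : ℝ)]
    nth_rewrite 1 [← e2]
    rw [← e1, ← integral_sub k2 k1]
    refine integral_mono_ae i1 (k2.sub k1) ?_
    filter_upwards [r.deriv_eq, r.abs_adj_le, r.adj_mem, ae_of_ae_cylinder hτT huM.le] with
      p hp hpC hpL hpM
    have := h.relative_entropy_le hpL hpC (timeWeight_nonneg c b p.1)
      (deriv_timeWeight_le c b p.1) (v p) (u p) hpM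
    refine this.trans (le_of_eq ?_)
    simp only [testField, hp, inner_sub_left, frob_sub_left]
    ring
  have i1' := i1
  rw [volume_restrict_cylinder] at i1'
  have hsl : ∀ᵐ t ∂(volume.restrict (Ioo 0 τ)), ∫ x in cell d, deriv (timeWeight c b) t *
      ((1 / 2) * frob (M (t, x) - F 0) 1 - entropy F (v (t, x))) =
      deriv (timeWeight c b) t * (subTotalEntropy F M t - totalEntropy F v t) := by
    filter_upwards [ae_integrable_slice hMF, ae_integrable_slice hK] with t h1 h2
    rw [integral_const_mul, integral_sub (h1.const_mul _) h2, integral_const_mul]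
    rfl
  refine ⟨i1'.integral_prod_left.congr hsl, ?_⟩
  rw [← integral_congr_ae hsl, ← integral_cylinder i1]
  exact hle

theorem IsStrongSolution.not_entropy_lt {κ : ℝ → ℝ} (h : StandingAssumptions L F)
    (hκ : IsWeight T κ) (hv₀ : MemOrlicz (entropy F) v₀ (volume.restrict (cell d)))
    (hv : IsStrongSolution L F T κ v₀ v)
    {u : ℝ × (Fin d → ℝ) → EuclideanSpace ℝ (Fin n)}
    {M : ℝ × (Fin d → ℝ) → Matrix (Fin N) (Fin N) ℝ} (huM : IsSubsolution L F T v₀ u M)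
    {t₀ t₁ : ℝ} (h0 : 0 ≤ t₀) (h01 : t₀ < t₁) (h1T : t₁ ≤ T)
    (hle : ∀ᵐ t : ℝ, t ∈ Ioo 0 t₁ → subTotalEntropy F M t ≤ totalEntropy F v t)
    (hlt : ∀ᵐ t : ℝ, t ∈ Ioo t₀ t₁ → subTotalEntropy F M t < totalEntropy F v t) : False := by
  -- The weight is switched off inside `(t₀, t₁)`, and `τ` is put between `b` and `T`, because the
  -- regularity of the strong solution is available only before `T`, even when `t₁ = T`.
  set b := (t₀ + t₁) / 2 with hbdef
  have hb0 : t₀ < b := by linarith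
  have hb1 : b < t₁ := by linarith
  set τ := (b + T) / 2 with hτdef
  have hbτ : b < τ := by linarith
  have hτT : τ < T := by linarith
  have hτ : 0 < τ := by linarith
  obtain ⟨D, G, C, r⟩ := hv.exists_regularOn h hκ hv₀ hτ hτT
  obtain ⟨hi, hint⟩ := r.integral_deriv_mul_entropy_le h hv.weak huM hτ hτT.le hbτ
  set c : ℝ := 2 * N * C + 1 with hc
  -- The summand 1 in the rate keeps it positive even if `C = 0`, so that the weight is strictly
  -- decreasing before `b`.
  have hc0 : 0 < c := by have := r.bound_nonneg; positivity
  have hneg : ∀ t, t < b → deriv (timeWeight c b) t < 0 := fun t ht => by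
    have := deriv_timeWeight_le c b t
    have := mul_pos hc0 (timeWeight_pos c ht)
    linarith
  have hb_ne : ∀ᵐ t : ℝ, t ≠ b := by
    rw [ae_iff]
    simp
  -- Before `b` two nonpositive factors are multiplied; after `b` the derivative of the weight
  -- vanishes, so nothing is required of the entropies there.
  have hnn : ∀ᵐ t ∂(volume.restrict (Ioo 0 τ)), 0 ≤ deriv (timeWeight c b) t *
      (subTotalEntropy F M t - totalEntropy F v t) := by
    rw [ae_restrict_iff' measurableSet_Ioo]
    filter_upwards [hle, hb_ne] with t ht htb htm
    rcases lt_or_gt_of_ne htb with hlt | hgt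
    · exact mul_nonneg_of_nonpos_of_nonpos (hneg t hlt).le
        (sub_nonpos.2 (ht ⟨htm.1, hlt.trans hb1⟩))
    · rw [deriv_timeWeight_eq_zero c hgt, zero_mul]
  have hz := (integral_eq_zero_iff_of_nonneg_ae hnn hi).1
    (le_antisymm hint (integral_nonneg_of_ae hnn))
  have hz' := (ae_restrict_iff' measurableSet_Ioo).1 hz
  have hfalse : ∀ᵐ t : ℝ, t ∉ Ioo t₀ b := by
    filter_upwards [hz', hlt] with t h1 h2 ht
    have e := h1 ⟨h0.trans_lt ht.1, ht.2.trans hbτ⟩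
    have p := mul_pos_of_neg_of_neg (hneg t ht.2) (sub_neg.2 (h2 ⟨ht.1, ht.2.trans hb1⟩))
    exact p.ne' e
  have hv0 : volume (Ioo t₀ b) = 0 := measure_eq_zero_iff_ae_notMem.2 hfalse
  rw [Real.volume_Ioo, ENNReal.ofReal_eq_zero] at hv0
  linarith

end Comparison

/-! ### Formal conservativity for nonsmooth fields -/

section Conservativity

/-- Dominated convergence with majorants that vary but converge in `L¹`. -/
theorem tendsto_integral_of_dominated_of_tendsto {X : Type*} [MeasurableSpace X] {μ : Measure X}
    {f g : ℕ → X → ℝ} {f' g' : X → ℝ} (hf : ∀ k, AEStronglyMeasurable (f k) μ)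
    (hg : ∀ k, Integrable (g k) μ) (hg' : Integrable g' μ) (hfg : ∀ k, ∀ᵐ x ∂μ, |f k x| ≤ g k x)
    (hfg' : ∀ᵐ x ∂μ, |f' x| ≤ g' x) (hlim : ∀ᵐ x ∂μ, Tendsto (fun k => f k x) atTop (𝓝 (f' x)))
    (hL : Tendsto (fun k => ∫ x, |g k x - g' x| ∂μ) atTop (𝓝 0)) :
    Tendsto (fun k => ∫ x, f k x ∂μ) atTop (𝓝 (∫ x, f' x ∂μ)) := by
  -- Clipping `f k` to `[-g', g']` reduces to a fixed majorant; what is cut off is at most `|g k -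
  -- g'|`.
  set c : ℕ → X → ℝ := fun k x => max (-g' x) (min (f k x) (g' x)) with hc
  have hcm : ∀ k, AEStronglyMeasurable (c k) μ := fun k =>
    hg'.aestronglyMeasurable.neg.sup ((hf k).inf hg'.aestronglyMeasurable)
  have hcb : ∀ k, ∀ᵐ x ∂μ, ‖c k x‖ ≤ g' x := fun k => by
    filter_upwards [hfg'] with x hx
    have h0 : 0 ≤ g' x := (abs_nonneg _).trans hx
    exact abs_le.2 ⟨le_max_left _ _, max_le (by linarith) (min_le_right _ _)⟩
  have hclim : Tendsto (fun k => ∫ x, c k x ∂μ) atTop (𝓝 (∫ x, f' x ∂μ)) := by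
    refine tendsto_integral_of_dominated_convergence g' hcm hg' hcb ?_
    filter_upwards [hlim, hfg'] with x hx hx'
    have h1 := (hx.min (tendsto_const_nhds (x := g' x))).max (tendsto_const_nhds (x := -g' x))
    have h2 := abs_le.1 hx'
    rw [min_eq_left h2.2, max_eq_left h2.1] at h1
    simpa only [hc, max_comm] using h1
  have hci : ∀ k, Integrable (c k) μ := fun k => hg'.mono' (hcm k) (hcb k)
  have hfi : ∀ k, Integrable (f k) μ := fun k => (hg k).mono' (hf k) (hfg k)
  have hdiff : Tendsto (fun k => ∫ x, (f k x - c k x) ∂μ) atTop (𝓝 0) := by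
    refine squeeze_zero_norm (fun k => ?_) hL
    refine norm_integral_le_of_norm_le ((hg k).sub hg').abs ?_
    filter_upwards [hfg k, hfg'] with x hx hx'
    have h0 : 0 ≤ g' x := (abs_nonneg _).trans hx'
    have h1 := abs_le.1 hx
    rw [Real.norm_eq_abs]
    simp only [hc]
    rcases le_total (f k x) (g' x) with h2 | h2
    · rw [min_eq_left h2]
      rcases le_total (-g' x) (f k x) with h3 | h3
      · rw [max_eq_right h3, sub_self, abs_zero]
        exact abs_nonneg _
      · rw [max_eq_left h3, abs_of_nonpos (by linarith)]
        exact le_trans (by linarith) (le_abs_self _)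
    · rw [min_eq_right h2, max_eq_right (by linarith), abs_of_nonneg (by linarith)]
      exact le_trans (by linarith) (le_abs_self _)
  have := hdiff.add hclim
  rw [zero_add] at this
  refine this.congr fun k => ?_
  rw [integral_sub (hfi k) (hci k), sub_add_cancel]

variable {d n N : ℕ} {T τ : ℝ} {L : DiffOp d n N}
  {F : EuclideanSpace ℝ (Fin n) → Matrix (Fin N) (Fin N) ℝ}

theorem abs_mollify_torusKer_le_of_ae {g : (Fin d → ℝ) → ℝ} {C : ℝ} (hC0 : 0 ≤ C)
    (hC : ∀ᵐ y ∂(volume.restrict (cell d)), |g y| ≤ C) (k : ℕ) (x : Fin d → ℝ) :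
    |mollify (torusKer d k) g x| ≤ C := by
  have e : mollify (torusKer d k) g x =
      mollify (torusKer d k) (fun y => max (-C) (min (g y) C)) x := by
    refine integral_congr_ae ?_
    filter_upwards [hC] with y hy
    have := abs_le.1 hy
    rw [min_eq_left this.2, max_eq_right this.1]
  rw [e]
  exact abs_mollify_torusKer_le (fun y =>
    abs_le.2 ⟨le_max_left _ _, max_le (by linarith) (min_le_right _ _)⟩) k x

/-- With `V` the inverse of `∇K` and `z k` the mollified `v^#`, the field `V (z k)` has a smooth
sharp image, so formal conservativity applies to it. In the limit, the mollified `G` stays bounded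
by `C`, and `K(V(z k))` is controlled by `K^*(z k) + 1`, hence by the mollification of `K^*(v^#)`
plus a constant. These majorants converge in `L¹`. -/
theorem StandingAssumptions.integral_frob_eq_zero (h : StandingAssumptions L F)
    {v : (Fin d → ℝ) → EuclideanSpace ℝ (Fin n)} {G : (Fin d → ℝ) → Matrix (Fin N) (Fin N) ℝ}
    {C : ℝ} (hC0 : 0 ≤ C) (hv : MemOrlicz (entropy F) v (volume.restrict (cell d)))
    (hG : ∀ l m, Integrable (fun x => G x l m) (volume.restrict (cell d)))
    (hGC : ∀ᵐ x ∂(volume.restrict (cell d)), ∀ l m, |G x l m| ≤ C)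
    (hGL : ∀ᵐ x ∂(volume.restrict (cell d)), G x ∈ L.Lam)
    (hadj : ∀ k x, mollifyMat (torusKer d k) G x =
      L.adj (mollifyVec (torusKer d k) (fun y => sharp F (v y))) x) :
    ∫ x in cell d, frob (F (v x)) (G x) = 0 := by
  obtain ⟨V, hVc, hV, hV'⟩ := exists_continuous_gradient_inverse h.nFunction h.strictConvex
    (h.contDiff_entropy.of_le one_le_two)
  obtain ⟨C₁, hC₁0, hC₁⟩ := le_legendre_gradient h.nFunction h.deltaTwo_legendre
    h.differentiable_entropy
  obtain ⟨C₂, -, hC₂⟩ := legendre_gradient_le h.nFunction h.deltaTwo h.differentiable_entropy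
  set w : (Fin d → ℝ) → EuclideanSpace ℝ (Fin n) := fun x => sharp F (v x) with hw
  have hwi : Integrable w (volume.restrict (cell d)) := hv.integrable_sharp h
  have hKw : Integrable (fun x => legendre (entropy F) (w x)) (volume.restrict (cell d)) := by
    refine ((hv.2.add (integrable_const 1)).const_mul C₂).mono'
      (h.nFunction.continuous_legendre.comp_aestronglyMeasurable hwi.aestronglyMeasurable)
      (Eventually.of_forall fun x => ?_)
    rw [Real.norm_of_nonneg (h.nFunction.legendre_nonneg _)]
    exact hC₂ (v x)
  obtain ⟨φ, hφ, hlim⟩ := exists_seq_tendsto_mollify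
    (g := Sum.elim (fun (i : Fin n) x => w x i)
      (fun (j : Fin N × Fin N) x => G x j.1 j.2)) (by
    rintro (i | j)
    · exact integrable_euclidean_apply hwi i
    · exact hG j.1 j.2)
  set z : ℕ → (Fin d → ℝ) → EuclideanSpace ℝ (Fin n) := fun k => mollifyVec (torusKer d k) w
  have hVs : ∀ k x, sharp F (V (z k x)) = z k x := fun k x => hV _
  have hz : ∀ k, SmoothVec (z k) := fun k => smoothVec_mollifyVec (smoothPer_torusKer d k) hwi
  have hzc : ∀ k, Continuous (z k) := fun k =>
    (contDiff_euclidean.2 fun i => (hz k i).1 : ContDiff ℝ ∞ (z k)).continuous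
  have hzero : ∀ k, ∫ x in cell d, frob (F (V (z k x))) (mollifyMat (torusKer d k) G x) = 0 :=
    fun k => by
      have := h.conservative (fun x => V (z k x)) (by simp only [hVs]; exact hz k)
      simp only [hVs] at this
      rw [← this]
      simp only [hadj k]
      rfl
  have hbd : ∀ (Q : Matrix (Fin N) (Fin N) ℝ) (x : EuclideanSpace ℝ (Fin n)) (a : ℝ), Q ∈ L.Lam →
      (∀ l m, |Q l m| ≤ C) → legendre (entropy F) (sharp F x) ≤ a →
      |frob (F x) Q| ≤ N * C * (2 * C₁) * a + N * C * (2 * C₁ + (F 0).trace) := by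
    intro Q x a hQ hQC ha
    refine (h.abs_frob_le hQ hQC x).trans ?_
    have h1 : entropy F x ≤ C₁ * (a + 1) :=
      (hC₁ x).trans (mul_le_mul_of_nonneg_left (by gcongr; exact ha) hC₁0)
    have h2 : N * C * (2 * entropy F x + (F 0).trace) ≤
        N * C * (2 * (C₁ * (a + 1)) + (F 0).trace) := by gcongr
    linarith
  have ht := tendsto_integral_of_dominated_of_tendsto (μ := volume.restrict (cell d))
    (f := fun k x => frob (F (V (z (φ k) x))) (mollifyMat (torusKer d (φ k)) G x))
    (f' := fun x => frob (F (v x)) (G x))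
    (g := fun k x => N * C * (2 * C₁) *
      mollify (torusKer d (φ k)) (fun y => legendre (entropy F) (w y)) x +
        N * C * (2 * C₁ + (F 0).trace))
    (g' := fun x => N * C * (2 * C₁) * legendre (entropy F) (w x) +
        N * C * (2 * C₁ + (F 0).trace)) ?_ ?_ ?_ ?_ ?_ ?_ ?_
  · refine tendsto_nhds_unique ht ?_
    simp only [hzero]
    exact tendsto_const_nhds
  · refine fun k => aestronglyMeasurable_frob (fun l m => ?_) fun l m => ?_
    · exact ((h.continuous_apply l m).comp (hVc.comp (hzc _))).aestronglyMeasurable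
    · exact (continuous_mollify (smoothPer_torusKer d _) (hG l m)).aestronglyMeasurable
  · exact fun k => ((integrable_mollify (smoothPer_torusKer d _) hKw).const_mul _).add
      (integrable_const _)
  · exact (hKw.const_mul _).add (integrable_const _)
  · refine fun k => Eventually.of_forall fun x => hbd _ _ _ ?_ (fun l m => ?_) ?_
    · rw [hadj]
      exact DiffOp.adj_mem_Lam (hz _) x
    · exact abs_mollify_torusKer_le_of_ae hC0 (hGC.mono fun y hy => hy l m) _ x
    · rw [hVs]
      exact legendre_mollifyVec_le h.nFunction hwi hKw _ x
  · filter_upwards [hGC, hGL] with x hx hx'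
    exact hbd _ _ _ hx' hx le_rfl
  · filter_upwards [hlim] with x hx
    have h1 : Tendsto (fun k => z (φ k) x) atTop (𝓝 (w x)) := by
      have : Tendsto (fun k => WithLp.ofLp (z (φ k) x)) atTop (𝓝 (WithLp.ofLp (w x))) :=
        tendsto_pi_nhds.2 fun i => hx (Sum.inl i)
      exact ((PiLp.continuous_toLp 2 _).tendsto _).comp this
    have h2 : Tendsto (fun k => V (z (φ k) x)) atTop (𝓝 (v x)) := by
      have := (hVc.tendsto (w x)).comp h1
      rwa [show V (w x) = v x from hV' (v x)] at this
    unfold frob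
    exact tendsto_finsetSum _ fun l _ => tendsto_finsetSum _ fun m _ =>
      (((h.continuous_apply l m).tendsto _).comp h2).mul (hx (Sum.inr (l, m)))
  · have := ((tendsto_integral_abs_mollify_sub hKw).comp hφ.tendsto_atTop).const_mul
      |N * C * (2 * C₁)|
    rw [mul_zero] at this
    refine this.congr fun k => ?_
    simp only [Function.comp_apply]
    rw [← integral_const_mul]
    refine integral_congr_ae (Eventually.of_forall fun x => ?_)
    simp only
    rw [add_sub_add_right_eq_sub, ← mul_sub]
    exact (abs_mul _ _).symm

variable {v₀ : (Fin d → ℝ) → EuclideanSpace ℝ (Fin n)}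
  {v D : ℝ × (Fin d → ℝ) → EuclideanSpace ℝ (Fin n)}
  {G : ℝ × (Fin d → ℝ) → Matrix (Fin N) (Fin N) ℝ} {C : ℝ}

theorem ae_slice_of_ae {P : ℝ × (Fin d → ℝ) → Prop}
    (h : ∀ᵐ p ∂(volume.restrict (cylinder d τ)), P p) :
    ∀ᵐ t ∂(volume.restrict (Ioo 0 τ)), ∀ᵐ x ∂(volume.restrict (cell d)), P (t, x) := by
  rw [volume_restrict_cylinder] at h
  exact Measure.ae_ae_of_ae_prod h

theorem MemOrlicz.ae_slice {K : EuclideanSpace ℝ (Fin n) → ℝ}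
    (hv : MemOrlicz K v (volume.restrict (cylinder d τ))) :
    ∀ᵐ t ∂(volume.restrict (Ioo 0 τ)),
      MemOrlicz K (fun x => v (t, x)) (volume.restrict (cell d)) := by
  have h1 := hv.1
  rw [volume_restrict_cylinder] at h1
  filter_upwards [h1.prodMk_left, ae_integrable_slice hv.2] with t ht ht'
  exact ⟨ht, ht'⟩

theorem RegularOn.ae_integral_frob_eq_zero (h : StandingAssumptions L F)
    (r : RegularOn L F T τ v₀ v D G C) (hτ : 0 < τ) (hτT : τ ≤ T) :
    ∀ᵐ t ∂(volume.restrict (Ioo 0 τ)), ∫ x in cell d, frob (F (v (t, x))) (G (t, x)) = 0 := by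
  have hGs : ∀ᵐ t ∂(volume.restrict (Ioo 0 τ)), ∀ l m,
      Integrable (fun x => G (t, x) l m) (volume.restrict (cell d)) :=
    ae_all_iff.2 fun l => ae_all_iff.2 fun m => ae_integrable_slice (r.integrable_adj l m)
  filter_upwards [hGs, (r.mem.mono_cylinder hτT).ae_slice, ae_slice_of_ae r.abs_adj_le,
    ae_slice_of_ae r.adj_mem, r.weakAdj.ae_slice hτ hτT r.integrable_sharp r.integrable_adj] with
    t h1 h2 h3 h4 h5
  exact h.integral_frob_eq_zero r.bound_nonneg h2 h1 h3 h4 h5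

end Conservativity

/-! ### The chain rule for the Legendre transform along absolutely continuous curves -/

section Chain

/-- Subdivide `[0,t]` into equal pieces shorter than `δ` and sum the increments: the total is at
most `ε ∫ g`, for every `ε`. -/
theorem eq_of_abs_sub_le_mul_integral {f g : ℝ → ℝ} {t : ℝ} (ht : 0 ≤ t)
    (hg : IntervalIntegrable g volume 0 t)
    (h : ∀ ε > 0, ∃ δ > 0, ∀ a b, 0 ≤ a → a ≤ b → b ≤ t → b - a < δ →
      |f b - f a| ≤ ε * ∫ s in a..b, g s) : f t = f 0 := by
  set I := ∫ s in (0)..t, g s with hI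
  have key : ∀ ε > 0, |f t - f 0| ≤ ε * I := by
    intro ε hε
    obtain ⟨δ, hδ, hδ'⟩ := h ε hε
    obtain ⟨m, hm⟩ := exists_nat_gt (t / δ)
    have hm0 : (0 : ℝ) < m := (div_nonneg ht hδ.le).trans_lt hm
    have hm1 : m ≠ 0 := by
      rintro rfl
      simp at hm0
    set a : ℕ → ℝ := fun i => i * t / m with ha
    have ha0 : a 0 = 0 := by simp [ha]
    have ham : a m = t := by
      simp only [ha]
      field_simp
    have hmono : Monotone a := fun i j hij => by
      simp only [ha]
      gcongr
    have hmem : ∀ i ≤ m, a i ∈ Icc 0 t := fun i hi =>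
      ⟨ha0 ▸ hmono (Nat.zero_le i), ham ▸ hmono hi⟩
    have hsum : f t - f 0 = ∑ i ∈ Finset.range m, (f (a (i + 1)) - f (a i)) := by
      rw [Finset.sum_range_sub (fun i => f (a i)), ham, ha0]
    have hint : ∑ i ∈ Finset.range m, ∫ s in a i..a (i + 1), g s = I := by
      rw [intervalIntegral.sum_integral_adjacent_intervals fun i hi => ?_, ham, ha0]
      refine hg.mono_set ?_
      rw [uIcc_of_le (hmono (Nat.le_succ i)), uIcc_of_le ht]
      exact Icc_subset_Icc (hmem i hi.le).1 (hmem (i + 1) hi).2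
    rw [hsum, ← hint, Finset.mul_sum]
    refine (Finset.abs_sum_le_sum_abs _ _).trans (Finset.sum_le_sum fun i hi => ?_)
    have hi' := Finset.mem_range.1 hi
    refine hδ' _ _ (hmem i hi'.le).1 (hmono (Nat.le_succ i)) (hmem (i + 1) hi').2 ?_
    have : a (i + 1) - a i = t / m := by
      simp only [ha]
      push_cast
      ring
    rw [this, div_lt_iff₀ hm0]
    rwa [div_lt_iff₀ hδ, mul_comm] at hm
  have hlim : Tendsto (fun ε : ℝ => ε * I) (𝓝[>] 0) (𝓝 0) := by
    have : Tendsto (fun ε : ℝ => ε * I) (𝓝 0) (𝓝 (0 * I)) :=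
      (continuous_id.mul continuous_const).tendsto 0
    rw [zero_mul] at this
    exact this.mono_left nhdsWithin_le_nhds
  have h0 : |f t - f 0| ≤ 0 := ge_of_tendsto hlim (by
    filter_upwards [self_mem_nhdsWithin] with ε hε
    exact key ε hε)
  exact sub_eq_zero.1 (abs_eq_zero.1 (le_antisymm h0 (abs_nonneg _)))

variable {n : ℕ} {K : EuclideanSpace ℝ (Fin n) → ℝ}

theorem integral_inner_const_left {a b : ℝ} {D : ℝ → EuclideanSpace ℝ (Fin n)}
    (hD : IntervalIntegrable D volume a b) (c : EuclideanSpace ℝ (Fin n)) :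
    ∫ s in a..b, (inner ℝ c (D s) : ℝ) = inner ℝ c (∫ s in a..b, D s) :=
  (innerSL ℝ c).intervalIntegral_comp_comm hD

/-- Chain rule `d/ds K^*(W) = V(W)·W'` for absolutely continuous `W`. Differentiability of `K^*` is
not invoked: the subgradient inequalities at both ends of a short interval enclose the increment,
and uniform continuity of `V ∘ W` makes the enclosure `ε`-tight. -/
theorem legendre_add_integral_sub (hK : IsNFunction K) (hd : Differentiable ℝ K)
    {V : EuclideanSpace ℝ (Fin n) → EuclideanSpace ℝ (Fin n)} (hV : Continuous V)
    (hVK : ∀ z, gradient K (V z) = z) {t : ℝ} (ht : 0 ≤ t)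
    {D : ℝ → EuclideanSpace ℝ (Fin n)} (hD : IntervalIntegrable D volume 0 t)
    (w₀ : EuclideanSpace ℝ (Fin n)) :
    legendre K (w₀ + ∫ s in (0)..t, D s) - legendre K w₀ =
      ∫ s in (0)..t, inner ℝ (V (w₀ + ∫ r in (0)..s, D r)) (D s) := by
  set W : ℝ → EuclideanSpace ℝ (Fin n) := fun s => w₀ + ∫ r in (0)..s, D r with hW
  have hsub : ∀ a b, 0 ≤ a → a ≤ b → b ≤ t → IntervalIntegrable D volume a b :=
    fun a b ha hab hb => hD.mono_set (by
      rw [uIcc_of_le hab, uIcc_of_le ht]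
      exact Icc_subset_Icc ha hb)
  have hWc : ContinuousOn W (Icc 0 t) := by
    have := intervalIntegral.continuousOn_primitive_interval (μ := volume) (f := D) (a := 0)
      (b := t) (by rwa [uIcc_of_le ht, ← intervalIntegrable_iff_integrableOn_Icc_of_le ht])
    rw [uIcc_of_le ht] at this
    exact continuousOn_const.add this
  have hxc : ContinuousOn (fun s => V (W s)) (Icc 0 t) := hV.comp_continuousOn hWc
  have hxi : IntervalIntegrable (fun s => (inner ℝ (V (W s)) (D s) : ℝ)) volume 0 t := by
    obtain ⟨B, hB⟩ := isCompact_Icc.exists_bound_of_continuousOn hxc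
    rw [intervalIntegrable_iff_integrableOn_Icc_of_le ht] at hD ⊢
    refine (hD.norm.const_mul B).mono'
      ((hxc.aestronglyMeasurable measurableSet_Icc).inner hD.aestronglyMeasurable) ?_
    filter_upwards [ae_restrict_mem measurableSet_Icc] with s hs
    exact (norm_inner_le_norm _ _).trans (mul_le_mul_of_nonneg_right (hB s hs) (norm_nonneg _))
  have hxsub : ∀ a b, 0 ≤ a → a ≤ b → b ≤ t →
      IntervalIntegrable (fun s => (inner ℝ (V (W s)) (D s) : ℝ)) volume a b :=
    fun a b ha hab hb => hxi.mono_set (by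
      rw [uIcc_of_le hab, uIcc_of_le ht]
      exact Icc_subset_Icc ha hb)
  have hWsub : ∀ a b, 0 ≤ a → a ≤ b → b ≤ t → W b - W a = ∫ s in a..b, D s :=
    fun a b ha hab hb => by
      simp only [hW]
      rw [add_sub_add_left_eq_sub, intervalIntegral.integral_interval_sub_left
        (hsub 0 b le_rfl (ha.trans hab) hb) (hsub 0 a le_rfl ha (hab.trans hb))]
  have key := eq_of_abs_sub_le_mul_integral (t := t)
    (f := fun b => legendre K (W b) - ∫ s in (0)..b, inner ℝ (V (W s)) (D s))
    (g := fun s => ‖D s‖) ht hD.norm fun ε hε => by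
      have huc := isCompact_Icc.uniformContinuousOn_of_continuous hxc
      obtain ⟨δ, hδ, hδ'⟩ := Metric.uniformContinuousOn_iff_le.1 huc ε hε
      refine ⟨δ, hδ, fun a b ha hab hb hba => ?_⟩
      have e0 : (∫ s in (0)..b, (inner ℝ (V (W s)) (D s) : ℝ)) -
          ∫ s in (0)..a, (inner ℝ (V (W s)) (D s) : ℝ) =
          ∫ s in a..b, (inner ℝ (V (W s)) (D s) : ℝ) :=
        intervalIntegral.integral_interval_sub_left
          (hxsub 0 b le_rfl (ha.trans hab) hb) (hxsub 0 a le_rfl ha (hab.trans hb))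
      have hosc : ∀ c ∈ Icc a b, |inner ℝ (V (W c)) (W b - W a) -
          ∫ s in a..b, (inner ℝ (V (W s)) (D s) : ℝ)| ≤ ε * ∫ s in a..b, ‖D s‖ := by
        intro c hc
        have hDab := hsub a b ha hab hb
        have hci : IntervalIntegrable (fun s => (inner ℝ (V (W c)) (D s) : ℝ)) volume a b :=
          ⟨hDab.1.const_inner _, hDab.2.const_inner _⟩
        rw [hWsub a b ha hab hb, ← integral_inner_const_left hDab,
          ← intervalIntegral.integral_sub hci (hxsub a b ha hab hb),
          ← intervalIntegral.integral_const_mul, ← Real.norm_eq_abs]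
        refine intervalIntegral.norm_integral_le_of_norm_le hab (Eventually.of_forall
          fun s hs => ?_) (hDab.norm.const_mul ε)
        rw [← inner_sub_left]
        refine (norm_inner_le_norm _ _).trans (mul_le_mul_of_nonneg_right ?_ (norm_nonneg _))
        rw [← dist_eq_norm]
        refine hδ' c ⟨ha.trans hc.1, hc.2.trans hb⟩ s ⟨ha.trans hs.1.le, hs.2.trans hb⟩ ?_
        rw [Real.dist_eq, abs_le]
        constructor <;> linarith [hc.1, hc.2, hs.1, hs.2]
      -- Subgradient at the left end for the lower bound, at the right end for the upper bound.
      have h1 := legendre_add_inner_le hK hd (V (W a)) (W b)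
      have h2 := legendre_add_inner_le hK hd (V (W b)) (W a)
      rw [hVK] at h1 h2
      have h3 := (abs_le.1 (hosc a ⟨le_rfl, hab⟩)).1
      have h4 := (abs_le.1 (hosc b ⟨hab, le_rfl⟩)).2
      rw [← neg_sub (W b) (W a), inner_neg_right] at h2
      rw [abs_le]
      constructor <;> linarith
  simp only [hW, intervalIntegral.integral_same, sub_zero, add_zero] at key
  linarith

end Chain

/-! ### Conservation of the total entropy -/

section Conservation

variable {d n N : ℕ} {T τ : ℝ} {L : DiffOp d n N}
  {F : EuclideanSpace ℝ (Fin n) → Matrix (Fin N) (Fin N) ℝ}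
  {v₀ : (Fin d → ℝ) → EuclideanSpace ℝ (Fin n)}
  {v D : ℝ × (Fin d → ℝ) → EuclideanSpace ℝ (Fin n)}
  {G : ℝ × (Fin d → ℝ) → Matrix (Fin N) (Fin N) ℝ} {C : ℝ}

theorem ae_slice_of_ae' {P : ℝ × (Fin d → ℝ) → Prop}
    (h : ∀ᵐ p ∂(volume.restrict (cylinder d τ)), P p) :
    ∀ᵐ x ∂(volume.restrict (cell d)), ∀ᵐ t ∂(volume.restrict (Ioo 0 τ)), P (t, x) := by
  rw [volume_restrict_cylinder] at h
  exact Measure.ae_ae_of_ae_prod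
    (Measure.measurePreserving_swap.quasiMeasurePreserving.ae h)

theorem ae_integrable_slice' {E : Type*} [NormedAddCommGroup E] {f : ℝ × (Fin d → ℝ) → E}
    (hf : Integrable f (volume.restrict (cylinder d τ))) :
    ∀ᵐ x ∂(volume.restrict (cell d)),
      Integrable (fun t => f (t, x)) (volume.restrict (Ioo 0 τ)) := by
  rw [volume_restrict_cylinder] at hf
  exact hf.prod_left_ae

theorem intervalIntegrable_of_Ioo {E : Type*} [NormedAddCommGroup E] {f : ℝ → E}
    (hf : Integrable f (volume.restrict (Ioo 0 τ))) {t : ℝ} (ht : t ∈ Ioo 0 τ) :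
    IntervalIntegrable f volume 0 t := by
  rw [intervalIntegrable_iff_integrableOn_Ioo_of_le ht.1.le]
  exact IntegrableOn.mono_set hf (Ioo_subset_Ioo_right ht.2.le)

theorem intervalIntegral_eq_Ioo {E : Type*} [NormedAddCommGroup E] [NormedSpace ℝ E]
    (f : ℝ → E) {t : ℝ} (ht : 0 ≤ t) : ∫ s in (0)..t, f s = ∫ s in Ioo 0 t, f s := by
  rw [intervalIntegral.integral_of_le ht, integral_Ioc_eq_integral_Ioo]

theorem integral_cell_eq_of_ae {g : ℝ × (Fin d → ℝ) → ℝ}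
    (hg : Integrable g (volume.restrict (cylinder d τ))) {t : ℝ} (ht : t ∈ Ioo 0 τ)
    {Φ : (Fin d → ℝ) → ℝ}
    (h : ∀ᵐ x ∂(volume.restrict (cell d)), Φ x = ∫ s in (0)..t, g (s, x)) :
    ∫ x in cell d, Φ x = ∫ s in (0)..t, ∫ x in cell d, g (s, x) := by
  rw [integral_congr_ae h]
  simp only [intervalIntegral_eq_Ioo _ ht.1.le]
  have hgt : Integrable g (volume.restrict (cylinder d t)) :=
    IntegrableOn.mono_set hg (cylinder_mono d ht.2.le)
  rw [volume_restrict_cylinder] at hgt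
  exact (integral_integral_swap (f := fun s x => g (s, x)) hgt).symm

/-- The primitive of a measurable representative is a parametric integral of an indicator, hence
measurable; by Fubini it agrees almost everywhere with the primitive of `D`. -/
theorem aestronglyMeasurable_primitive
    (hD : Integrable D (volume.restrict (cylinder d τ))) :
    AEStronglyMeasurable (fun p : ℝ × (Fin d → ℝ) => ∫ s in (0)..p.1, D (s, p.2))
      (volume.restrict (cylinder d τ)) := by
  obtain ⟨D', hD', hDD'⟩ := hD.aestronglyMeasurable
  have hS : MeasurableSet {q : (ℝ × (Fin d → ℝ)) × ℝ | q.2 ∈ Ioo 0 q.1.1} :=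
    (measurableSet_lt measurable_const measurable_snd).inter
      (measurableSet_lt measurable_snd (measurable_fst.comp measurable_fst))
  have h1 : StronglyMeasurable ({q : (ℝ × (Fin d → ℝ)) × ℝ | q.2 ∈ Ioo 0 q.1.1}.indicator
      fun q => D' (q.2, q.1.2)) :=
    (hD'.comp_measurable (measurable_snd.prodMk (measurable_snd.comp measurable_fst))).indicator hS
  refine ⟨_, h1.integral_prod_right' (ν := volume), ?_⟩
  have h2 : ∀ᵐ p ∂(volume.restrict (cylinder d τ)),
      ∀ᵐ s ∂(volume.restrict (Ioo 0 τ)), D (s, p.2) = D' (s, p.2) := by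
    have := ae_slice_of_ae' hDD'
    rw [volume_restrict_cylinder]
    exact Measure.quasiMeasurePreserving_snd.ae this
  filter_upwards [h2, ae_mem_cylinder d τ] with p hp hpm
  rw [intervalIntegral_eq_Ioo _ hpm.1.1.le]
  have h3 : ∀ᵐ s ∂(volume.restrict (Ioo 0 p.1)), D (s, p.2) = D' (s, p.2) :=
    ae_mono (Measure.restrict_mono_set _ (Ioo_subset_Ioo_right hpm.1.2.le)) hp
  rw [integral_congr_ae h3, ← integral_indicator measurableSet_Ioo]
  rfl

/-- Obtaining the identity almost everywhere in space-time permits slicing in either order; the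
chain rule needs it at almost every `x` for almost every `t`. -/
theorem RegularOn.ae_sharp_eq (r : RegularOn L F T τ v₀ v D G C) (hτ : 0 < τ) (hτT : τ ≤ T) :
    ∀ᵐ p ∂(volume.restrict (cylinder d τ)),
      sharp F (v p) = sharp F (v₀ p.2) + ∫ s in (0)..p.1, D (s, p.2) := by
  have hm : AEStronglyMeasurable (fun p : ℝ × (Fin d → ℝ) =>
      sharp F (v p) - (sharp F (v₀ p.2) + ∫ s in (0)..p.1, D (s, p.2)))
      (volume.restrict (cylinder d τ)) := by
    refine r.integrable_sharp.aestronglyMeasurable.sub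
      (AEStronglyMeasurable.add ?_ (aestronglyMeasurable_primitive r.integrable_deriv))
    rw [volume_restrict_cylinder]
    exact r.integrable_sharp_initial.aestronglyMeasurable.comp_snd
  have h1 : ∀ᵐ t ∂(volume.restrict (Ioo 0 τ)), ∀ i, ∀ᵐ x ∂(volume.restrict (cell d)),
      sharp F (v (t, x)) i = sharp F (v₀ x) i + ∫ s in (0)..t, D (s, x) i :=
    ae_all_iff.2 fun i => r.timeDeriv.ae_slice hτ hτT r.integrable_sharp r.integrable_deriv
      r.integrable_sharp_initial r.initial i
  rw [volume_restrict_cylinder] at hm ⊢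
  have h2 := ae_prod_mem_of_ae_ae_mem hm (isClosed_singleton (x := 0)) (by
    filter_upwards [h1, ae_restrict_mem measurableSet_Ioo] with t ht htm
    filter_upwards [ae_all_iff.2 ht, ae_integrable_slice' r.integrable_deriv] with x hx hxD
    rw [mem_singleton_iff, sub_eq_zero]
    ext i
    rw [hx i, PiLp.add_apply]
    congr 1
    exact (EuclideanSpace.proj (𝕜 := ℝ) i).intervalIntegral_comp_comm
      (intervalIntegrable_of_Ioo hxD htm))
  filter_upwards [h2] with p hp
  exact sub_eq_zero.1 hp

theorem MemOrlicz.integrable_inner_sharp {X : Type*} [MeasurableSpace X] {μ : Measure X}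
    [IsFiniteMeasure μ] (h : StandingAssumptions L F) {x y : X → EuclideanSpace ℝ (Fin n)}
    (hx : MemOrlicz (entropy F) x μ) (hy : MemOrlicz (entropy F) y μ) :
    Integrable (fun p => inner ℝ (y p) (sharp F (x p))) μ := by
  obtain ⟨A, -, hA⟩ := h.nFunction.abs_inner_gradient_le h.deltaTwo h.differentiable_entropy
  refine (((hx.2.add hy.2).add (integrable_const 1)).const_mul A).mono'
    (hy.1.inner (hx.integrable_sharp h).aestronglyMeasurable) (Eventually.of_forall fun p => ?_)
  rw [real_inner_comm]
  exact hA (x p) (y p)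

theorem MemOrlicz.integrable_legendre_sharp {X : Type*} [MeasurableSpace X] {μ : Measure X}
    [IsFiniteMeasure μ] (h : StandingAssumptions L F) {x : X → EuclideanSpace ℝ (Fin n)}
    (hx : MemOrlicz (entropy F) x μ) :
    Integrable (fun p => legendre (entropy F) (sharp F (x p))) μ := by
  have : ∀ p, legendre (entropy F) (sharp F (x p)) =
      inner ℝ (x p) (sharp F (x p)) - entropy F (x p) := fun p =>
    legendre_gradient h.nFunction h.differentiable_entropy (x p)
  simp only [this]
  exact (hx.integrable_inner_sharp h hx).sub hx.2

theorem MemOrlicz.integral_entropy_eq {X : Type*} [MeasurableSpace X] {μ : Measure X}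
    [IsFiniteMeasure μ] (h : StandingAssumptions L F) {x : X → EuclideanSpace ℝ (Fin n)}
    (hx : MemOrlicz (entropy F) x μ) :
    ∫ p, entropy F (x p) ∂μ = ∫ p, inner ℝ (x p) (sharp F (x p)) ∂μ -
      ∫ p, legendre (entropy F) (sharp F (x p)) ∂μ := by
  rw [← integral_sub (hx.integrable_inner_sharp h hx) (hx.integrable_legendre_sharp h)]
  refine integral_congr_ae (Eventually.of_forall fun p => ?_)
  have := legendre_gradient h.nFunction h.differentiable_entropy (x p)
  simp only [sharp]
  linarith

theorem RegularOn.integrable_inner_deriv (h : StandingAssumptions L F)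
    (r : RegularOn L F T τ v₀ v D G C) (hτT : τ ≤ T)
    {y : ℝ × (Fin d → ℝ) → EuclideanSpace ℝ (Fin n)}
    (hy : MemOrlicz (entropy F) y (volume.restrict (cylinder d τ))) :
    Integrable (fun p => inner ℝ (y p) (D p)) (volume.restrict (cylinder d τ)) := by
  -- For `θ = 1` the test field is `D` itself.
  have := r.integrable_inner_testField h hτT (contDiff_const (c := (1 : ℝ))) hy
  simpa only [testField, deriv_const, zero_smul, one_smul, zero_add] using this

/-- The weak formulation of `v` against its own test pair; the flux term drops out by conservativity
on slices. What remains is a weak ODE in time with initial value zero, as `v - v₀` carries the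
initial datum. -/
theorem RegularOn.ae_integral_inner_eq (h : StandingAssumptions L F)
    (r : RegularOn L F T τ v₀ v D G C) (hv : IsWeakSolution L F T v₀ v) (hτ : 0 < τ)
    (hτT : τ ≤ T) :
    ∀ᵐ t ∂(volume.restrict (Ioo 0 τ)),
      ∫ x in cell d, inner ℝ (v (t, x) - v₀ x) (sharp F (v (t, x))) =
        ∫ s in (0)..t, ∫ x in cell d, inner ℝ (v (s, x) - v₀ x) (D (s, x)) := by
  have hvτ := r.mem.mono_cylinder hτT
  have hv₀ := r.mem_initial.comp_snd τ
  have i1 : Integrable (fun p => (inner ℝ (v p - v₀ p.2) (sharp F (v p)) : ℝ))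
      (volume.restrict (cylinder d τ)) := by
    simp only [inner_sub_left]
    exact (hvτ.integrable_inner_sharp h hvτ).sub (hvτ.integrable_inner_sharp h hv₀)
  have i2 : Integrable (fun p => (inner ℝ (v p - v₀ p.2) (D p) : ℝ))
      (volume.restrict (cylinder d τ)) := by
    simp only [inner_sub_left]
    exact (r.integrable_inner_deriv h hτT hvτ).sub (r.integrable_inner_deriv h hτT hv₀)
  have i1' := i1
  have i2' := i2
  rw [volume_restrict_cylinder] at i1' i2'
  have key := ae_eq_add_integral_of_weak hτ (m₀ := 0) i1'.integral_prod_left i2'.integral_prod_left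
    fun θ hθ ⟨b, hb, hθb⟩ => by
      have e := r.integral_eq_zero h hτ hτT hθ hb hθb hv.weak
      have i3 : Integrable (fun p => (inner ℝ (v p - v₀ p.2) (testField F v D θ p) : ℝ) +
          frob (F (v p)) (θ p.1 • G p)) (volume.restrict (cylinder d τ)) := by
        simp only [inner_sub_left]
        exact ((r.integrable_inner_testField h hτT hθ hvτ).sub
          (r.integrable_inner_testField h hτT hθ hv₀)).add (r.integrable_frob_flux h hτT hθ)
      rw [mul_zero, neg_zero]
      refine Eq.trans (integral_congr_ae ?_) ((integral_cylinder i3).symm.trans e)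
      filter_upwards [ae_integrable_slice i1, ae_integrable_slice i2,
        ae_integrable_slice (r.integrable_frob_flux h hτT hθ),
        r.ae_integral_frob_eq_zero h hτ hτT] with t h1 h2 h3 h4
      have h5 : Integrable (fun x => deriv θ t * (inner ℝ (v (t, x) - v₀ x) (sharp F (v (t, x))) : ℝ)
          + θ t * (inner ℝ (v (t, x) - v₀ x) (D (t, x)) : ℝ)) (volume.restrict (cell d)) :=
        (h1.const_mul _).add (h2.const_mul _)
      simp only [testField, inner_add_right, real_inner_smul_right]
      rw [integral_add h5 h3, integral_add (h1.const_mul _) (h2.const_mul _), integral_const_mul,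
        integral_const_mul]
      simp only [frob_smul_right]
      rw [integral_const_mul, h4, mul_zero, add_zero]
  simpa only [zero_add] using key

/-- Three identities are combined: the one for `∫ (v - v₀)·v^#`, the chain rule `hA` for `∫
K^*(v^#)`, and `hB`, the fundamental theorem of calculus for `v^#` paired with `v₀`. The space-time
integrals of `v·D` and `v₀·D` cancel, and what is left says that `∫ (v·v^# - K^*(v^#))`, the total
entropy, keeps its initial value. -/
theorem RegularOn.ae_totalEntropy_eq (h : StandingAssumptions L F)
    (r : RegularOn L F T τ v₀ v D G C) (hv : IsWeakSolution L F T v₀ v) (hτ : 0 < τ)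
    (hτT : τ ≤ T) :
    ∀ᵐ t ∂(volume.restrict (Ioo 0 τ)), totalEntropy F v t = ∫ x in cell d, entropy F (v₀ x) := by
  obtain ⟨V, hVc, hV, hV'⟩ := exists_continuous_gradient_inverse h.nFunction h.strictConvex
    (h.contDiff_entropy.of_le one_le_two)
  have hvτ := r.mem.mono_cylinder hτT
  have hv₀ := r.mem_initial.comp_snd τ
  have iv := r.integrable_inner_deriv h hτT hvτ
  have iv₀ := r.integrable_inner_deriv h hτT hv₀
  have hW := r.ae_sharp_eq hτ hτT
  have hμ : ∀ᵐ s ∂(volume.restrict (Ioo 0 τ)),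
      ∫ x in cell d, inner ℝ (v (s, x) - v₀ x) (D (s, x)) =
        (∫ x in cell d, (inner ℝ (v (s, x)) (D (s, x)) : ℝ)) -
          ∫ x in cell d, (inner ℝ (v₀ x) (D (s, x)) : ℝ) := by
    filter_upwards [ae_integrable_slice iv, ae_integrable_slice iv₀] with s h1 h2
    rw [← integral_sub h1 h2]
    simp only [inner_sub_left]
  have iv' := iv
  have iv₀' := iv₀
  rw [volume_restrict_cylinder] at iv' iv₀'
  filter_upwards [r.ae_integral_inner_eq h hv hτ hτT, hvτ.ae_slice, ae_slice_of_ae hW,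
    ae_restrict_mem measurableSet_Ioo] with t h1 h2 h3 ht
  have hA : ∫ x in cell d, (legendre (entropy F) (sharp F (v (t, x))) -
      legendre (entropy F) (sharp F (v₀ x))) =
      ∫ s in (0)..t, ∫ x in cell d, inner ℝ (v (s, x)) (D (s, x)) := by
    refine integral_cell_eq_of_ae iv ht ?_
    filter_upwards [h3, ae_slice_of_ae' hW, ae_integrable_slice' r.integrable_deriv] with
      x hx hxs hxD
    rw [hx, legendre_add_integral_sub h.nFunction h.differentiable_entropy hVc hV ht.1.le
      (intervalIntegrable_of_Ioo hxD ht), intervalIntegral_eq_Ioo _ ht.1.le,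
      intervalIntegral_eq_Ioo _ ht.1.le]
    refine integral_congr_ae ?_
    have : ∀ᵐ s ∂(volume.restrict (Ioo 0 t)),
        sharp F (v (s, x)) = sharp F (v₀ x) + ∫ r in (0)..s, D (r, x) :=
      ae_mono (Measure.restrict_mono_set _ (Ioo_subset_Ioo_right ht.2.le)) hxs
    filter_upwards [this] with s hs
    rw [← hs]
    congr 1
    exact hV' (v (s, x))
  have hB : ∫ x in cell d, ((inner ℝ (v₀ x) (sharp F (v (t, x))) : ℝ) -
      inner ℝ (v₀ x) (sharp F (v₀ x))) =
      ∫ s in (0)..t, ∫ x in cell d, inner ℝ (v₀ x) (D (s, x)) := by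
    refine integral_cell_eq_of_ae (g := fun p => inner ℝ (v₀ p.2) (D p)) iv₀ ht ?_
    filter_upwards [h3, ae_integrable_slice' r.integrable_deriv] with x hx hxD
    rw [hx, inner_add_right, add_sub_cancel_left,
      integral_inner_const_left (intervalIntegrable_of_Ioo hxD ht)]
  have hM : ∫ s in (0)..t, ∫ x in cell d, inner ℝ (v (s, x) - v₀ x) (D (s, x)) =
      (∫ s in (0)..t, ∫ x in cell d, (inner ℝ (v (s, x)) (D (s, x)) : ℝ)) -
        ∫ s in (0)..t, ∫ x in cell d, (inner ℝ (v₀ x) (D (s, x)) : ℝ) := by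
    rw [← intervalIntegral.integral_sub
      (intervalIntegrable_of_Ioo iv'.integral_prod_left ht)
      (intervalIntegrable_of_Ioo iv₀'.integral_prod_left ht)]
    rw [intervalIntegral_eq_Ioo _ ht.1.le, intervalIntegral_eq_Ioo _ ht.1.le]
    exact integral_congr_ae
      (ae_mono (Measure.restrict_mono_set _ (Ioo_subset_Ioo_right ht.2.le)) hμ)
  rw [integral_sub (h2.integrable_legendre_sharp h) (r.mem_initial.integrable_legendre_sharp h)]
    at hA
  rw [integral_sub (h2.integrable_inner_sharp h r.mem_initial)
    (r.mem_initial.integrable_inner_sharp h r.mem_initial)] at hB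
  simp only [inner_sub_left] at h1 hM
  rw [integral_sub (h2.integrable_inner_sharp h h2)
    (h2.integrable_inner_sharp h r.mem_initial)] at h1
  rw [totalEntropy, h2.integral_entropy_eq h, r.mem_initial.integral_entropy_eq h]
  linarith

theorem IsStrongSolution.ae_totalEntropy_eq {κ : ℝ → ℝ} (h : StandingAssumptions L F)
    (hκ : IsWeight T κ) (hv₀ : MemOrlicz (entropy F) v₀ (volume.restrict (cell d)))
    (hv : IsStrongSolution L F T κ v₀ v) (hT : 0 < T) :
    ∀ᵐ t : ℝ, t ∈ Ioo 0 T → totalEntropy F v t = ∫ x in cell d, entropy F (v₀ x) := by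
  -- Times `τ < T` increasing to `T` exhaust the interval; the shift by 2 keeps `τ` positive already
  -- for `k = 0`.
  have key : ∀ k : ℕ, ∀ᵐ t : ℝ, t ∈ Ioo 0 (T * (1 - 1 / ((k : ℝ) + 2))) →
      totalEntropy F v t = ∫ x in cell d, entropy F (v₀ x) := fun k => by
    have hk : (1 : ℝ) / ((k : ℝ) + 2) < 1 := by
      rw [div_lt_one (by positivity)]
      linarith [(Nat.cast_nonneg k : (0 : ℝ) ≤ k)]
    have hk0 : (0 : ℝ) < 1 / ((k : ℝ) + 2) := by positivity
    have hτ : 0 < T * (1 - 1 / ((k : ℝ) + 2)) := mul_pos hT (by linarith)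
    have hτT : T * (1 - 1 / ((k : ℝ) + 2)) < T := by nlinarith
    obtain ⟨D, G, C, r⟩ := hv.exists_regularOn h hκ hv₀ hτ hτT
    exact (ae_restrict_iff' measurableSet_Ioo).1 (r.ae_totalEntropy_eq h hv.weak hτ hτT.le)
  filter_upwards [ae_all_iff.2 key] with t ht htm
  obtain ⟨k, hk⟩ := exists_nat_one_div_lt (show 0 < 1 - t / T by
    rw [sub_pos, div_lt_one hT]; exact htm.2)
  refine ht k ⟨htm.1, ?_⟩
  have h1 : (1 : ℝ) / ((k : ℝ) + 2) ≤ 1 / ((k : ℝ) + 1) := by gcongr; norm_num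
  rw [mul_comm, ← div_lt_iff₀ hT]
  linarith

end Conservation

end Dafermos

/-! ### Dafermos' principle. -/

theorem mainTheorem1 {d n N : ℕ} (L : Dafermos.DiffOp d n N)
    (F : EuclideanSpace ℝ (Fin n) → Matrix (Fin N) (Fin N) ℝ)
    (hLF : Dafermos.StandingAssumptions L F)
    (T : ℝ) (hT : 0 < T) (κ : ℝ → ℝ) (hκ : Dafermos.IsWeight T κ)
    (v₀ : (Fin d → ℝ) → EuclideanSpace ℝ (Fin n))
    (hv₀ : Dafermos.MemOrlicz (Dafermos.entropy F) v₀ (volume.restrict (Dafermos.cell d)))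
    (v : ℝ × (Fin d → ℝ) → EuclideanSpace ℝ (Fin n))
    (hv : Dafermos.IsStrongSolution L F T κ v₀ v)
    (u : ℝ × (Fin d → ℝ) → EuclideanSpace ℝ (Fin n))
    (M : ℝ × (Fin d → ℝ) → Matrix (Fin N) (Fin N) ℝ)
    (huM : Dafermos.IsSubsolution L F T v₀ u M) :
    (∀ᵐ t : ℝ, t ∈ Ioo 0 T →
      Dafermos.totalEntropy F v t = ∫ x in Dafermos.cell d, Dafermos.entropy F (v₀ x)) ∧
    (∀ t₀ t₁ : ℝ, 0 ≤ t₀ → t₀ < t₁ → t₁ ≤ T →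
      ¬ ((∀ᵐ t : ℝ, t ∈ Ioo 0 t₁ →
            Dafermos.subTotalEntropy F M t ≤ Dafermos.totalEntropy F v t) ∧
          (∀ᵐ t : ℝ, t ∈ Ioo t₀ t₁ →
            Dafermos.subTotalEntropy F M t < Dafermos.totalEntropy F v t))) ∧
    (∀ ε : ℝ, 0 < ε → ε ≤ T →
      ¬ ∀ᵐ t : ℝ, t ∈ Ioo 0 ε →
        Dafermos.subTotalEntropy F M t < Dafermos.totalEntropy F v t) := by
  exact ⟨hv.ae_totalEntropy_eq hLF hκ hv₀ hT,
    fun t₀ t₁ h0 h01 h1 h => hv.not_entropy_lt hLF hκ hv₀ huM h0 h01 h1 h.1 h.2,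
    fun ε hε hεT h => hv.not_entropy_lt hLF hκ hv₀ huM le_rfl hε hεT
      (h.mono fun t ht hm => (ht hm).le) h⟩
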